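/- Let $G=(V,E)$ be a simple undirected graph with $n=|V|$ vertices, $m=|E|$ edges and $p=\binom n2$ vertex pairs. A clustering $\zeta$ of $G$ is a partition of $V$. Let $i_e(\zeta)$ be the number of edges of $G$ with both endpoints in the same cluster, let $i_p(\zeta)=\sum_{C\in\zeta}\binom{|C|}{2}$, and define the surprise of $\zeta$ by $$S(\zeta)=\sum_{i=i_e(\zeta)}^{m}\frac{\binom{i_p(\zeta)}{i}\binom{p-i_p(\zeta)}{m-i}}{\binom{p}{m}}.$$ A clustering is surprise optimal if it minimizes $S$ among all clusterings of $G$. Theorem. There is an algorithm that, given any (unweighted) tree $T$ with $n$ vertices, computes a surprise optimal clustering of $T$ in $O(n^5)$ time. Here time is the number of steps of a word RAM whose words have $O(\log n)$ bits, the vertices are $0,\dots,n-1$, the input consists of $n$ and a list of the edges in arbitrary order, and the output is a cluster label for each vertex. -/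

import Mathlib

/-! ### Surprise of a clustering -/

namespace Surprise

variable {V : Type*} [Fintype V] [DecidableEq V]

/-- The number of edges of `G` having both endpoints in `C`. -/
noncomputable def clusterEdges (G : SimpleGraph V) (C : Finset V) : ℕ :=
  {e | e ∈ G.edgeSet ∧ ∀ v ∈ e, v ∈ C}.ncard

/-- The number `i_e` of intracluster edges of a clustering (a partition of the vertex set). -/
noncomputable def intraEdges (G : SimpleGraph V)
    (ζ : Finpartition (Finset.univ : Finset V)) : ℕ :=
  ∑ C ∈ ζ.parts, clusterEdges G C

/-- The number `i_p` of intracluster vertex pairs of a clustering. -/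
def intraPairs (ζ : Finpartition (Finset.univ : Finset V)) : ℕ :=
  ∑ C ∈ ζ.parts, C.card.choose 2

/-- The hypergeometric tail `S(i_p, i_e)` for a graph with `p` vertex pairs and `m` edges. -/
def hyperTail (p m ip ie : ℕ) : ℚ :=
  ∑ i ∈ Finset.Icc ie m, ((ip.choose i : ℚ) * ((p - ip).choose (m - i) : ℚ)) / (p.choose m : ℚ)

/-- The surprise `S(ζ)` of a clustering `ζ` of `G`. -/
noncomputable def surprise (G : SimpleGraph V)
    (ζ : Finpartition (Finset.univ : Finset V)) : ℚ :=
  hyperTail ((Fintype.card V).choose 2) G.edgeSet.ncard (intraPairs ζ) (intraEdges G ζ)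

/-- Smaller surprise is better: `ζ` is optimal if its surprise is minimum. -/
def IsOptimal (G : SimpleGraph V) (ζ : Finpartition (Finset.univ : Finset V)) : Prop :=
  ∀ ζ' : Finpartition (Finset.univ : Finset V), surprise G ζ ≤ surprise G ζ'

end Surprise

/-! ### A word RAM

The machine has registers and a random access memory, all of whose cells hold natural numbers
below a word bound `W`. Programs are structured (sequence, conditional, loop) and do not depend
on the input. Every instruction and every evaluation of a test takes one step. An instruction
whose result would reach `W` cannot be executed, so a program that halts never overflows. -/

namespace WordRAM

/-- Arithmetic instructions: addition, truncated subtraction, multiplication, and division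
rounded down (with `x / 0 = 0`). -/
inductive Op
  | add | sub | mul | div

/-- The value computed by an arithmetic instruction. -/
def Op.eval : Op → ℕ → ℕ → ℕ
  | .add, x, y => x + y
  | .sub, x, y => x - y
  | .mul, x, y => x * y
  | .div, x, y => x / y

/-- Programs. Below, `R i` is register `i` and `M a` is the memory cell with address `a`. -/
inductive Prog
  /-- do nothing -/
  | skip
  /-- `R i := k` -/
  | const (i k : ℕ)
  /-- `R i := R j ∘ R k` -/
  | arith (o : Op) (i j k : ℕ)
  /-- `R i := M (R j)` -/
  | load (i j : ℕ)
  /-- `M (R i) := R j` -/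
  | store (i j : ℕ)
  /-- `P`, then `Q` -/
  | seq (P Q : Prog)
  /-- if `R i < R j` then `P` else `Q` -/
  | ifLt (i j : ℕ) (P Q : Prog)
  /-- as long as `R i < R j`, repeat `P` -/
  | whileLt (i j : ℕ) (P : Prog)

/-- A configuration of the machine. -/
structure State where
  reg : ℕ → ℕ
  mem : ℕ → ℕ

/-- Write the value `x` into register `i`. -/
def State.setReg (s : State) (i x : ℕ) : State := { s with reg := Function.update s.reg i x }

/-- Write the value `x` into the memory cell with address `a`. -/
def State.setMem (s : State) (a x : ℕ) : State := { s with mem := Function.update s.mem a x }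

/-- `Runs W P s t s'`: with word bound `W`, the program `P` started in `s` halts after exactly
`t` steps in `s'`. -/
inductive Runs (W : ℕ) : Prog → State → ℕ → State → Prop
  | skip (s : State) : Runs W .skip s 1 s
  | const (s : State) (i k : ℕ) (h : k < W) : Runs W (.const i k) s 1 (s.setReg i k)
  | arith (s : State) (o : Op) (i j k : ℕ) (h : o.eval (s.reg j) (s.reg k) < W) :
      Runs W (.arith o i j k) s 1 (s.setReg i (o.eval (s.reg j) (s.reg k)))
  | load (s : State) (i j : ℕ) (h : s.mem (s.reg j) < W) :
      Runs W (.load i j) s 1 (s.setReg i (s.mem (s.reg j)))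
  | store (s : State) (i j : ℕ) : Runs W (.store i j) s 1 (s.setMem (s.reg i) (s.reg j))
  | seq {P Q : Prog} {s s₁ s₂ : State} {t₁ t₂ : ℕ} (h₁ : Runs W P s t₁ s₁)
      (h₂ : Runs W Q s₁ t₂ s₂) : Runs W (.seq P Q) s (t₁ + t₂) s₂
  | ifTrue {i j : ℕ} {P Q : Prog} {s s₁ : State} {t : ℕ} (hlt : s.reg i < s.reg j)
      (h : Runs W P s t s₁) : Runs W (.ifLt i j P Q) s (t + 1) s₁
  | ifFalse {i j : ℕ} {P Q : Prog} {s s₁ : State} {t : ℕ} (hge : ¬ s.reg i < s.reg j)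
      (h : Runs W Q s t s₁) : Runs W (.ifLt i j P Q) s (t + 1) s₁
  | whileTrue {i j : ℕ} {P : Prog} {s s₁ s₂ : State} {t₁ t₂ : ℕ} (hlt : s.reg i < s.reg j)
      (h₁ : Runs W P s t₁ s₁) (h₂ : Runs W (.whileLt i j P) s₁ t₂ s₂) :
      Runs W (.whileLt i j P) s (t₁ + t₂ + 1) s₂
  | whileFalse {i j : ℕ} {P : Prog} {s : State} (hge : ¬ s.reg i < s.reg j) :
      Runs W (.whileLt i j P) s 1 s

/-- `L` lists every edge of `G` exactly once, in any order, each with its endpoints in either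
order. -/
def IsEdgeList {n : ℕ} (G : SimpleGraph (Fin n)) (L : List (Fin n × Fin n)) : Prop :=
  (L.map (fun q => s(q.1, q.2))).Nodup ∧
    ∀ e : Sym2 (Fin n), e ∈ L.map (fun q => s(q.1, q.2)) ↔ e ∈ G.edgeSet

/-- The input as a sequence of words: the number of vertices, then the endpoints of the edges. -/
def inputWords {n : ℕ} (L : List (Fin n × Fin n)) : List ℕ :=
  n :: L.flatMap (fun q => [(q.1 : ℕ), (q.2 : ℕ)])

/-- Initially the input occupies the first memory cells; all else is zero. -/
def initState {n : ℕ} (L : List (Fin n × Fin n)) : State where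
  reg := fun _ => 0
  mem := fun a => (inputWords L).getD a 0

/-- The first `n` memory cells of `s` hold cluster labels of the vertices `0, …, n - 1`: two
vertices are in the same cluster of `ζ` exactly if their labels agree. -/
def Outputs {n : ℕ} (s : State) (ζ : Finpartition (Finset.univ : Finset (Fin n))) : Prop :=
  ∀ u v : Fin n, s.mem u = s.mem v ↔ ζ.part u = ζ.part v

end WordRAM

/-!
For fixed numbers of vertices and edges the surprise depends only on the pair `(i_p, i_e)`, and it
increases with `i_p`. Splitting the clusters of a clustering of a tree into their connected
components keeps `i_e` and does not increase `i_p`, so only the clusterings need to be considered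
that arise by deleting some edges of the tree and keeping the others, and for each number `k` of
kept edges only one with the least number of intracluster pairs. Removing the vertices of the tree
leaf by leaf, one computes for every vertex, every size of the cluster at the top of the part below
it and every `k` the least number of intracluster pairs in that part: joining two parts along an
edge means to run through at most `n ^ 4` pairs of entries, for each of the `n - 1` edges.

The `n` candidates at the root are compared exactly, by the numerators of their hypergeometric
tails. If the entries below `k` of row `i_p` of Pascal's triangle are erased and the row is then
developed `p - i_p` steps further by the recurrence of Pascal's triangle, entry `m` becomes the
numerator. Entries are numbers with `n` digits in a base polynomial in `n`, so that the at most
`n ^ 2` steps for one candidate, each of which adds `n` pairs of entries, take time `O(n ^ 4)`.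

The algorithm is written in a language of bounded loops, where the exponent of the running time can
be read off as the nesting depth of the loops, and compiled for the word RAM.
-/

namespace LoopLang
open WordRAM Filter

/-! ### A language of bounded loops -/

section Language
variable {A : Type}

/-- The contents of named arrays; a scalar variable is the entry of an array at index `0`. -/
abbrev Store (A : Type) := A → ℕ → ℕ

/-- Write `w` into the entry of `b` at `i`. -/
def Store.set [DecidableEq A] (σ : Store A) (b : A) (i w : ℕ) : Store A :=
  fun b' i' => if b' = b ∧ i' = i then w else σ b' i'

/-- Expressions; `len` is the number `n` of vertices. -/
inductive Ex (A : Type)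
  | lit (k : ℕ)
  | len
  | get (b : A) (e : Ex A)
  | op (o : Op) (e f : Ex A)

/-- The value of an expression. -/
def Ex.eval (n : ℕ) (σ : Store A) : Ex A → ℕ
  | .lit k => k
  | .len => n
  | .get b e => σ b (e.eval n σ)
  | .op o e f => o.eval (e.eval n σ) (f.eval n σ)

/-- The expression with value `n ^ k`. -/
def Ex.lenPow : ℕ → Ex A
  | 0 => .lit 1
  | k + 1 => .op .mul (lenPow k) .len

lemma Ex.eval_lenPow (n k : ℕ) (σ : Store A) : (lenPow k).eval n σ = n ^ k := by
  induction k with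
  | zero => rfl
  | succ k ih => rw [pow_succ, ← ih]; rfl

/-- The expression for the minimum of `e` and `n ^ k`. -/
def Ex.minLenPow (e : Ex A) (k : ℕ) : Ex A := .op .sub e (.op .sub e (lenPow k))

lemma Ex.eval_minLenPow (e : Ex A) (n k : ℕ) (σ : Store A) :
    (e.minLenPow k).eval n σ = min (e.eval n σ) (n ^ k) := by
  rw [← eval_lenPow n k σ]
  exact Nat.sub_sub_eq_min _ _

/-- Statements. The loop `loop x k e P` runs `P` for `x = 0, 1, …`, at most `e` times and at most
`n ^ k` times. -/
inductive Stmt (A : Type)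
  | skip
  | put (b : A) (i e : Ex A)
  | seq (P Q : Stmt A)
  | ite (e f : Ex A) (P Q : Stmt A)
  | loop (x : A) (k : ℕ) (e : Ex A) (P : Stmt A)

/-- The bound below which the values in a store stay. -/
def cap (n : ℕ) : ℕ := (n + 2) ^ 4

/-- Truncation to values below the bound, replacing larger ones by `0`; it makes the semantics of
statements total and free of overflow. -/
def clamp (n w : ℕ) : ℕ := if w < cap n then w else 0

/-- Run `body i` for `i = 0, …, m - 1`. -/
def iter {α : Type*} (body : ℕ → α → α) : ℕ → α → α
  | 0, a => a
  | m + 1, a => body m (iter body m a)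

/-- The effect of a statement. -/
def Stmt.run [DecidableEq A] (n : ℕ) : Stmt A → Store A → Store A
  | .skip, σ => σ
  | .put b i e, σ => σ.set b (i.eval n σ) (clamp n (e.eval n σ))
  | .seq P Q, σ => Q.run n (P.run n σ)
  | .ite e f P Q, σ => if e.eval n σ < f.eval n σ then P.run n σ else Q.run n σ
  | .loop x k e P, σ =>
      iter (fun i τ => P.run n (τ.set x 0 (clamp n i))) (min (e.eval n σ) (n ^ k)) σ

/-- The exponent of the running time. -/
def Stmt.deg : Stmt A → ℕ
  | .skip => 0
  | .put _ _ _ => 0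
  | .seq P Q => max P.deg Q.deg
  | .ite _ _ P Q => max P.deg Q.deg
  | .loop _ k _ P => k + P.deg

lemma cap_pos (n : ℕ) : 0 < cap n := by
  unfold cap
  positivity

lemma clamp_lt (n w : ℕ) : clamp n w < cap n := by
  unfold clamp
  split_ifs with hw
  exacts [hw, cap_pos n]

lemma Op.eval_lt_mul (o : Op) {x y X Y : ℕ} (hx : x < X) (hy : y < Y) : o.eval x y < X * Y := by
  cases o <;> simp only [Op.eval]
  · nlinarith
  · exact (Nat.sub_le x y).trans_lt (hx.trans_le (Nat.le_mul_of_pos_right X (by omega)))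
  · exact Nat.mul_lt_mul'' hx hy
  · exact (Nat.div_le_self x y).trans_lt (hx.trans_le (Nat.le_mul_of_pos_right X (by omega)))

lemma Ex.exists_eval_lt (e : Ex A) : ∃ c, ∀ n, ∀ σ : Store A, (∀ b i, σ b i < cap n) →
    e.eval n σ < (n + 2) ^ c := by
  induction e with
  | lit k =>
    exact ⟨k, fun n σ _ => Nat.lt_pow_self (by omega)⟩
  | len => exact ⟨1, fun n σ _ => by simp [eval]⟩
  | get b e _ => exact ⟨4, fun n σ hσ => hσ _ _⟩
  | op o e f ihe ihf =>
    obtain ⟨c, hc⟩ := ihe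
    obtain ⟨c', hc'⟩ := ihf
    exact ⟨c + c', fun n σ hσ => by
      rw [pow_add]; exact Op.eval_lt_mul o (hc n σ hσ) (hc' n σ hσ)⟩

lemma Ex.eventually_eval_lt (e : Ex A) : ∀ᶠ c in atTop, ∀ n, ∀ σ : Store A,
    (∀ b i, σ b i < cap n) → e.eval n σ < (n + 2) ^ c := by
  obtain ⟨c, hc⟩ := e.exists_eval_lt
  filter_upwards [eventually_ge_atTop c] with c' hc' n σ hσ
  exact (hc n σ hσ).trans_le (Nat.pow_le_pow_right (by omega) hc')

end Language

/-! ### Timed execution -/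

/-- With word bound `W`, the program `P` started in `s` halts within `T` steps in a state
satisfying `Q`. -/
def Exec (W : ℕ) (P : Prog) (s : State) (T : ℕ) (Q : State → Prop) : Prop :=
  ∃ t s', Runs W P s t s' ∧ t ≤ T ∧ Q s'

section Exec
variable {W T T' : ℕ} {P P' : Prog} {s : State} {Q Q' : State → Prop}

lemma Exec.mono (h : Exec W P s T Q) (hT : T ≤ T') (hQ : ∀ s', Q s' → Q' s') :
    Exec W P s T' Q' := by
  obtain ⟨t, s', hrun, ht, hs'⟩ := h
  exact ⟨t, s', hrun, ht.trans hT, hQ _ hs'⟩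

lemma Exec.skip (h : Q s) : Exec W .skip s 1 Q := ⟨1, _, .skip s, le_rfl, h⟩

lemma Exec.const {i k : ℕ} (hk : k < W) (h : Q (s.setReg i k)) : Exec W (.const i k) s 1 Q :=
  ⟨1, _, .const s i k hk, le_rfl, h⟩

lemma Exec.arith {o : Op} {i j k : ℕ} (hk : o.eval (s.reg j) (s.reg k) < W)
    (h : Q (s.setReg i (o.eval (s.reg j) (s.reg k)))) : Exec W (.arith o i j k) s 1 Q :=
  ⟨1, _, .arith s o i j k hk, le_rfl, h⟩

lemma Exec.load {i j : ℕ} (hk : s.mem (s.reg j) < W) (h : Q (s.setReg i (s.mem (s.reg j)))) :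
    Exec W (.load i j) s 1 Q :=
  ⟨1, _, .load s i j hk, le_rfl, h⟩

lemma Exec.store {i j : ℕ} (h : Q (s.setMem (s.reg i) (s.reg j))) :
    Exec W (.store i j) s 1 Q :=
  ⟨1, _, .store s i j, le_rfl, h⟩

lemma Exec.seq (h : Exec W P s T fun s' => Exec W P' s' T' Q) :
    Exec W (.seq P P') s (T + T') Q := by
  obtain ⟨t, s', hrun, ht, t', s'', hrun', ht', hs''⟩ := h
  exact ⟨_, _, .seq hrun hrun', by omega, hs''⟩

lemma Exec.ifLt {i j : ℕ} (h : s.reg i < s.reg j → Exec W P s T Q)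
    (h' : ¬ s.reg i < s.reg j → Exec W P' s T Q) : Exec W (.ifLt i j P P') s (T + 1) Q := by
  by_cases hlt : s.reg i < s.reg j
  · obtain ⟨t, s', hrun, ht, hs'⟩ := h hlt
    exact ⟨_, _, .ifTrue hlt hrun, by omega, hs'⟩
  · obtain ⟨t, s', hrun, ht, hs'⟩ := h' hlt
    exact ⟨_, _, .ifFalse hlt hrun, by omega, hs'⟩

lemma Exec.whileLt {i j M : ℕ} (I : ℕ → State → Prop)
    (hI : ∀ m s, I m s → s.reg i = m ∧ s.reg j = M)
    (hP : ∀ m s, m < M → I m s → Exec W P s T (I (m + 1))) (h : I 0 s) :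
    Exec W (.whileLt i j P) s (M * (T + 1) + 1) (I M) := by
  have from_counter : ∀ r m s, m + r = M → I m s →
      Exec W (.whileLt i j P) s (r * (T + 1) + 1) (I M) := by
    intro r
    induction r with
    | zero =>
      intro m s hm hs
      obtain ⟨hi, hj⟩ := hI _ _ hs
      exact ⟨1, s, .whileFalse (by omega), by omega, by rwa [← hm]⟩
    | succ r ih =>
      intro m s hm hs
      obtain ⟨hi, hj⟩ := hI _ _ hs
      obtain ⟨t, s', hrun, ht, hs'⟩ := hP m s (by omega) hs
      obtain ⟨t', s'', hrun', ht', hs''⟩ := ih (m + 1) s' (by omega) hs'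
      exact ⟨_, _, .whileTrue (by omega) hrun hrun', by rw [Nat.succ_mul]; omega, hs''⟩
  exact from_counter M 0 s (Nat.zero_add M) h

end Exec

/-! ### Compilation -/

/-- The injective pairing of natural numbers used for addresses and for arrays with several
indices; unlike `Nat.pair` it is computed without a case distinction. -/
def sqPair (x y : ℕ) : ℕ := (x + y) * (x + y) + y

@[simp]
lemma sqPair_inj {x y x' y' : ℕ} : sqPair x y = sqPair x' y' ↔ x = x' ∧ y = y' := by
  refine ⟨fun h => ?_, fun ⟨hx, hy⟩ => by rw [hx, hy]⟩
  unfold sqPair at h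
  have hsum : x + y = x' + y' := by
    rcases lt_trichotomy (x + y) (x' + y') with hlt | heq | hlt
    · nlinarith
    · exact heq
    · nlinarith
  rw [hsum] at h
  omega

/-- The expression for `2 n + sqPair k i`, which bounds the addresses used. -/
def Ex.pairAddr {A : Type} (k : ℕ) (e : Ex A) : Ex A :=
  .op .add (.op .add .len .len) (.op .add (.op .mul (.op .add (.lit k) e) (.op .add (.lit k) e)) e)

lemma Ex.eventually_pairAddr_lt {A : Type} (k : ℕ) (e : Ex A) : ∀ᶠ c in atTop, ∀ n, ∀ σ : Store A,
    (∀ b i, σ b i < cap n) → 2 * n + sqPair k (e.eval n σ) < (n + 2) ^ c := by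
  filter_upwards [(e.pairAddr k).eventually_eval_lt] with c hc n σ hσ
  rw [two_mul]
  exact hc n σ hσ

section Compile
variable {A : Type} [DecidableEq A] [Encodable A] [Inhabited A]

/-- The address of the entry of `b` at `i`. The array `default` starts in the first `2 n` cells,
where the machine expects input and output. -/
def addr (n : ℕ) (b : A) (i : ℕ) : ℕ :=
  if b = default ∧ i < 2 * n then i else 2 * n + sqPair (Encodable.encode b) i

lemma addr_inj {n : ℕ} {b b' : A} {i i' : ℕ} :
    addr n b i = addr n b' i' ↔ b = b' ∧ i = i' := by
  refine ⟨fun h => ?_, fun ⟨hb, hi⟩ => by rw [hb, hi]⟩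
  unfold addr at h
  split_ifs at h with hio hio' hio'
  · exact ⟨hio.1.trans hio'.1.symm, h⟩
  · omega
  · omega
  · rw [Nat.add_left_cancel_iff, sqPair_inj] at h
    exact ⟨Encodable.encode_injective h.1, h.2⟩

/-- The machine state `s` represents the store `σ`. Registers from `3` on are scratch space, used
as a stack: code at depth `d` writes only registers from `d` on. -/
structure Good (n : ℕ) (σ : Store A) (s : State) : Prop where
  reg_zero : s.reg 0 = n
  reg_one : s.reg 1 = 2 * n
  reg_two : s.reg 2 = cap n
  mem_addr : ∀ b i, s.mem (addr n b i) = σ b i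
  lt_cap : ∀ b i, σ b i < cap n

/-- Between `s` and `s'` the value `x` was pushed into register `d`. -/
structure Pushes (s : State) (d x : ℕ) (s' : State) : Prop where
  mem : s'.mem = s.mem
  reg_self : s'.reg d = x
  reg_of_lt : ∀ r < d, s'.reg r = s.reg r

lemma pushes_setReg (s : State) (d x : ℕ) : Pushes s d x (s.setReg d x) where
  mem := rfl
  reg_self := Function.update_self ..
  reg_of_lt _ hr := Function.update_of_ne hr.ne ..

lemma Pushes.push {s s' s'' : State} {d d' x y : ℕ} (h : Pushes s d x s')
    (h' : Pushes s' d' y s'') (hd : d < d') : Pushes s d x s'' where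
  mem := h'.mem.trans h.mem
  reg_self := (h'.reg_of_lt d hd).trans h.reg_self
  reg_of_lt r hr := (h'.reg_of_lt r (hr.trans hd)).trans (h.reg_of_lt r hr)

lemma Pushes.pop {s s' s'' : State} {d x y : ℕ} (h : Pushes s d x s')
    (h' : Pushes s' d y s'') : Pushes s d y s'' where
  mem := h'.mem.trans h.mem
  reg_self := h'.reg_self
  reg_of_lt r hr := (h'.reg_of_lt r hr).trans (h.reg_of_lt r hr)

lemma Pushes.setReg {s s' : State} {d d' x : ℕ} (h : Pushes s d' x s') (hd : d ≤ d') (y : ℕ) :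
    Pushes s d y (s'.setReg d y) where
  mem := h.mem
  reg_self := Function.update_self ..
  reg_of_lt r hr := (Function.update_of_ne hr.ne ..).trans (h.reg_of_lt r (hr.trans_le hd))

lemma Good.of_pushes {n d x : ℕ} {σ : Store A} {s s' : State} (h : Good n σ s) (hd : 3 ≤ d)
    (hs' : Pushes s d x s') : Good n σ s' where
  reg_zero := (hs'.reg_of_lt 0 (by omega)).trans h.reg_zero
  reg_one := (hs'.reg_of_lt 1 (by omega)).trans h.reg_one
  reg_two := (hs'.reg_of_lt 2 (by omega)).trans h.reg_two
  mem_addr := by rw [hs'.mem]; exact h.mem_addr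
  lt_cap := h.lt_cap

lemma Good.set {n d i w : ℕ} {b : A} {σ : Store A} {s s' : State} (h : Good n σ s) (hd : 3 ≤ d)
    (hmem : s'.mem = Function.update s.mem (addr n b i) (clamp n w))
    (hreg : ∀ r < d, s'.reg r = s.reg r) : Good n (σ.set b i (clamp n w)) s' where
  reg_zero := (hreg 0 (by omega)).trans h.reg_zero
  reg_one := (hreg 1 (by omega)).trans h.reg_one
  reg_two := (hreg 2 (by omega)).trans h.reg_two
  mem_addr b' i' := by
    simp only [hmem, Function.update_apply, addr_inj, h.mem_addr, Store.set]
  lt_cap b' i' := by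
    unfold Store.set
    split_ifs
    exacts [clamp_lt n w, h.lt_cap b' i']

/-- Replace the value `i` in register `d` by `2 n + sqPair k i`. -/
def pairCode (k d : ℕ) : Prog :=
  .seq (.const (d + 1) k) <| .seq (.arith .add (d + 1) (d + 1) d) <|
    .seq (.arith .mul (d + 1) (d + 1) (d + 1)) <| .seq (.arith .add d (d + 1) d) <|
      .arith .add d 1 d

/-- Replace an index `i` in register `d` by the address of the entry of `b` at `i`. -/
def addrCode (b : A) (d : ℕ) : Prog :=
  if b = default then .ifLt d 1 .skip (pairCode (Encodable.encode b) d)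
  else pairCode (Encodable.encode b) d

/-- Truncate the value in register `d`. -/
def clampCode (d : ℕ) : Prog := .ifLt d 2 .skip (.const d 0)

/-- Write a value into the entry of `b` at an index, where `I` pushes the index into register `d`
and `V` pushes the value into register `d + 1`. -/
def writeCode (b : A) (d : ℕ) (I V : Prog) : Prog :=
  .seq I <| .seq (addrCode b d) <| .seq V <| .seq (clampCode (d + 1)) (.store d (d + 1))

/-- Code that pushes the value of an expression into register `d`. -/
def Ex.comp : Ex A → ℕ → Prog
  | .lit k, d => .const d k
  | .len, d => .seq (.const d 0) (.arith .add d d 0)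
  | .get b e, d => .seq (e.comp d) (.seq (addrCode b d) (.load d d))
  | .op o e f, d => .seq (e.comp d) (.seq (f.comp (d + 1)) (.arith o d d (d + 1)))

/-- Code for one iteration of a loop with variable `x`, body `P` and its counter in register
`d`. -/
def loopBody (x : A) (d : ℕ) (P : Prog) : Prog :=
  .seq (writeCode x (d + 1) (.const (d + 1) 0)
      (.seq (.const (d + 2) 0) (.arith .add (d + 2) (d + 2) d))) <|
    .seq P <| .seq (.const (d + 1) 1) (.arith .add d d (d + 1))

/-- Code for a statement at depth `d`. A loop holds its bound in register `d` and its counter in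
register `d + 1`. -/
def Stmt.comp : Stmt A → ℕ → Prog
  | .skip, _ => .skip
  | .put b i e, d => writeCode b d (i.comp d) (e.comp (d + 1))
  | .seq P Q, d => .seq (P.comp d) (Q.comp d)
  | .ite e f P Q, d =>
      .seq (e.comp d) <| .seq (f.comp (d + 1)) <| .ifLt d (d + 1) (P.comp d) (Q.comp d)
  | .loop x k e P, d =>
      .seq ((e.minLenPow k).comp d) <| .seq (.const (d + 1) 0) <|
        .whileLt (d + 1) d (loopBody x (d + 1) (P.comp (d + 2)))

/-! ### Correctness of the compilation -/

/-- The program `P` pushes the value `v σ` into register `d` within `T` steps. -/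
def Evaluates (W n d : ℕ) (P : Prog) (v : Store A → ℕ) (T : ℕ) : Prop :=
  ∀ σ s, Good n σ s → Exec W P s T (Pushes s d (v σ))

/-- The program `P`, which uses the registers from `d` on, has the effect `f` on the represented
store and takes at most `T` steps. -/
def Simulates (W n d : ℕ) (P : Prog) (f : Store A → Store A) (T : ℕ) : Prop :=
  ∀ σ s, Good n σ s → Exec W P s T fun s' => Good n (f σ) s' ∧ ∀ r < d, s'.reg r = s.reg r

lemma Exec.pairCode {W n k d : ℕ} {s : State} (hd : 1 < d) (hs : s.reg 1 = 2 * n)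
    (hW : 2 * n + sqPair k (s.reg d) < W) :
    Exec W (pairCode k d) s 5 (Pushes s d (2 * n + sqPair k (s.reg d))) := by
  have hle := Nat.le_mul_self (k + s.reg d)
  have hone : 1 ≠ d + 1 := by omega
  unfold sqPair at hW ⊢
  refine .seq (T := 1) (T' := 4) (.const ?_ <| .seq (T := 1) (T' := 3) <| .arith ?_ <|
    .seq (T := 1) (T' := 2) <| .arith ?_ <| .seq (T := 1) (T' := 1) <| .arith ?_ <|
      .arith ?_ ⟨rfl, ?_, fun r hr => ?_⟩)
  any_goals simp only [State.setReg, Op.eval, Function.update_apply, hs, hd.ne, hone,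
    left_eq_add, one_ne_zero, ↓reduceIte]
  any_goals omega
  simp [hr.ne, (hr.trans (Nat.lt_succ_self d)).ne]

lemma Exec.addrCode {W n d : ℕ} {b : A} {s : State} (hd : 1 < d) (hs : s.reg 1 = 2 * n)
    (hW : 2 * n + sqPair (Encodable.encode b) (s.reg d) < W) :
    Exec W (addrCode b d) s 6 (Pushes s d (addr n b (s.reg d))) := by
  have hpair := Exec.pairCode hd hs hW
  by_cases hb : b = default
  · simp only [LoopLang.addrCode, addr, hb, ↓reduceIte, true_and]
    rw [hb] at hpair
    refine .ifLt (fun hlt => ?_) (fun hge => ?_)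
    · rw [hs] at hlt
      rw [if_pos hlt]
      exact (Exec.skip ⟨rfl, rfl, fun _ _ => rfl⟩).mono (by omega) fun _ => id
    · rw [hs] at hge
      rwa [if_neg hge]
  · simp only [LoopLang.addrCode, addr, hb, ↓reduceIte, false_and]
    exact hpair.mono (by omega) fun _ => id

lemma Good.exec_addrCode {W n d i : ℕ} {b : A} {σ : Store A} {s s' : State} (hσ : Good n σ s)
    (hd : 3 ≤ d) (hs' : Pushes s d i s') (hW : 2 * n + sqPair (Encodable.encode b) i < W) :
    Exec W (addrCode b d) s' 6 (Pushes s d (addr n b i)) := by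
  have haddr := Exec.addrCode (W := W) (d := d) (b := b) (by omega) (hσ.of_pushes hd hs').reg_one
    (by rwa [hs'.reg_self])
  rw [hs'.reg_self] at haddr
  exact haddr.mono le_rfl fun _ => hs'.pop

lemma Exec.clampCode {W n d : ℕ} {s : State} (hs : s.reg 2 = cap n) (hW : 0 < W) :
    Exec W (clampCode d) s 2 (Pushes s d (clamp n (s.reg d))) := by
  unfold clamp
  rw [← hs]
  refine .ifLt (fun hlt => ?_) (fun hge => ?_)
  · rw [if_pos hlt]
    exact .skip ⟨rfl, rfl, fun _ _ => rfl⟩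
  · rw [if_neg hge]
    exact .const hW (pushes_setReg s d 0)

lemma Exec.copy {W i j : ℕ} {s : State} (hij : j < i) (hW : s.reg j < W) :
    Exec W (.seq (.const i 0) (.arith .add i i j)) s 2 (Pushes s i (s.reg j)) := by
  have hval : Op.add.eval ((s.setReg i 0).reg i) ((s.setReg i 0).reg j) = s.reg j := by
    simp [Op.eval, State.setReg, hij.ne]
  refine .seq (T := 1) (T' := 1) (.const (by omega) (.arith (by rwa [hval]) ?_))
  rw [hval]
  exact (pushes_setReg s i 0).setReg le_rfl _

lemma Exec.writeCode {W n d i w T T' : ℕ} {b : A} {I V : Prog} {σ : Store A} {s : State}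
    (hd : 3 ≤ d) (hσ : Good n σ s) (hW : 2 * n + sqPair (Encodable.encode b) i < W)
    (hI : Exec W I s T (Pushes s d i))
    (hV : ∀ s', Pushes s d (addr n b i) s' → Exec W V s' T' (Pushes s' (d + 1) w)) :
    Exec W (writeCode b d I V) s (T + (6 + (T' + (2 + 1)))) fun s' =>
      Good n (σ.set b i (clamp n w)) s' ∧ ∀ r < d, s'.reg r = s.reg r := by
  refine .seq (hI.mono le_rfl fun s₁ h₁ => .seq ?_)
  refine (hσ.exec_addrCode hd h₁ hW).mono le_rfl fun s₂ h₂ => .seq ?_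
  refine (hV s₂ h₂).mono le_rfl fun s₃ h₃ => .seq ?_
  have hgood := hσ.of_pushes hd (h₂.push h₃ d.lt_succ_self)
  have hclamp := Exec.clampCode (d := d + 1) hgood.reg_two (Nat.zero_lt_of_lt hW)
  rw [h₃.reg_self] at hclamp
  refine hclamp.mono le_rfl fun s₄ h₄ => Exec.store ?_
  have hs₄ := h₂.push (h₃.pop h₄) d.lt_succ_self
  refine ⟨hσ.set hd ?_ hs₄.reg_of_lt, hs₄.reg_of_lt⟩
  simp only [State.setMem, hs₄.mem, hs₄.reg_self, h₄.reg_self]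

lemma Evaluates.get {W n d T : ℕ} {b : A} {P : Prog} {v : Store A → ℕ} (hd : 3 ≤ d)
    (hP : Evaluates W n d P v T)
    (hW : ∀ σ : Store A, (∀ b i, σ b i < cap n) →
      2 * n + sqPair (Encodable.encode b) (v σ) < W ∧ cap n ≤ W) :
    Evaluates W n d (.seq P (.seq (addrCode b d) (.load d d))) (fun σ => σ b (v σ))
      (T + (6 + 1)) := by
  intro σ s hσ
  obtain ⟨haddrW, hcapW⟩ := hW σ hσ.lt_cap
  refine .seq ((hP σ s hσ).mono le_rfl fun s₁ h₁ => .seq ?_)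
  refine (hσ.exec_addrCode hd h₁ haddrW).mono le_rfl fun s₂ h₂ => ?_
  have hload : s₂.mem (s₂.reg d) = σ b (v σ) := by
    rw [h₂.reg_self, h₂.mem, hσ.mem_addr]
  refine .load ?_ ?_ <;> rw [hload]
  · exact (hσ.lt_cap _ _).trans_le hcapW
  · exact h₂.setReg le_rfl _

lemma Evaluates.op {W n d T T' : ℕ} {o : Op} {P P' : Prog} {v v' : Store A → ℕ} (hd : 3 ≤ d)
    (hP : Evaluates W n d P v T) (hP' : Evaluates W n (d + 1) P' v' T')
    (hW : ∀ σ : Store A, (∀ b i, σ b i < cap n) → o.eval (v σ) (v' σ) < W) :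
    Evaluates W n d (.seq P (.seq P' (.arith o d d (d + 1)))) (fun σ => o.eval (v σ) (v' σ))
      (T + (T' + 1)) := by
  intro σ s hσ
  refine .seq ((hP σ s hσ).mono le_rfl fun s₁ h₁ => .seq ?_)
  refine (hP' σ s₁ (hσ.of_pushes hd h₁)).mono le_rfl fun s₂ h₂ => ?_
  have hs₂ := h₁.push h₂ d.lt_succ_self
  refine .arith ?_ ?_ <;> rw [hs₂.reg_self, h₂.reg_self]
  · exact hW σ hσ.lt_cap
  · exact hs₂.setReg le_rfl _

lemma cap_le_pow {c n : ℕ} (hc : 4 ≤ c) : cap n ≤ (n + 2) ^ c :=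
  Nat.pow_le_pow_right (by omega) hc

lemma Ex.evaluates_comp (e : Ex A) : ∃ T, ∀ᶠ c in atTop, ∀ n d, 3 ≤ d →
    Evaluates ((n + 2) ^ c) n d (e.comp d) (e.eval n) T := by
  induction e with
  | lit k =>
    refine ⟨1, ?_⟩
    filter_upwards [(Ex.lit k : Ex A).eventually_eval_lt] with c hc n d _ σ s hσ
    exact .const (hc n σ hσ.lt_cap) (pushes_setReg s d k)
  | len =>
    refine ⟨2, ?_⟩
    filter_upwards [(Ex.len : Ex A).eventually_eval_lt] with c hc n d hd σ s hσ
    have hcopy := Exec.copy (s := s) (show 0 < d by omega) (hσ.reg_zero ▸ hc n σ hσ.lt_cap)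
    rwa [hσ.reg_zero] at hcopy
  | get b e ih =>
    obtain ⟨T, hT⟩ := ih
    refine ⟨T + (6 + 1), ?_⟩
    filter_upwards [hT, e.eventually_pairAddr_lt (Encodable.encode b),
      eventually_ge_atTop 4] with c hc haddr hcap n d hd
    exact (hc n d hd).get hd fun σ hσ => ⟨haddr n σ hσ, cap_le_pow hcap⟩
  | op o e f ihe ihf =>
    obtain ⟨T, hT⟩ := ihe
    obtain ⟨T', hT'⟩ := ihf
    refine ⟨T + (T' + 1), ?_⟩
    filter_upwards [hT, hT', (Ex.op o e f).eventually_eval_lt] with c hc hc' hlt n d hd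
    exact (hc n d hd).op hd (hc' n (d + 1) (by omega)) (hlt n)

lemma Simulates.seq {W n d T T' : ℕ} {P Q : Prog} {f g : Store A → Store A}
    (hP : Simulates W n d P f T) (hQ : Simulates W n d Q g T') :
    Simulates W n d (.seq P Q) (fun σ => g (f σ)) (T + T') := by
  intro σ s hσ
  refine .seq ((hP σ s hσ).mono le_rfl fun s₁ ⟨h₁, hreg₁⟩ => ?_)
  refine (hQ _ s₁ h₁).mono le_rfl fun s₂ ⟨h₂, hreg₂⟩ => ⟨h₂, fun r hr => ?_⟩
  rw [hreg₂ r hr, hreg₁ r hr]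

lemma Simulates.mono {W n d T T' : ℕ} {P : Prog} {f : Store A → Store A}
    (hP : Simulates W n d P f T) (hT : T ≤ T') : Simulates W n d P f T' :=
  fun σ s hσ => (hP σ s hσ).mono hT fun _ => id

lemma Simulates.put {W n d T T' : ℕ} {b : A} {I V : Prog} {i v : Store A → ℕ} (hd : 3 ≤ d)
    (hI : Evaluates W n d I i T) (hV : Evaluates W n (d + 1) V v T')
    (hW : ∀ σ : Store A, (∀ b i, σ b i < cap n) →
      2 * n + sqPair (Encodable.encode b) (i σ) < W) :
    Simulates W n d (writeCode b d I V) (fun σ => σ.set b (i σ) (clamp n (v σ)))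
      (T + (6 + (T' + (2 + 1)))) :=
  fun σ s hσ => .writeCode hd hσ (hW σ hσ.lt_cap) (hI σ s hσ) fun _ hs' =>
    hV σ _ (hσ.of_pushes hd hs')

lemma Simulates.ite {W n d Te Tf T T' : ℕ} {E F P Q : Prog} {v w : Store A → ℕ}
    {f g : Store A → Store A} (hd : 3 ≤ d) (hE : Evaluates W n d E v Te)
    (hF : Evaluates W n (d + 1) F w Tf) (hP : Simulates W n d P f T)
    (hQ : Simulates W n d Q g T') :
    Simulates W n d (.seq E (.seq F (.ifLt d (d + 1) P Q)))
      (fun σ => if v σ < w σ then f σ else g σ) (Te + (Tf + (T + T' + 1))) := by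
  intro σ s hσ
  refine .seq ((hE σ s hσ).mono le_rfl fun s₁ h₁ => .seq ?_)
  refine (hF σ s₁ (hσ.of_pushes hd h₁)).mono le_rfl fun s₂ h₂ => ?_
  have hs₂ := h₁.push h₂ d.lt_succ_self
  have hσ₂ := hσ.of_pushes hd hs₂
  refine .ifLt (fun hlt => ?_) (fun hge => ?_)
  · rw [hs₂.reg_self, h₂.reg_self] at hlt
    simp only [if_pos hlt]
    exact (hP σ s₂ hσ₂).mono (by omega) fun s₃ ⟨h₃, hreg₃⟩ =>
      ⟨h₃, fun r hr => (hreg₃ r hr).trans (hs₂.reg_of_lt r hr)⟩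
  · rw [hs₂.reg_self, h₂.reg_self] at hge
    simp only [if_neg hge]
    exact (hQ σ s₂ hσ₂).mono (by omega) fun s₃ ⟨h₃, hreg₃⟩ =>
      ⟨h₃, fun r hr => (hreg₃ r hr).trans (hs₂.reg_of_lt r hr)⟩

lemma Exec.loopBody {W n d i T : ℕ} {x : A} {P : Prog} {f : Store A → Store A} {σ : Store A}
    {s : State} (hd : 3 ≤ d) (hP : Simulates W n (d + 1) P f T) (hσ : Good n σ s)
    (hi : s.reg d = i) (hiW : i + 1 < W)
    (hW : 2 * n + sqPair (Encodable.encode x) 0 < W) :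
    Exec W (loopBody x d P) s (T + 14) fun s' =>
      Good n (f (σ.set x 0 (clamp n i))) s' ∧ s'.reg d = i + 1 ∧ ∀ r < d, s'.reg r = s.reg r := by
  have hwrite := Exec.writeCode (d := d + 1) (b := x) (T := 1) (T' := 2) (w := i)
    (I := .const (d + 1) 0) (V := .seq (.const (d + 2) 0) (.arith .add (d + 2) (d + 2) d))
    (by omega) hσ hW (.const (by omega) (pushes_setReg s (d + 1) 0)) fun s' hs' => by
      have hcounter := (hs'.reg_of_lt d d.lt_succ_self).trans hi
      simpa only [hcounter] using Exec.copy (W := W) (s := s') (show d < d + 2 by omega) (by omega)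
  refine Exec.mono (.seq (hwrite.mono le_rfl fun s₁ ⟨h₁, hreg₁⟩ => .seq (T' := 2) <|
    (hP _ s₁ h₁).mono le_rfl fun s₂ ⟨h₂, hreg₂⟩ => .seq (T := 1) (T' := 1) <|
      .const (by omega) ?_)) (by omega) fun _ => id
  have hcounter : s₂.reg d = i := by
    rw [hreg₂ d d.lt_succ_self, hreg₁ d d.lt_succ_self, hi]
  have hone := pushes_setReg s₂ (d + 1) 1
  have hsucc := hone.setReg d.le_succ (i + 1)
  refine .arith ?_ ?_ <;>
    rw [hone.reg_self, hone.reg_of_lt d d.lt_succ_self, hcounter] <;> simp only [Op.eval]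
  · exact hiW
  · refine ⟨h₂.of_pushes hd hsucc, hsucc.reg_self, fun r hr => ?_⟩
    rw [hsucc.reg_of_lt r hr, hreg₂ r (by omega), hreg₁ r (by omega)]

lemma Simulates.loop {W n d M T T' : ℕ} {x : A} {E P : Prog} {v : Store A → ℕ}
    {f : Store A → Store A} (hd : 3 ≤ d) (hE : Evaluates W n d E v T)
    (hP : Simulates W n (d + 2) P f T') (hv : ∀ σ, v σ ≤ M) (hM : M + 1 < W)
    (hW : 2 * n + sqPair (Encodable.encode x) 0 < W) :
    Simulates W n d (.seq E (.seq (.const (d + 1) 0) (.whileLt (d + 1) d (loopBody x (d + 1) P))))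
      (fun σ => iter (fun i τ => f (τ.set x 0 (clamp n i))) (v σ) σ)
      (T + (1 + (M * (T' + 15) + 1))) := by
  intro σ s hσ
  refine .seq ((hE σ s hσ).mono le_rfl fun s₁ h₁ => .seq (.const (by omega) ?_))
  have h₂ := h₁.push (pushes_setReg s₁ (d + 1) 0) d.lt_succ_self
  have hMv : v σ * (T' + 14 + 1) ≤ M * (T' + 15) := Nat.mul_le_mul_right _ (hv σ)
  refine (Exec.whileLt (T := T' + 14) (M := v σ) (fun m s' =>
    Good n (iter (fun i τ => f (τ.set x 0 (clamp n i))) m σ) s' ∧ s'.reg (d + 1) = m ∧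
      s'.reg d = v σ ∧ ∀ r < d, s'.reg r = s.reg r)
    (fun m s' hs' => hs'.2.imp_right And.left) (fun m s' hm ⟨hgood, hcounter, hbound, hreg⟩ => ?_)
    ⟨hσ.of_pushes hd h₂, (pushes_setReg s₁ (d + 1) 0).reg_self, h₂.reg_self, h₂.reg_of_lt⟩).mono
    (by omega) fun s' hs' => ⟨hs'.1, hs'.2.2.2⟩
  refine (Exec.loopBody (by omega) hP hgood hcounter (by have := hv σ; omega) hW).mono le_rfl
    fun s'' ⟨hgood', hcounter', hreg'⟩ => ⟨hgood', hcounter', ?_, fun r hr => ?_⟩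
  · rw [hreg' d d.lt_succ_self, hbound]
  · rw [hreg' r (by omega), hreg r hr]

/-- With sufficiently long words, the compiled code of `P` simulates `P` in time
`O(n ^ P.deg)`. -/
def Stmt.Compiles (P : Stmt A) : Prop :=
  ∃ K, ∀ᶠ c in atTop, ∀ n d, 0 < n → 3 ≤ d →
    Simulates ((n + 2) ^ c) n d (P.comp d) (P.run n) (K * n ^ P.deg)

lemma Stmt.compiles_put (b : A) (i e : Ex A) : (Stmt.put b i e).Compiles := by
  obtain ⟨Ti, hi⟩ := i.evaluates_comp
  obtain ⟨Te, he⟩ := e.evaluates_comp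
  refine ⟨Ti + (6 + (Te + (2 + 1))), ?_⟩
  filter_upwards [hi, he, i.eventually_pairAddr_lt (Encodable.encode b)] with c hi he hW n d _ hd
  exact (Simulates.put hd (hi n d hd) (he n (d + 1) (by omega)) (hW n)).mono (by simp [Stmt.deg])

lemma Stmt.Compiles.seq {P Q : Stmt A} (hP : P.Compiles) (hQ : Q.Compiles) :
    (P.seq Q).Compiles := by
  obtain ⟨K, hP⟩ := hP
  obtain ⟨K', hQ⟩ := hQ
  refine ⟨K + K', ?_⟩
  filter_upwards [hP, hQ] with c hP hQ n d hn hd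
  refine ((hP n d hn hd).seq (hQ n d hn hd)).mono ?_
  rw [Stmt.deg, add_mul]
  gcongr
  exacts [le_max_left .., le_max_right ..]

lemma Stmt.Compiles.ite {P Q : Stmt A} (hP : P.Compiles) (hQ : Q.Compiles) (e f : Ex A) :
    (Stmt.ite e f P Q).Compiles := by
  obtain ⟨Te, he⟩ := e.evaluates_comp
  obtain ⟨Tf, hf⟩ := f.evaluates_comp
  obtain ⟨K, hP⟩ := hP
  obtain ⟨K', hQ⟩ := hQ
  refine ⟨Te + Tf + K + K' + 1, ?_⟩
  filter_upwards [he, hf, hP, hQ] with c he hf hP hQ n d hn hd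
  refine (Simulates.ite hd (he n d hd) (hf n (d + 1) (by omega)) (hP n d hn hd)
    (hQ n d hn hd)).mono ?_
  have hKP : K * n ^ P.deg ≤ K * n ^ max P.deg Q.deg := by
    gcongr
    exact le_max_left ..
  have hKQ : K' * n ^ Q.deg ≤ K' * n ^ max P.deg Q.deg := by
    gcongr
    exact le_max_right ..
  have hpos : Te + Tf + 1 ≤ (Te + Tf + 1) * n ^ max P.deg Q.deg :=
    Nat.le_mul_of_pos_right _ (by positivity)
  simp only [Stmt.deg]
  linarith

lemma Stmt.Compiles.loop {P : Stmt A} (hP : P.Compiles) (x : A) (k : ℕ) (e : Ex A) :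
    (Stmt.loop x k e P).Compiles := by
  obtain ⟨T, he⟩ := (e.minLenPow k).evaluates_comp
  obtain ⟨K, hP⟩ := hP
  refine ⟨T + K + 17, ?_⟩
  filter_upwards [he, hP, (Ex.lit 0 : Ex A).eventually_pairAddr_lt (Encodable.encode x),
    eventually_ge_atTop (k + 1)] with c he hP hW hc n d hn hd
  have hv : ∀ σ : Store A, (e.minLenPow k).eval n σ ≤ n ^ k := fun σ => by
    rw [Ex.eval_minLenPow]
    exact min_le_right _ _
  have hM : n ^ k + 1 < (n + 2) ^ c := by
    have hk : n ^ k ≤ (n + 2) ^ k := Nat.pow_le_pow_left (by omega) k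
    have hpos : 0 < (n + 2) ^ k := by positivity
    calc n ^ k + 1 < (n + 2) ^ k * (n + 2) := by nlinarith
      _ ≤ (n + 2) ^ c := by rw [← pow_succ]; exact Nat.pow_le_pow_right (by omega) hc
  have hloop := Simulates.loop hd (he n d hd) (hP n (d + 2) hn (by omega)) hv hM
    (hW n (fun _ _ => 0) fun _ _ => cap_pos n)
  simp only [Ex.eval_minLenPow] at hloop
  refine hloop.mono ?_
  have hk : n ^ k ≤ n ^ (k + P.deg) := Nat.pow_le_pow_right hn (Nat.le_add_right ..)
  have hpos : 0 < n ^ (k + P.deg) := by positivity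
  calc T + (1 + (n ^ k * (K * n ^ P.deg + 15) + 1))
      = T + 2 + K * n ^ (k + P.deg) + 15 * n ^ k := by ring
    _ ≤ (T + 2) * n ^ (k + P.deg) + K * n ^ (k + P.deg) + 15 * n ^ (k + P.deg) := by
      gcongr
      exact Nat.le_mul_of_pos_right _ hpos
    _ = (T + K + 17) * n ^ (k + P.deg) := by ring

lemma Stmt.compiles (P : Stmt A) : P.Compiles := by
  induction P with
  | skip => exact ⟨1, .of_forall fun c n d _ _ σ s hσ => .skip ⟨hσ, fun _ _ => rfl⟩⟩
  | put b i e => exact compiles_put b i e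
  | seq P Q ihP ihQ => exact ihP.seq ihQ
  | ite e f P Q ihP ihQ => exact ihP.ite ihQ e f
  | loop x k e P ih => exact ih.loop x k e

/-- Load `n` and compute `2 n` and the bound `cap n`. -/
def prologue : Prog :=
  .seq (.load 0 0) <| .seq (.arith .add 1 0 0) <| .seq (.const 2 2) <| .seq (.arith .add 2 0 2) <|
    .seq (.arith .mul 2 2 2) (.arith .mul 2 2 2)

/-- The store in which the array `default` holds the memory contents `mem` and all else is zero. -/
def startStore (mem : ℕ → ℕ) : Store A := fun b i => if b = default then mem i else 0

lemma mem_addr_eq_startStore {n : ℕ} {mem : ℕ → ℕ} (hzero : ∀ i, 2 * n ≤ i → mem i = 0) (b : A)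
    (i : ℕ) : mem (addr n b i) = startStore mem b i := by
  unfold addr startStore
  split_ifs with hio hb hb
  · rfl
  · exact absurd hio.1 hb
  · rw [hzero _ (by omega), hzero i (not_lt.1 fun hi => hio ⟨hb, hi⟩)]
  · exact hzero _ (by omega)

lemma exec_prologue {W n : ℕ} {s : State} (hW : cap n < W) (hn : s.mem 0 = n)
    (hreg : ∀ r, s.reg r = 0) (hle : ∀ i, s.mem i ≤ n) (hzero : ∀ i, 2 * n ≤ i → s.mem i = 0) :
    Exec W prologue s 6 (Good n (startStore s.mem : Store A)) := by
  have hcap : cap n = (n + 2) * (n + 2) * ((n + 2) * (n + 2)) := by unfold cap; ring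
  have hlt : n + 2 < (n + 2) * (n + 2) := by nlinarith
  have hlt' : (n + 2) * (n + 2) < cap n := by rw [hcap]; nlinarith
  refine .seq (T := 1) (T' := 5) <| .load ?_ <| .seq (T := 1) (T' := 4) <| .arith ?_ <|
    .seq (T := 1) (T' := 3) <| .const ?_ <| .seq (T := 1) (T' := 2) <| .arith ?_ <|
      .seq (T := 1) (T' := 1) <| .arith ?_ <| .arith ?_
      ⟨?_, ?_, ?_, mem_addr_eq_startStore hzero, fun b i => ?_⟩
  any_goals simp only [State.setReg, Function.update_apply, Op.eval, hreg, hn, OfNat.zero_ne_ofNat,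
    OfNat.one_ne_ofNat, zero_ne_one, ↓reduceIte]
  any_goals omega
  · nlinarith
  · unfold startStore
    split_ifs
    exacts [(hle i).trans_lt (by omega), cap_pos n]

theorem Stmt.exists_prog (P : Stmt A) : ∃ (R : Prog) (c K : ℕ), ∀ n s, 0 < n → s.mem 0 = n →
    (∀ r, s.reg r = 0) → (∀ i, s.mem i ≤ n) → (∀ i, 2 * n ≤ i → s.mem i = 0) →
    ∃ t s', Runs ((n + 2) ^ c) R s t s' ∧ t ≤ K * n ^ P.deg ∧
      ∀ i < 2 * n, s'.mem i = P.run n (startStore s.mem) default i := by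
  obtain ⟨K, hK⟩ := P.compiles
  obtain ⟨c, hP, hc⟩ := (hK.and (eventually_ge_atTop 5)).exists
  refine ⟨.seq prologue (P.comp 3), c, 6 + K, fun n s hn hmem hreg hle hzero => ?_⟩
  have hcap : cap n < (n + 2) ^ c := Nat.pow_lt_pow_right (by omega) (by omega)
  have hstart : Exec _ prologue s 6 (Good n (startStore s.mem : Store A)) :=
    exec_prologue hcap hmem hreg hle hzero
  have hrun : Exec ((n + 2) ^ c) (.seq prologue (P.comp 3)) s (6 + K * n ^ P.deg) fun s' =>
      Good n (P.run n (startStore s.mem)) s' := .seq <| hstart.mono le_rfl fun s₁ h₁ =>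
    (hP n 3 hn le_rfl _ s₁ h₁).mono le_rfl fun _ => And.left
  obtain ⟨t, s', hrun, ht, hgood⟩ := hrun
  refine ⟨t, s', hrun, ht.trans ?_, fun i hi => ?_⟩
  · rw [add_mul]
    gcongr
    exact Nat.le_mul_of_pos_right _ (by positivity)
  · rw [← hgood.mem_addr, addr, if_pos ⟨rfl, hi⟩]

end Compile
end LoopLang

namespace Surprise

/-! ### The hypergeometric tail -/

/-- The numerator of the hypergeometric tail. -/
def tailNum (p m ip ie : ℕ) : ℕ := ∑ i ∈ Finset.Icc ie m, ip.choose i * (p - ip).choose (m - i)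

lemma hyperTail_eq (p m ip ie : ℕ) : hyperTail p m ip ie = tailNum p m ip ie / p.choose m := by
  unfold hyperTail tailNum
  rw [← Finset.sum_div]
  push_cast
  rfl

lemma hyperTail_le_of_tailNum_le {p m ip ie ip' ie' : ℕ}
    (h : tailNum p m ip ie ≤ tailNum p m ip' ie') :
    hyperTail p m ip ie ≤ hyperTail p m ip' ie' := by
  rw [hyperTail_eq, hyperTail_eq]
  gcongr

lemma tailNum_anti (p m ip : ℕ) {ie ie' : ℕ} (h : ie ≤ ie') :
    tailNum p m ip ie' ≤ tailNum p m ip ie :=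
  Finset.sum_le_sum_of_subset (Finset.Icc_subset_Icc_left h)

/-- The step from one row of Pascal's triangle to the next, for arbitrary rows. -/
def pascalStep (R : ℕ → ℕ) : ℕ → ℕ
  | 0 => R 0
  | j + 1 => R (j + 1) + R j

lemma pascalStep_mono : Monotone pascalStep
  | _, _, h, 0 => h 0
  | _, _, h, j + 1 => add_le_add (h (j + 1)) (h j)

lemma pascalStep_choose (x : ℕ) : pascalStep x.choose = (x + 1).choose := by
  funext j
  cases j with
  | zero => simp [pascalStep]
  | succ j => rw [pascalStep, Nat.choose_succ_succ', add_comm]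

lemma pascalStep_iterate_choose (x y : ℕ) : pascalStep^[y] x.choose = (x + y).choose := by
  induction y with
  | zero => rfl
  | succ y ih => rw [Function.iterate_succ_apply', ih, pascalStep_choose, add_assoc]

lemma pascalStep_iterate_apply (R : ℕ → ℕ) (y j : ℕ) :
    pascalStep^[y] R j = ∑ q ∈ Finset.HasAntidiagonal.antidiagonal j, R q.1 * y.choose q.2 := by
  induction y generalizing j with
  | zero =>
    rw [Finset.sum_eq_single_of_mem (j, 0) (by simp)]
    · simp
    · rintro ⟨i, k⟩ hik hne
      have hk : k ≠ 0 := by rintro rfl; exact hne (by simpa using hik)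
      rw [Nat.choose_eq_zero_of_lt (by omega), mul_zero]
  | succ y ih =>
    rw [Function.iterate_succ_apply']
    cases j with
    | zero => simp [pascalStep, ih]
    | succ j =>
      simp only [pascalStep, ih, Finset.Nat.sum_antidiagonal_succ', Nat.choose_succ_succ',
        Nat.choose_zero_right, mul_add, Finset.sum_add_distrib]
      ring

/-- Row `ip` of Pascal's triangle with the entries below `ie` erased. -/
def cutRow (ip ie : ℕ) : ℕ → ℕ := fun j => if j < ie then 0 else ip.choose j

lemma cutRow_le (ip ie : ℕ) : cutRow ip ie ≤ ip.choose := fun j => by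
  unfold cutRow
  split_ifs <;> simp

lemma pascalStep_cutRow_le (ip ie : ℕ) : pascalStep (cutRow ip ie) ≤ cutRow (ip + 1) ie := by
  intro j
  by_cases hj : j < ie
  · cases j with
    | zero => simp [pascalStep, cutRow, hj]
    | succ j => simp [pascalStep, cutRow, hj, (Nat.lt_succ_self j).trans hj]
  · calc pascalStep (cutRow ip ie) j ≤ pascalStep ip.choose j := pascalStep_mono (cutRow_le ip ie) j
      _ = cutRow (ip + 1) ie j := by rw [pascalStep_choose, cutRow, if_neg hj]

lemma tailNum_eq_pascalStep (p m ip ie : ℕ) :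
    tailNum p m ip ie = pascalStep^[p - ip] (cutRow ip ie) m := by
  rw [pascalStep_iterate_apply,
    Finset.Nat.sum_antidiagonal_eq_sum_range_succ fun i k => cutRow ip ie i * (p - ip).choose k]
  have hIcc : Finset.Icc ie m = {i ∈ Finset.range (m + 1) | ¬ i < ie} := by
    ext i
    simp only [Finset.mem_Icc, Finset.mem_filter, Finset.mem_range]
    omega
  rw [tailNum, hIcc, Finset.sum_filter]
  refine Finset.sum_congr rfl fun i _ => ?_
  by_cases hi : i < ie <;> simp [cutRow, hi]

lemma tailNum_mono {p m ip ip' : ℕ} (ie : ℕ) (h : ip ≤ ip') (hp : ip' ≤ p) :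
    tailNum p m ip ie ≤ tailNum p m ip' ie := by
  induction ip', h using Nat.le_induction with
  | base => exact le_rfl
  | succ k _ ih =>
    refine (ih (by omega)).trans ?_
    rw [tailNum_eq_pascalStep, tailNum_eq_pascalStep, show p - k = p - (k + 1) + 1 by omega,
      Function.iterate_succ_apply]
    exact pascalStep_mono.iterate _ (pascalStep_cutRow_le k ie) m

/-! ### Clusterings given by labels -/

section Labels
variable {V ι : Type*} [Fintype V] [DecidableEq V] [DecidableEq ι]

/-- The clustering whose clusters are the nonempty fibres of `lab`. -/
def ofLabel (lab : V → ι) : Finpartition (Finset.univ : Finset V) :=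
  letI : DecidableRel (Setoid.ker lab).r := fun u v => decEq (lab u) (lab v)
  Finpartition.ofSetoid (Setoid.ker lab)

lemma mem_part_ofLabel (lab : V → ι) {u v : V} : v ∈ (ofLabel lab).part u ↔ lab u = lab v :=
  letI : DecidableRel (Setoid.ker lab).r := fun u v => decEq (lab u) (lab v)
  Finpartition.mem_part_ofSetoid_iff_rel

lemma part_ofLabel_eq_iff (lab : V → ι) (u v : V) :
    (ofLabel lab).part u = (ofLabel lab).part v ↔ lab u = lab v := by
  rw [← mem_part_ofLabel lab, eq_comm]
  exact (Finpartition.mem_part_iff_part_eq_part _ (Finset.mem_univ v) (Finset.mem_univ u)).symm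

lemma two_mul_intraPairs_add (ζ : Finpartition (Finset.univ : Finset V)) :
    2 * intraPairs ζ + Fintype.card V = Finset.card {q : V × V | ζ.part q.1 = ζ.part q.2} := by
  have two_mul_choose (k : ℕ) : 2 * k.choose 2 + k = k * k := by
    rw [Nat.choose_two_right, Nat.mul_div_cancel' (Nat.even_mul_pred_self _).two_dvd]
    cases k with
    | zero => rfl
    | succ k => simp only [Nat.add_sub_cancel]; ring
  have pairs_eq_biUnion : ({q : V × V | ζ.part q.1 = ζ.part q.2} : Finset (V × V)) =
      ζ.parts.biUnion fun C => C ×ˢ C := by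
    ext ⟨u, v⟩
    simp only [Finset.mem_filter, Finset.mem_univ, true_and, Finset.mem_biUnion,
      Finset.mem_product]
    constructor
    · intro huv
      exact ⟨ζ.part u, ζ.part_mem.2 (Finset.mem_univ u), ζ.mem_part (Finset.mem_univ u),
        huv ▸ ζ.mem_part (Finset.mem_univ v)⟩
    · rintro ⟨C, hC, hu, hv⟩
      rw [ζ.part_eq_of_mem hC hu, ζ.part_eq_of_mem hC hv]
  have disjoint_squares : (ζ.parts : Set (Finset V)).PairwiseDisjoint fun C => C ×ˢ C :=
    fun C hC D hD hne => Finset.disjoint_product.2 (.inl (ζ.disjoint hC hD hne))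
  rw [pairs_eq_biUnion, Finset.card_biUnion disjoint_squares, ← Finset.card_univ,
    ← ζ.sum_card_parts, intraPairs, Finset.mul_sum, ← Finset.sum_add_distrib]
  exact Finset.sum_congr rfl fun C _ => by rw [two_mul_choose, Finset.card_product]

lemma two_mul_intraPairs_ofLabel_add (lab : V → ι) :
    2 * intraPairs (ofLabel lab) + Fintype.card V =
      Finset.card {q : V × V | lab q.1 = lab q.2} := by
  simp only [two_mul_intraPairs_add, part_ofLabel_eq_iff]

lemma intraPairs_ofLabel_of_injective {lab : V → ι} (h : Function.Injective lab) :
    intraPairs (ofLabel lab) = 0 := by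
  have hpairs := two_mul_intraPairs_ofLabel_add lab
  simp only [h.eq_iff] at hpairs
  rw [← Finset.univ_product_univ, ← Finset.diag_eq_filter, Finset.diag_card,
    Finset.card_univ] at hpairs
  omega

lemma intraPairs_le_of_refines {ζ ξ : Finpartition (Finset.univ : Finset V)}
    (h : ∀ u v, ζ.part u = ζ.part v → ξ.part u = ξ.part v) : intraPairs ζ ≤ intraPairs ξ := by
  have hpairs : Finset.card {q : V × V | ζ.part q.1 = ζ.part q.2} ≤
      Finset.card {q : V × V | ξ.part q.1 = ξ.part q.2} :=
    Finset.card_le_card (Finset.monotone_filter_right _ fun q _ => h q.1 q.2)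
  rw [← two_mul_intraPairs_add, ← two_mul_intraPairs_add] at hpairs
  omega

lemma intraPairs_le_choose (ζ : Finpartition (Finset.univ : Finset V)) :
    intraPairs ζ ≤ (Fintype.card V).choose 2 := by
  have htriv : intraPairs (ofLabel fun _ : V => ()) = (Fintype.card V).choose 2 := by
    have hcount := two_mul_intraPairs_ofLabel_add fun _ : V => ()
    simp only [Finset.filter_true, Finset.card_univ, Fintype.card_prod] at hcount
    rw [Nat.choose_two_right, Nat.mul_sub_one]
    omega
  rw [← htriv]
  exact intraPairs_le_of_refines fun u v _ => (part_ofLabel_eq_iff _ u v).2 rfl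

lemma intraPairs_ofLabel_merge (lab : V → ι) {p c : ι} (hpc : p ≠ c) :
    intraPairs (ofLabel fun v => if lab v = c then p else lab v) =
      intraPairs (ofLabel lab) +
        Finset.card {v | lab v = p} * Finset.card {v | lab v = c} := by
  have hpairs : ({q : V × V | (if lab q.1 = c then p else lab q.1) =
        if lab q.2 = c then p else lab q.2} : Finset (V × V)) =
      ({q : V × V | lab q.1 = lab q.2} : Finset (V × V)) ∪
        (({v | lab v = p} : Finset V) ×ˢ ({v | lab v = c} : Finset V) ∪
        ({v | lab v = c} : Finset V) ×ˢ ({v | lab v = p} : Finset V)) := by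
    ext ⟨u, v⟩
    simp only [Finset.mem_filter, Finset.mem_univ, true_and, Finset.mem_union,
      Finset.mem_product]
    split_ifs <;> grind
  have hcount := two_mul_intraPairs_ofLabel_add fun v => if lab v = c then p else lab v
  rw [hpairs, Finset.card_union_of_disjoint, Finset.card_union_of_disjoint,
    ← two_mul_intraPairs_ofLabel_add, Finset.card_product, Finset.card_product,
    mul_comm (Finset.card {v | lab v = c})] at hcount
  · omega
  all_goals
    rw [Finset.disjoint_left]
    rintro ⟨u, v⟩
    simp only [Finset.mem_filter, Finset.mem_univ, true_and, Finset.mem_union,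
      Finset.mem_product]
    grind

end Labels

/-! ### Eliminating the vertices of a tree -/

lemma ncard_edgeSet_of_isTree {n : ℕ} {T : SimpleGraph (Fin n)} (hT : T.IsTree) :
    T.edgeSet.ncard = n - 1 := by
  classical
  have hcard := hT.card_edgeFinset
  rw [← SimpleGraph.coe_edgeFinset, Set.ncard_coe_finset]
  rw [Fintype.card_fin] at hcard
  omega

/-- Vertex `v` has not been eliminated before step `t`, where step `s` eliminates `child s`. -/
def Live (child : ℕ → ℕ) (t v : ℕ) : Prop := ∀ s < t, v ≠ child s

/-- An order in which the vertices `0, …, n - 1` of a tree rooted at `0` can be removed one leaf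
at a time: step `t < n - 1` removes `child t`, whose only remaining neighbour is `par t`. -/
structure EliminationOrder (n : ℕ) where
  par : ℕ → ℕ
  child : ℕ → ℕ
  par_lt {t : ℕ} : t < n - 1 → par t < n
  child_lt {t : ℕ} : t < n - 1 → child t < n
  par_live {t : ℕ} : t < n - 1 → Live child (t + 1) (par t)
  child_live {t : ℕ} : t < n - 1 → Live child t (child t)
  live_zero : Live child (n - 1) 0
  eq_zero_of_live {v : ℕ} : v < n → Live child (n - 1) v → v = 0

lemma Live.anti {child : ℕ → ℕ} {s t v : ℕ} (h : Live child t v) (hst : s ≤ t) : Live child s v :=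
  fun r hr => h r (hr.trans_le hst)

lemma live_succ {child : ℕ → ℕ} {t v : ℕ} :
    Live child (t + 1) v ↔ Live child t v ∧ v ≠ child t :=
  ⟨fun h => ⟨h.anti t.le_succ, h t t.lt_succ_self⟩, fun h s hs =>
    (Nat.lt_succ_iff_lt_or_eq.1 hs).elim (h.1 s) (by rintro rfl; exact h.2)⟩

namespace EliminationOrder
variable {n : ℕ} (O : EliminationOrder n) (keep : ℕ → Bool)

lemma par_ne_child {t : ℕ} (ht : t < n - 1) : O.par t ≠ O.child t := O.par_live ht t t.lt_succ_self

/-- The vertex which represents the cluster of `w` after the first `t` steps, step `s` joining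
the cluster of `child s` to the one of `par s` if `keep s`. -/
def rep : ℕ → ℕ → ℕ
  | 0, w => w
  | t + 1, w => if keep t ∧ rep t w = O.child t then O.par t else rep t w

/-- The number of vertices in the cluster represented by `v` after the first `t` steps. -/
def size (t v : ℕ) : ℕ := Finset.card {w : Fin n | O.rep keep t w = v}

/-- The sum of the weights `x s` of the edges `s < t` below the vertex `v`. -/
def gather (x : ℕ → ℕ) : ℕ → ℕ → ℕ
  | 0, _ => 0
  | t + 1, v =>
    if v = O.child t then 0
    else if v = O.par t then gather x t (O.par t) + gather x t (O.child t) + x t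
    else gather x t v

/-- The number of kept edges among those below `v` that are processed in the first `t` steps. -/
def kept : ℕ → ℕ → ℕ := O.gather fun t => (keep t).toNat

/-- The number of intracluster pairs created below `v` in the first `t` steps. -/
def cost : ℕ → ℕ → ℕ := O.gather fun t =>
  (keep t).toNat * (O.size keep t (O.par t) * O.size keep t (O.child t))

variable {keep}

lemma rep_of_live {t v : ℕ} (hv : Live O.child t v) : O.rep keep t v = v := by
  induction t with
  | zero => rfl
  | succ t ih =>
    obtain ⟨hlive, hne⟩ := live_succ.1 hv
    rw [rep, ih hlive, if_neg (fun h => hne h.2)]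

variable (keep) in
lemma rep_child {t r : ℕ} (ht : t < r) (hr : r ≤ n - 1) :
    O.rep keep r (O.child t) = if keep t then O.rep keep r (O.par t) else O.child t := by
  have htn : t < n - 1 := by omega
  induction r, ht using Nat.le_induction with
  | base =>
    rw [rep, O.rep_of_live (O.child_live htn), O.rep_of_live (O.par_live htn)]
    simp only [and_true]
  | succ r hr' ih =>
    have hne : O.child t ≠ O.child r := (O.child_live (by omega) t (by omega)).symm
    rw [rep, rep, ih (by omega)]
    split_ifs with hkeep <;> simp_all

lemma eq_rep {lab : ℕ → ℕ} (hroot : lab 0 = 0)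
    (hchild : ∀ t < n - 1, lab (O.child t) = if keep t then lab (O.par t) else O.child t)
    {v : ℕ} (hv : v < n) : lab v = O.rep keep (n - 1) v := by
  suffices h : ∀ k ≤ n - 1, ∀ v < n, Live O.child (n - 1 - k) v →
      lab v = O.rep keep (n - 1) v from
    h (n - 1) le_rfl v hv fun s hs => by omega
  intro k
  induction k with
  | zero =>
    intro _ v hv hlive
    rw [O.eq_zero_of_live hv hlive, hroot, O.rep_of_live O.live_zero]
  | succ k ih =>
    intro hk v hv hlive
    obtain ⟨t, ht, hk⟩ : ∃ t, n - 1 - k = t + 1 ∧ n - 1 - (k + 1) = t := ⟨_, by omega, rfl⟩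
    rw [ht] at ih
    rw [hk] at hlive
    have htn : t < n - 1 := by omega
    by_cases hvt : v = O.child t
    · rw [hvt, hchild t htn, O.rep_child keep htn le_rfl,
        ih (by omega) _ (O.par_lt htn) (O.par_live htn)]
    · exact ih (by omega) v hv (live_succ.2 ⟨hlive, hvt⟩)

lemma size_zero {v : ℕ} (hv : v < n) : O.size keep 0 v = 1 :=
  Finset.card_eq_one.2 ⟨⟨v, hv⟩, Finset.ext fun w => by
    rw [Finset.mem_filter_univ, Finset.mem_singleton, Fin.ext_iff, rep]⟩

lemma size_succ_par {t : ℕ} (ht : t < n - 1) : O.size keep (t + 1) (O.par t) =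
    O.size keep t (O.par t) + (keep t).toNat * O.size keep t (O.child t) := by
  have hne := O.par_ne_child ht
  cases hkeep : keep t with
  | false => simp [size, rep, hkeep]
  | true =>
    have hdisj : Disjoint ({w : Fin n | O.rep keep t w = O.par t} : Finset (Fin n))
        ({w : Fin n | O.rep keep t w = O.child t} : Finset (Fin n)) :=
      Finset.disjoint_filter.2 fun w _ hpar hchild => hne (hpar.symm.trans hchild)
    rw [size, size, size, Bool.toNat_true, one_mul, ← Finset.card_union_of_disjoint hdisj,
      ← Finset.filter_or]
    congr 1
    ext w
    simp only [rep, hkeep, true_and, Finset.mem_filter, Finset.mem_univ]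
    split_ifs <;> grind

lemma size_succ_of_ne {t v : ℕ} (hpar : v ≠ O.par t) (hchild : v ≠ O.child t) :
    O.size keep (t + 1) v = O.size keep t v := by
  rw [size, size]
  congr 1
  refine Finset.filter_congr fun w _ => ?_
  rw [rep]
  split_ifs <;> grind

lemma size_pos {t v : ℕ} (hv : v < n) (hlive : Live O.child t v) : 0 < O.size keep t v :=
  Finset.card_pos.2 ⟨⟨v, hv⟩, Finset.mem_filter.2 ⟨Finset.mem_univ _, O.rep_of_live hlive⟩⟩

lemma size_le (t v : ℕ) : O.size keep t v ≤ n :=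
  (Finset.card_le_univ _).trans_eq (Fintype.card_fin n)

lemma size_add_size_le {t u v : ℕ} (huv : u ≠ v) :
    O.size keep t u + O.size keep t v ≤ n := by
  have hdisj : Disjoint ({w : Fin n | O.rep keep t w = u} : Finset (Fin n))
      ({w : Fin n | O.rep keep t w = v} : Finset (Fin n)) :=
    Finset.disjoint_filter.2 fun w _ hu hv => huv (hu.symm.trans hv)
  rw [size, size, ← Finset.card_union_of_disjoint hdisj]
  exact (Finset.card_le_univ _).trans_eq (Fintype.card_fin n)

section Gather
variable (x : ℕ → ℕ)

lemma sum_gather {t : ℕ} (ht : t ≤ n - 1) :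
    ∑ v ∈ Finset.range n, O.gather x t v = ∑ s ∈ Finset.range t, x s := by
  induction t with
  | zero => simp [gather]
  | succ t ih =>
    have hpar := Finset.mem_range.2 (O.par_lt ht)
    have hchild := Finset.mem_range.2 (O.child_lt ht)
    have hne := O.par_ne_child ht
    have hrest : ∀ v ∈ ((Finset.range n).erase (O.par t)).erase (O.child t),
        O.gather x (t + 1) v = O.gather x t v := fun v hv => by
      simp only [Finset.mem_erase] at hv
      rw [gather, if_neg hv.1, if_neg hv.2.1]
    have hchild' := Finset.mem_erase.2 ⟨hne.symm, hchild⟩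
    rw [Finset.sum_range_succ, ← ih (by omega), ← Finset.add_sum_erase _ _ hpar,
      ← Finset.add_sum_erase _ _ hchild', Finset.sum_congr rfl hrest,
      ← Finset.add_sum_erase (Finset.range n) _ hpar, ← Finset.add_sum_erase _ _ hchild']
    simp only [gather, hne, if_true, if_false]
    ring

lemma gather_le_sum {t v : ℕ} (ht : t ≤ n - 1) (hv : v < n) :
    O.gather x t v ≤ ∑ s ∈ Finset.range t, x s :=
  (O.sum_gather x ht).symm ▸
    Finset.single_le_sum (fun _ _ => Nat.zero_le _) (Finset.mem_range.2 hv)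

lemma gather_child {s t : ℕ} (hst : s < t) (ht : t ≤ n - 1) : O.gather x t (O.child s) = 0 := by
  induction t, hst using Nat.le_induction with
  | base => rw [gather, if_pos rfl]
  | succ t hst ih =>
    rw [gather, if_neg (O.child_live ht s hst).symm, if_neg (O.par_live ht s (by omega)).symm,
      ih (by omega)]

lemma gather_root (hn : 0 < n) :
    O.gather x (n - 1) 0 = ∑ t ∈ Finset.range (n - 1), x t := by
  rw [← O.sum_gather x le_rfl]
  refine (Finset.sum_eq_single_of_mem 0 (Finset.mem_range.2 hn) fun v hv hne => ?_).symm
  have hdead : ¬ Live O.child (n - 1) v := fun h => hne (O.eq_zero_of_live (by simpa using hv) h)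
  simp only [Live, not_forall, not_not] at hdead
  obtain ⟨s, hs, rfl⟩ := hdead
  exact O.gather_child x hs le_rfl

end Gather

lemma kept_lt {t v : ℕ} (ht : t ≤ n - 1) (hv : v < n) : O.kept keep t v < n := by
  have hsum : ∑ s ∈ Finset.range t, (keep s).toNat ≤ t := by
    simpa using Finset.sum_le_card_nsmul (Finset.range t) _ 1 fun s _ => (keep s).toNat_le
  have := (O.gather_le_sum (fun s => (keep s).toNat) ht hv).trans hsum
  unfold kept
  omega

lemma sum_mul_size_eq_intraPairs {t : ℕ} (ht : t ≤ n - 1) :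
    ∑ s ∈ Finset.range t, (keep s).toNat * (O.size keep s (O.par s) * O.size keep s (O.child s)) =
      intraPairs (ofLabel fun w : Fin n => O.rep keep t w) := by
  induction t with
  | zero =>
    exact (intraPairs_ofLabel_of_injective Fin.val_injective).symm
  | succ t ih =>
    rw [Finset.sum_range_succ, ih (by omega)]
    cases hkeep : keep t with
    | false => simp [rep, hkeep]
    | true =>
      simp only [rep, hkeep, true_and, Bool.toNat_true, one_mul]
      exact (intraPairs_ofLabel_merge _ (O.par_ne_child ht)).symm

lemma cost_root (hn : 0 < n) :
    O.cost keep (n - 1) 0 = intraPairs (ofLabel fun w : Fin n => O.rep keep (n - 1) w) := by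
  rw [cost, O.gather_root _ hn, O.sum_mul_size_eq_intraPairs le_rfl]

lemma cost_le {t v : ℕ} (ht : t ≤ n - 1) (hv : v < n) : O.cost keep t v ≤ n.choose 2 := by
  refine (O.gather_le_sum _ ht hv).trans ?_
  rw [O.sum_mul_size_eq_intraPairs ht]
  exact (intraPairs_le_choose _).trans_eq (by rw [Fintype.card_fin])

/-! ### Clusterings of a tree -/

section Tree
variable [NeZero n] {T : SimpleGraph (Fin n)}

/-- The edges of the elimination order are edges of `T`. -/
def Follows (T : SimpleGraph (Fin n)) : Prop :=
  ∀ t < n - 1, T.Adj (Fin.ofNat n (O.par t)) (Fin.ofNat n (O.child t))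

/-- The edge used by step `t`. -/
def edge (t : ℕ) : Sym2 (Fin n) := s(Fin.ofNat n (O.par t), Fin.ofNat n (O.child t))

lemma edge_injOn : Set.InjOn O.edge (Finset.range (n - 1) : Set ℕ) := by
  have edge_ne {s t : ℕ} (hst : s < t) (ht : t < n - 1) : O.edge s ≠ O.edge t := by
    intro heq
    have hmem : Fin.ofNat n (O.child s) ∈ O.edge t := heq ▸ Sym2.mem_mk_right _ _
    have hs : s < n - 1 := hst.trans ht
    rcases Sym2.mem_iff.1 hmem with hpar | hchild
    · rw [Fin.ext_iff, Fin.val_ofNat, Fin.val_ofNat, Nat.mod_eq_of_lt (O.child_lt hs),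
        Nat.mod_eq_of_lt (O.par_lt ht)] at hpar
      exact O.par_live ht s (by omega) hpar.symm
    · rw [Fin.ext_iff, Fin.val_ofNat, Fin.val_ofNat, Nat.mod_eq_of_lt (O.child_lt hs),
        Nat.mod_eq_of_lt (O.child_lt ht)] at hchild
      exact O.child_live ht s hst hchild.symm
  intro s hs t ht heq
  rw [Finset.coe_range, Set.mem_Iio] at hs ht
  rcases lt_trichotomy s t with hst | hst | hst
  exacts [absurd heq (edge_ne hst ht), hst, absurd heq.symm (edge_ne hst hs)]

variable {O}

lemma Follows.edgeSet_eq_image (h : O.Follows T) (hT : T.IsTree) :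
    T.edgeSet = (Finset.range (n - 1)).image O.edge := by
  refine (Set.eq_of_subset_of_ncard_le ?_ ?_ (Set.toFinite _)).symm
  · intro e he
    obtain ⟨t, ht, rfl⟩ := Finset.mem_image.1 (Finset.mem_coe.1 he)
    exact h t (Finset.mem_range.1 ht)
  · rw [Set.ncard_coe_finset, Finset.card_image_of_injOn O.edge_injOn, Finset.card_range,
      ncard_edgeSet_of_isTree hT]

lemma Follows.clusterEdges_eq (h : O.Follows T) (hT : T.IsTree) (C : Finset (Fin n)) :
    clusterEdges T C = Finset.card {t ∈ Finset.range (n - 1) |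
      Fin.ofNat n (O.par t) ∈ C ∧ Fin.ofNat n (O.child t) ∈ C} := by
  have himage : {e | e ∈ T.edgeSet ∧ ∀ v ∈ e, v ∈ C} =
      (({t ∈ Finset.range (n - 1) | Fin.ofNat n (O.par t) ∈ C ∧
        Fin.ofNat n (O.child t) ∈ C} : Finset ℕ).image O.edge : Set (Sym2 (Fin n))) := by
    ext e
    simp only [h.edgeSet_eq_image hT, Set.mem_ofPred_eq, Finset.mem_coe, Finset.mem_image,
      Finset.mem_filter]
    constructor
    · rintro ⟨⟨t, ht, rfl⟩, hC⟩
      exact ⟨t, ⟨ht, hC _ (Sym2.mem_mk_left _ _), hC _ (Sym2.mem_mk_right _ _)⟩, rfl⟩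
    · rintro ⟨t, ⟨ht, hpar, hchild⟩, rfl⟩
      exact ⟨⟨t, ht, rfl⟩, fun v hv => (Sym2.mem_iff.1 hv).elim (· ▸ hpar) (· ▸ hchild)⟩
  rw [clusterEdges, himage, Set.ncard_coe_finset, Finset.card_image_of_injOn]
  exact O.edge_injOn.mono (Finset.coe_subset.2 (Finset.filter_subset _ _))

lemma Follows.intraEdges_eq (h : O.Follows T) (hT : T.IsTree)
    (ζ : Finpartition (Finset.univ : Finset (Fin n))) :
    intraEdges T ζ = Finset.card {t ∈ Finset.range (n - 1) |
      ζ.part (Fin.ofNat n (O.par t)) = ζ.part (Fin.ofNat n (O.child t))} := by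
  rw [Finset.card_eq_sum_card_fiberwise (f := fun t => ζ.part (Fin.ofNat n (O.par t)))
    (t := ζ.parts) fun t _ => ζ.part_mem.2 (Finset.mem_univ _), intraEdges]
  refine Finset.sum_congr rfl fun C hC => ?_
  rw [h.clusterEdges_eq hT, Finset.filter_filter]
  congr 1
  refine Finset.filter_congr fun t _ => ?_
  constructor
  · rintro ⟨hpar, hchild⟩
    exact ⟨(ζ.part_eq_of_mem hC hpar).trans (ζ.part_eq_of_mem hC hchild).symm,
      ζ.part_eq_of_mem hC hpar⟩
  · rintro ⟨heq, rfl⟩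
    exact ⟨ζ.mem_part (Finset.mem_univ _), heq ▸ ζ.mem_part (Finset.mem_univ _)⟩

variable (O) in
/-- The edges that lie inside a cluster of `ζ`. -/
def keepOf (ζ : Finpartition (Finset.univ : Finset (Fin n))) (t : ℕ) : Bool :=
  ζ.part (Fin.ofNat n (O.par t)) = ζ.part (Fin.ofNat n (O.child t))

lemma kept_root : O.kept keep (n - 1) 0 = Finset.card {t ∈ Finset.range (n - 1) | keep t} := by
  rw [kept, O.gather_root _ (NeZero.pos n), Finset.card_filter]
  exact Finset.sum_congr rfl fun t _ => by cases keep t <;> rfl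

lemma Follows.kept_keepOf (h : O.Follows T) (hT : T.IsTree)
    (ζ : Finpartition (Finset.univ : Finset (Fin n))) :
    O.kept (O.keepOf ζ) (n - 1) 0 = intraEdges T ζ := by
  simp only [kept_root, h.intraEdges_eq hT, keepOf, decide_eq_true_eq]

variable (O) in
lemma part_rep_keepOf (ζ : Finpartition (Finset.univ : Finset (Fin n))) (t : ℕ) (w : Fin n) :
    ζ.part (Fin.ofNat n (O.rep (O.keepOf ζ) t w)) = ζ.part w := by
  induction t with
  | zero => rw [rep, Fin.ofNat_val_eq_self]
  | succ t ih =>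
    rw [rep]
    split_ifs with hmerge
    · rw [← ih, hmerge.2]
      exact of_decide_eq_true hmerge.1
    · exact ih

variable (O) in
lemma cost_keepOf_le (ζ : Finpartition (Finset.univ : Finset (Fin n))) :
    O.cost (O.keepOf ζ) (n - 1) 0 ≤ intraPairs ζ := by
  rw [O.cost_root (NeZero.pos n)]
  refine intraPairs_le_of_refines fun u v huv => ?_
  rw [part_ofLabel_eq_iff] at huv
  rw [← O.part_rep_keepOf ζ (n - 1) u, huv, O.part_rep_keepOf]

lemma Follows.kept_le_intraEdges (h : O.Follows T) (hT : T.IsTree) (keep : ℕ → Bool) :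
    O.kept keep (n - 1) 0 ≤
      intraEdges T (ofLabel fun w : Fin n => O.rep keep (n - 1) w) := by
  rw [kept_root, h.intraEdges_eq hT]
  refine Finset.card_le_card (Finset.monotone_filter_right _ fun t ht hkeep => ?_)
  have ht := Finset.mem_range.1 ht
  rw [part_ofLabel_eq_iff, Fin.val_ofNat, Fin.val_ofNat, Nat.mod_eq_of_lt (O.par_lt ht),
    Nat.mod_eq_of_lt (O.child_lt ht), O.rep_child keep ht le_rfl, if_pos hkeep]

lemma Follows.isOptimal (h : O.Follows T) (hT : T.IsTree) {best : ℕ → ℕ} {keep : ℕ → Bool}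
    (hbound : ∀ keep', best (O.kept keep' (n - 1) 0) ≤ O.cost keep' (n - 1) 0)
    (hcost : O.cost keep (n - 1) 0 = best (O.kept keep (n - 1) 0))
    (hmin : ∀ k < n, tailNum (n.choose 2) (n - 1) (best (O.kept keep (n - 1) 0))
        (O.kept keep (n - 1) 0) ≤ tailNum (n.choose 2) (n - 1) (best k) k) :
    IsOptimal T (ofLabel fun w : Fin n => O.rep keep (n - 1) w) := by
  intro ζ
  have hpairs : intraPairs ζ ≤ n.choose 2 :=
    (intraPairs_le_choose ζ).trans_eq (by rw [Fintype.card_fin])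
  rw [surprise, surprise, Fintype.card_fin, ncard_edgeSet_of_isTree hT]
  refine hyperTail_le_of_tailNum_le ?_
  calc tailNum (n.choose 2) (n - 1) _ _
      ≤ tailNum (n.choose 2) (n - 1) (best (O.kept keep (n - 1) 0))
          (O.kept keep (n - 1) 0) := by
        rw [← O.cost_root (NeZero.pos n), hcost]
        exact tailNum_anti _ _ _ (h.kept_le_intraEdges hT keep)
    _ ≤ tailNum (n.choose 2) (n - 1) (best (O.kept (O.keepOf ζ) (n - 1) 0))
          (O.kept (O.keepOf ζ) (n - 1) 0) := hmin _ (O.kept_lt le_rfl (NeZero.pos n))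
    _ ≤ tailNum (n.choose 2) (n - 1) (intraPairs ζ) (intraEdges T ζ) := by
        rw [h.kept_keepOf hT]
        refine tailNum_mono _ (le_trans ?_ (O.cost_keepOf_le ζ)) hpairs
        exact h.kept_keepOf hT ζ ▸ hbound (O.keepOf ζ)

end Tree

end EliminationOrder

end Surprise

namespace LoopLang

open WordRAM Surprise

/-! ### Programs and loop invariants -/

section Programs
variable {A : Type}

infixr:67 ";;" => Stmt.seq

instance : Add (Ex A) := ⟨.op .add⟩
instance : Sub (Ex A) := ⟨.op .sub⟩
instance : Mul (Ex A) := ⟨.op .mul⟩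
instance : Div (Ex A) := ⟨.op .div⟩
instance : Mod (Ex A) := ⟨fun e f => e - e / f * f⟩
instance (k : ℕ) : OfNat (Ex A) k := ⟨.lit k⟩

/-- An array name used as an expression is the scalar variable of that name. -/
instance : Coe A (Ex A) := ⟨fun x => .get x 0⟩

/-- The expression with value `sqPair`, used to index arrays by several numbers. -/
def Ex.pair (e f : Ex A) : Ex A := (e + f) * (e + f) + f

variable (n k : ℕ) (σ : Store A) (e f : Ex A)

@[simp] lemma eval_add : (e + f).eval n σ = e.eval n σ + f.eval n σ := rfl
@[simp] lemma eval_sub : (e - f).eval n σ = e.eval n σ - f.eval n σ := rfl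
@[simp] lemma eval_mul : (e * f).eval n σ = e.eval n σ * f.eval n σ := rfl
@[simp] lemma eval_div : (e / f).eval n σ = e.eval n σ / f.eval n σ := rfl

@[simp] lemma eval_mod : (e % f).eval n σ = e.eval n σ % f.eval n σ := by
  rw [Nat.mod_eq_sub_div_mul]
  rfl

@[simp] lemma eval_lit : (Ex.lit k).eval n σ = k := rfl
@[simp] lemma eval_zero : (0 : Ex A).eval n σ = 0 := rfl
@[simp] lemma eval_one : (1 : Ex A).eval n σ = 1 := rfl
@[simp] lemma eval_ofNat [k.AtLeastTwo] : (ofNat(k) : Ex A).eval n σ = ofNat(k) := rfl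
@[simp] lemma eval_len : Ex.len.eval n σ = n := rfl
@[simp] lemma eval_get (b : A) : (Ex.get b e).eval n σ = σ b (e.eval n σ) := rfl

@[simp] lemma eval_pair : (e.pair f).eval n σ = sqPair (e.eval n σ) (f.eval n σ) := rfl

variable [DecidableEq A] (P Q : Stmt A)

@[simp] lemma run_skip : Stmt.skip.run n σ = σ := rfl

@[simp] lemma run_put (b : A) :
    (Stmt.put b e f).run n σ = σ.set b (e.eval n σ) (clamp n (f.eval n σ)) := rfl

@[simp] lemma run_seq : (P ;; Q).run n σ = Q.run n (P.run n σ) := rfl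

@[simp] lemma run_ite : (Stmt.ite e f P Q).run n σ =
    if e.eval n σ < f.eval n σ then P.run n σ else Q.run n σ := rfl

end Programs

section Frame
variable {A : Type} [DecidableEq A] {n : ℕ} {σ : Store A}

@[simp] lemma set_apply (b b' : A) (i i' w : ℕ) :
    σ.set b i w b' i' = if b' = b ∧ i' = i then w else σ b' i' := rfl

lemma clamp_of_lt {w : ℕ} (hw : w < cap n) : clamp n w = w := if_pos hw

lemma clamp_of_lt_pow {w d : ℕ} (hd : d ≤ 4) (hw : w < (n + 2) ^ d) : clamp n w = w :=
  clamp_of_lt (hw.trans_le (Nat.pow_le_pow_right (by omega) hd))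

lemma clamp_of_le_self {w : ℕ} (hw : w ≤ n) : clamp n w = w :=
  clamp_of_lt_pow (d := 1) (by omega) (by simpa using by omega)

/-- Whether a statement contains an assignment to the array `b`. -/
def Stmt.writes (b : A) : Stmt A → Bool
  | .skip => false
  | .put b' _ _ => b = b'
  | .seq P Q => P.writes b || Q.writes b
  | .ite _ _ P Q => P.writes b || Q.writes b
  | .loop x _ _ P => b = x || P.writes b

lemma iter_inv {α : Type*} {body : ℕ → α → α} (I : ℕ → α → Prop) {a : α} {M : ℕ} (h0 : I 0 a)
    (hs : ∀ i a, i < M → I i a → I (i + 1) (body i a)) : I M (iter body M a) := by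
  induction M with
  | zero => exact h0
  | succ M ih =>
    exact hs M _ M.lt_succ_self (ih fun i a hi => hs i a (hi.trans M.lt_succ_self))

lemma set_of_ne {b b' : A} (h : b' ≠ b) (i w : ℕ) : σ.set b i w b' = σ b' := by
  funext i'
  simp [h]

lemma Stmt.run_of_not_writes {P : Stmt A} {b : A} (h : P.writes b = false) :
    P.run n σ b = σ b := by
  induction P generalizing σ with
  | skip => rfl
  | put b' i e => exact set_of_ne (by simpa [writes] using h) _ _
  | seq P Q ihP ihQ =>
    simp only [writes, Bool.or_eq_false_iff] at h
    rw [run_seq, ihQ h.2, ihP h.1]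
  | ite e f P Q ihP ihQ =>
    simp only [writes, Bool.or_eq_false_iff] at h
    rw [run_ite]
    split_ifs
    exacts [ihP h.1, ihQ h.2]
  | loop x k e P ih =>
    simp only [writes, Bool.or_eq_false_iff, decide_eq_false_iff_not] at h
    refine iter_inv (fun _ (τ : Store A) => τ b = σ b) rfl fun i τ _ hτ => ?_
    rw [ih h.2, set_of_ne h.1, hτ]

lemma Stmt.loop_inv {x : A} {k : ℕ} {e : Ex A} {P : Stmt A} (M : ℕ) (hk : k ≤ 4)
    (hM : e.eval n σ = M) (hMk : M ≤ n ^ k) (I : ℕ → Store A → Prop) (h0 : I 0 σ)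
    (hs : ∀ i (τ : Store A), i < M → (∀ b, (loop x k e P).writes b = false → τ b = σ b) →
      I i τ → I (i + 1) (P.run n (τ.set x 0 i))) :
    I M ((loop x k e P).run n σ) := by
  rw [run, hM, min_eq_left hMk]
  refine (iter_inv
    (fun i (τ : Store A) => (∀ b, (loop x k e P).writes b = false → τ b = σ b) ∧ I i τ)
    ⟨fun _ _ => rfl, h0⟩ fun i τ hi hτ => ?_).2
  rw [clamp_of_lt_pow hk ((hi.trans_le hMk).trans_le (Nat.pow_le_pow_left (by omega) k))]
  refine ⟨fun b hb => ?_, hs i τ hi hτ.1 hτ.2⟩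
  obtain ⟨hbx, hbP⟩ : b ≠ x ∧ P.writes b = false := by simpa [writes] using hb
  rw [run_of_not_writes hbP, set_of_ne hbx, hτ.1 b hb]

end Frame

/-- The arrays and scalar variables of the tree clustering program. The array `io` is the memory
region that holds the input at the start and the output at the end. -/
inductive Arr
  | io
  | edge | pass | left | par | child | stamp
  | step | quad | table | gain | keep | origin
  | digits | row | place | total | carry | round
  | kept | size | minSize | cost | less | best | bestKept | bestSize
  | want
  deriving DecidableEq, Encodable, Inhabited

@[simp] lemma default_arr : (default : Arr) = .io := rfl

/-! ### Ordering the edges -/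

/-- The endpoint `x = 1, 2` of the current edge. -/
def endpoint (x : ℕ) : Ex Arr := .get .io (2 * Arr.edge + .lit x)

/-- Make endpoint `x` of the current edge a child of endpoint `y` if exactly `y` has been
reached. -/
def appendEdge (x y : ℕ) : Stmt Arr :=
  .ite 0 ((1 - .get .stamp (endpoint x)) * .get .stamp (endpoint y))
    (.put .stamp (endpoint x) Arr.left ;; .put .left 0 (Arr.left - 1) ;;
      .put .par Arr.left (endpoint y) ;; .put .child Arr.left (endpoint x))
    .skip

/-- Scan the list of edges. -/
def scanEdges : Stmt Arr := .loop .edge 1 (.len - 1) (appendEdge 1 2 ;; appendEdge 2 1)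

/-- Grow the tree from the root, filling `par` and `child` from the end; `left` counts the vertices
that have not been reached yet. -/
def orderEdges : Stmt Arr :=
  .put .left 0 (.len - 1) ;; .put .stamp 0 .len ;; .loop .pass 1 .len scanEdges

section Order
variable {n : ℕ}

/-- The vertices reached so far. -/
def reached (n : ℕ) (σ : Store Arr) : Finset (Fin n) := {v | 0 < σ .stamp v}

lemma card_reached_of_stamp {σ τ : Store Arr} {u s : ℕ} (hu : u < n) (hu0 : σ .stamp u = 0)
    (hs : 0 < s) (hstamp : ∀ v, τ .stamp v = if v = u then s else σ .stamp v) :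
    (reached n τ).card = (reached n σ).card + 1 := by
  have hreached : reached n τ = insert ⟨u, hu⟩ (reached n σ) := by
    ext v
    simp only [reached, Finset.mem_insert, Finset.mem_filter_univ, hstamp, Fin.ext_iff]
    split_ifs with hvu <;> simp [hvu, hs]
  rw [hreached, Finset.card_insert_of_notMem (by simp [reached, hu0])]

variable [NeZero n] {T : SimpleGraph (Fin n)}

/-- The array `io` holds the edges of `T` behind its first entry. -/
structure HoldsEdges (T : SimpleGraph (Fin n)) (io : ℕ → ℕ) : Prop where
  lt : ∀ j < n - 1, io (2 * j + 1) < n ∧ io (2 * j + 2) < n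
  adj : ∀ j < n - 1, T.Adj (Fin.ofNat n (io (2 * j + 1))) (Fin.ofNat n (io (2 * j + 2)))
  complete : ∀ u v : Fin n, T.Adj u v → ∃ j < n - 1,
    (io (2 * j + 1) = u ∧ io (2 * j + 2) = v) ∨ (io (2 * j + 1) = v ∧ io (2 * j + 2) = u)

lemma HoldsEdges.closed {io : ℕ → ℕ} (hio : HoldsEdges T io) {p : ℕ → Prop}
    (hp : ∀ j < n - 1, p (io (2 * j + 1)) ↔ p (io (2 * j + 2))) (u v : Fin n) (huv : T.Adj u v) :
    p u ↔ p v := by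
  obtain ⟨j, hj, ⟨hu, hv⟩ | ⟨hv, hu⟩⟩ := hio.complete u v huv
  · rw [← hu, ← hv, hp j hj]
  · rw [← hu, ← hv, hp j hj]

/-- All but `left` vertices have been reached from the root, by the edges from `par t` to `child t`
with `left ≤ t`. The stamp of a vertex is `0` until the vertex is reached; stamps are given in
decreasing order, so that a parent has a larger stamp than its children. -/
structure PartialOrdering (T : SimpleGraph (Fin n)) (σ : Store Arr) : Prop where
  left_lt : σ .left 0 < n
  stamp_root : σ .stamp 0 = n
  par_lt : ∀ t, σ .left 0 ≤ t → t < n - 1 → σ .par t < n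
  child_lt : ∀ t, σ .left 0 ≤ t → t < n - 1 → σ .child t < n
  stamp_child : ∀ t, σ .left 0 ≤ t → t < n - 1 → σ .stamp (σ .child t) = t + 1
  stamp_par : ∀ t, σ .left 0 ≤ t → t < n - 1 → t + 1 < σ .stamp (σ .par t)
  adj : ∀ t, σ .left 0 ≤ t → t < n - 1 →
    T.Adj (Fin.ofNat n (σ .par t)) (Fin.ofNat n (σ .child t))
  eq_child : ∀ v < n, 0 < σ .stamp v → v = 0 ∨ ∃ t, σ .left 0 ≤ t ∧ t < n - 1 ∧ v = σ .child t
  card_reached : (reached n σ).card = n - σ .left 0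

namespace PartialOrdering
variable {σ : Store Arr}

lemma left_lt_stamp (h : PartialOrdering T σ) {v : ℕ} (hv : v < n) (hpos : 0 < σ .stamp v) :
    σ .left 0 < σ .stamp v := by
  rcases h.eq_child v hv hpos with rfl | ⟨t, hlt, htn, rfl⟩
  · rw [h.stamp_root]
    exact h.left_lt
  · rw [h.stamp_child t hlt htn]
    omega

lemma of_unreached (h0 : σ .left 0 = n - 1) (hroot : σ .stamp 0 = n)
    (hstamp : ∀ v ≠ 0, σ .stamp v = 0) : PartialOrdering T σ where
  left_lt := by have := NeZero.pos n; omega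
  stamp_root := hroot
  par_lt t := by omega
  child_lt t := by omega
  stamp_child t := by omega
  stamp_par t := by omega
  adj t := by omega
  eq_child v _ hpos := by
    by_contra! hv
    exact hpos.ne' (hstamp v hv.1)
  card_reached := by
    have hreached : reached n σ = {0} := by
      ext v
      rw [reached, Finset.mem_filter_univ, Finset.mem_singleton]
      constructor
      · intro hpos
        by_contra hv
        exact hpos.ne' (hstamp v (Fin.val_ne_zero_iff.2 hv))
      · rintro rfl
        simpa [hroot] using NeZero.pos n
    rw [hreached, Finset.card_singleton]
    have := NeZero.pos n
    omega

lemma left_pos (h : PartialOrdering T σ) {u : ℕ} (hu : u < n) (hu0 : σ .stamp u = 0) :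
    0 < σ .left 0 := by
  have hcard := Finset.card_lt_univ_of_notMem (s := reached n σ) (x := ⟨u, hu⟩)
    (by simp [reached, hu0])
  rw [h.card_reached, Fintype.card_fin] at hcard
  omega

lemma append (h : PartialOrdering T σ) {u w : ℕ} (hu : u < n) (hw : w < n)
    (hadj : T.Adj (Fin.ofNat n w) (Fin.ofNat n u)) (hu0 : σ .stamp u = 0) (hw0 : 0 < σ .stamp w)
    {τ : Store Arr} (hleft : τ .left 0 + 1 = σ .left 0)
    (hstamp : ∀ v, τ .stamp v = if v = u then σ .left 0 else σ .stamp v)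
    (hpar : ∀ t, τ .par t = if t = τ .left 0 then w else σ .par t)
    (hchild : ∀ t, τ .child t = if t = τ .left 0 then u else σ .child t) :
    PartialOrdering T τ := by
  have hn := h.left_lt
  have hne {v : ℕ} (hv : 0 < σ .stamp v) : τ .stamp v = σ .stamp v := by
    rw [hstamp, if_neg (by rintro rfl; omega)]
  have hsplit (Q : ℕ → ℕ → ℕ → Prop) (hnew : Q (τ .left 0) w u)
      (hold : ∀ t, σ .left 0 ≤ t → t < n - 1 → Q t (σ .par t) (σ .child t)) :
      ∀ t, τ .left 0 ≤ t → t < n - 1 → Q t (τ .par t) (τ .child t) := by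
    intro t hlt htn
    rw [hpar, hchild]
    split_ifs with ht
    exacts [ht ▸ hnew, hold t (by omega) htn]
  constructor
  · omega
  · rw [hne (by rw [h.stamp_root]; omega), h.stamp_root]
  · exact hsplit (fun _ v _ => v < n) hw h.par_lt
  · exact hsplit (fun _ _ v => v < n) hu h.child_lt
  · refine hsplit (fun t _ v => τ .stamp v = t + 1) (by rw [hstamp, if_pos rfl, hleft])
      fun t hlt htn => ?_
    have hs := h.stamp_child t hlt htn
    rw [hne (by omega), hs]
  · refine hsplit (fun t v _ => t + 1 < τ .stamp v) ?_ fun t hlt htn => ?_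
    · rw [hne hw0, hleft]
      exact h.left_lt_stamp hw hw0
    · have hs := h.stamp_par t hlt htn
      rwa [hne (by omega)]
  · exact hsplit (fun _ v v' => T.Adj (Fin.ofNat n v) (Fin.ofNat n v')) hadj h.adj
  · intro v hv hpos
    by_cases hvu : v = u
    · exact .inr ⟨τ .left 0, le_rfl, by omega, by rw [hvu, hchild, if_pos rfl]⟩
    · rw [hstamp, if_neg hvu] at hpos
      refine (h.eq_child v hv hpos).imp_right fun ⟨t, hlt, htn, ht⟩ => ⟨t, by omega, htn, ?_⟩
      rw [ht, hchild, if_neg (by omega)]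
  · rw [card_reached_of_stamp hu hu0 (by omega) hstamp, h.card_reached]
    omega

lemma stamp_pos (h : PartialOrdering T σ) (hT : T.Connected)
    (hclosed : ∀ u v : Fin n, T.Adj u v → (0 < σ .stamp u ↔ 0 < σ .stamp v)) (v : Fin n) :
    0 < σ .stamp v := by
  by_contra hv
  obtain ⟨p⟩ := hT.preconnected 0 v
  obtain ⟨d, -, hfst, hsnd⟩ := p.exists_boundary_dart {v : Fin n | 0 < σ .stamp v}
    (by simpa [h.stamp_root] using NeZero.pos n) hv
  exact hsnd ((hclosed _ _ d.adj).1 hfst)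

lemma left_eq_zero (h : PartialOrdering T σ) (hall : ∀ v : Fin n, 0 < σ .stamp v) :
    σ .left 0 = 0 := by
  have hn := h.left_lt
  have hcard := h.card_reached
  rw [reached, Finset.filter_true_of_mem fun v _ => hall v, Finset.card_univ,
    Fintype.card_fin] at hcard
  omega

lemma stamp_pos_of_left_eq_zero (h : PartialOrdering T σ) (h0 : σ .left 0 = 0) {v : ℕ}
    (hv : v < n) : 0 < σ .stamp v := by
  by_contra! hv0
  have := h.left_pos hv (by omega)
  omega

/-- The elimination order of the edges from `par t` to `child t`, all vertices being reached. -/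
def eliminationOrder (h : PartialOrdering T σ) (h0 : σ .left 0 = 0) : EliminationOrder n where
  par := σ .par
  child := σ .child
  par_lt ht := h.par_lt _ (by omega) ht
  child_lt ht := h.child_lt _ (by omega) ht
  par_live {t} ht s hs heq := by
    have hpar := h.stamp_par t (by omega) ht
    have hchild := h.stamp_child s (by omega) (by omega)
    rw [← heq] at hchild
    omega
  child_live {t} ht s hs heq := by
    have hchild := h.stamp_child t (by omega) ht
    have hchild' := h.stamp_child s (by omega) (by omega)
    rw [← heq] at hchild'
    omega
  live_zero s hs heq := by
    have hchild := h.stamp_child s (by omega) (by omega)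
    rw [← heq, h.stamp_root] at hchild
    omega
  eq_zero_of_live {v} hv hlive := by
    rcases h.eq_child v hv (h.stamp_pos_of_left_eq_zero h0 hv) with h | ⟨t, -, htn, rfl⟩
    exacts [h, absurd rfl (hlive t htn)]

lemma congr (h : PartialOrdering T σ) {τ : Store Arr} (hleft : τ .left = σ .left)
    (hpar : τ .par = σ .par) (hchild : τ .child = σ .child) (hstamp : τ .stamp = σ .stamp) :
    PartialOrdering T τ := by
  constructor
  all_goals simp only [hleft, hpar, hchild, hstamp, reached]
  exacts [h.left_lt, h.stamp_root, h.par_lt, h.child_lt, h.stamp_child, h.stamp_par, h.adj,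
    h.eq_child, h.card_reached]

lemma run_appendEdge (h : PartialOrdering T σ) {x y u w : ℕ}
    (hu : σ .io (2 * σ .edge 0 + x) = u) (hw : σ .io (2 * σ .edge 0 + y) = w) (hun : u < n)
    (hwn : w < n) (hadj : T.Adj (Fin.ofNat n w) (Fin.ofNat n u)) :
    PartialOrdering T ((appendEdge x y).run n σ) ∧
      ((appendEdge x y).run n σ .left 0 < σ .left 0 ∨
        (appendEdge x y).run n σ = σ ∧ (0 < σ .stamp w → 0 < σ .stamp u)) := by
  have hn := h.left_lt
  by_cases hc : 0 < (1 - σ .stamp u) * σ .stamp w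
  · obtain ⟨hu0, hw0⟩ : σ .stamp u = 0 ∧ 0 < σ .stamp w := by
      rw [Nat.pos_iff_ne_zero, Nat.mul_ne_zero_iff] at hc
      omega
    have hpos := h.left_pos hun hu0
    have hrun : (appendEdge x y).run n σ = (((σ.set .stamp u (σ .left 0)).set .left 0
        (σ .left 0 - 1)).set .par (σ .left 0 - 1) w).set .child (σ .left 0 - 1) u := by
      simp [appendEdge, endpoint, hu, hw, hc, clamp_of_le_self, hn.le, hun.le, hwn.le,
        (Nat.sub_le _ 1).trans hn.le]
    rw [hrun]
    exact ⟨h.append hun hwn hadj hu0 hw0 (by simp; omega) (by simp) (by simp) (by simp),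
      .inl (by simpa using hpos)⟩
  · have hrun : (appendEdge x y).run n σ = σ := by simp [appendEdge, endpoint, hu, hw, hc]
    rw [hrun]
    refine ⟨h, .inr ⟨rfl, fun hw0 => ?_⟩⟩
    by_contra! hu0
    exact hc (Nat.mul_pos (by omega) hw0)

lemma run_appendEdges (h : PartialOrdering T σ) (hio : HoldsEdges T (σ .io)) {i : ℕ}
    (hi : i < n - 1) (hedge : σ .edge 0 = i) :
    PartialOrdering T ((appendEdge 1 2 ;; appendEdge 2 1).run n σ) ∧
      ((appendEdge 1 2 ;; appendEdge 2 1).run n σ .left 0 < σ .left 0 ∨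
        (appendEdge 1 2 ;; appendEdge 2 1).run n σ = σ ∧
          (0 < σ .stamp (σ .io (2 * i + 1)) ↔ 0 < σ .stamp (σ .io (2 * i + 2)))) := by
  obtain ⟨hlt₁, hlt₂⟩ := hio.lt i hi
  obtain ⟨hord₁, hrun₁⟩ := h.run_appendEdge (x := 1) (y := 2) (by rw [hedge]) (by rw [hedge])
    hlt₁ hlt₂ (hio.adj i hi).symm
  have hframe (b : Arr) (hb : b = .io ∨ b = .edge) : (appendEdge 1 2).run n σ b = σ b := by
    rcases hb with rfl | rfl <;> exact Stmt.run_of_not_writes rfl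
  obtain ⟨hord₂, hrun₂⟩ := hord₁.run_appendEdge (x := 2) (y := 1)
    (by rw [hframe .io (.inl rfl), hframe .edge (.inr rfl), hedge])
    (by rw [hframe .io (.inl rfl), hframe .edge (.inr rfl), hedge]) hlt₂ hlt₁ (hio.adj i hi)
  refine ⟨hord₂, ?_⟩
  rw [run_seq]
  rcases hrun₁ with hlt | ⟨heq₁, hreach₁⟩
  · exact .inl ((hrun₂.elim le_of_lt fun heq => by rw [heq.1]).trans_lt hlt)
  · rw [heq₁] at hrun₂ ⊢
    exact hrun₂.imp_right fun ⟨heq₂, hreach₂⟩ => ⟨heq₂, hreach₂, hreach₁⟩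

end PartialOrdering

lemma scanEdges_spec {σ : Store Arr} (h : PartialOrdering T σ) (hT : T.Connected)
    (hio : HoldsEdges T (σ .io)) : PartialOrdering T (scanEdges.run n σ) ∧
      scanEdges.run n σ .left 0 ≤ σ .left 0 - 1 := by
  obtain ⟨hord, hle, hclosed⟩ : PartialOrdering T (scanEdges.run n σ) ∧
      scanEdges.run n σ .left 0 ≤ σ .left 0 ∧
      (scanEdges.run n σ .left 0 = σ .left 0 → ∀ j < n - 1,
        0 < scanEdges.run n σ .stamp (σ .io (2 * j + 1)) ↔
          0 < scanEdges.run n σ .stamp (σ .io (2 * j + 2))) := by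
    refine Stmt.loop_inv (n - 1) (by omega) rfl (by simp) (fun i τ => PartialOrdering T τ ∧
      τ .left 0 ≤ σ .left 0 ∧ (τ .left 0 = σ .left 0 → ∀ j < i,
        0 < τ .stamp (σ .io (2 * j + 1)) ↔ 0 < τ .stamp (σ .io (2 * j + 2))))
      ⟨h, le_rfl, fun _ j hj => absurd hj j.not_lt_zero⟩ ?_
    rintro i τ hi hτ ⟨hord, hle, hclosed⟩
    have hτio : τ .io = σ .io := hτ .io rfl
    have hset : PartialOrdering T (τ.set .edge 0 i) := hord.congr rfl rfl rfl rfl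
    obtain ⟨hord', hrun⟩ := hset.run_appendEdges
      (by rwa [set_of_ne (by decide), hτio]) hi (by simp)
    simp only [set_apply, reduceCtorEq, false_and, if_false, hτio] at hrun
    refine ⟨hord', ?_⟩
    rcases hrun with hlt | ⟨heq, hreach⟩
    · exact ⟨by omega, by omega⟩
    · simp only [heq, set_apply, reduceCtorEq, false_and, if_false]
      refine ⟨hle, fun hleft j hj => ?_⟩
      rcases Nat.lt_succ_iff_lt_or_eq.1 hj with hj | rfl
      exacts [hclosed hleft j hj, hreach]
  refine ⟨hord, ?_⟩
  rcases hle.lt_or_eq with hlt | heq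
  · exact Nat.le_sub_one_of_lt hlt
  · have hpos := hord.stamp_pos hT
      (hio.closed (p := (0 < scanEdges.run n σ .stamp ·)) (hclosed heq))
    rw [hord.left_eq_zero hpos]
    exact Nat.zero_le _

lemma orderEdges_spec {σ : Store Arr} (hT : T.Connected) (hio : HoldsEdges T (σ .io))
    (hstamp : ∀ v, σ .stamp v = 0) :
    PartialOrdering T (orderEdges.run n σ) ∧ orderEdges.run n σ .left 0 = 0 := by
  let σ₀ := (Stmt.put .left 0 (.len - 1) ;; .put .stamp 0 .len).run n σ
  obtain ⟨hord, hle⟩ : PartialOrdering T (orderEdges.run n σ) ∧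
      orderEdges.run n σ .left 0 ≤ n - 1 - n := by
    refine Stmt.loop_inv (σ := σ₀) n (by omega) rfl (by simp)
      (fun i τ => PartialOrdering T τ ∧ τ .left 0 ≤ n - 1 - i) ⟨?_, ?_⟩ ?_
    · refine .of_unreached ?_ ?_ fun v hv => ?_
      all_goals simp [σ₀, clamp_of_le_self, *]
    · simp [σ₀, clamp_of_le_self]
    · rintro i τ - hτ ⟨hord, hle⟩
      obtain ⟨hord', hle'⟩ := scanEdges_spec (σ := τ.set .pass 0 i) (hord.congr rfl rfl rfl rfl) hT
        (by rwa [set_of_ne (by decide), hτ .io rfl])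
      rw [set_of_ne (by decide)] at hle'
      exact ⟨hord', by omega⟩
  exact ⟨hord, by omega⟩

end Order

/-! ### The table of costs -/

/-- The `i`-th digit of `q` in base `n`. -/
def digit (n q i : ℕ) : ℕ := q / n ^ i % n

/-- The size and the number of kept edges of the upper part, as encoded by `q`. -/
def upper (n q : ℕ) : ℕ × ℕ := (digit n q 3, digit n q 2)

/-- The size and the number of kept edges of the lower part, as encoded by `q`. -/
def lower (n q : ℕ) : ℕ × ℕ := (digit n q 1, digit n q 0)

/-- The size and the number of kept edges after joining two parts by an edge that is kept
(`f = 1`) or cut (`f = 0`). -/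
def join (f : ℕ) (x y : ℕ × ℕ) : ℕ × ℕ := (x.1 + f * y.1, x.2 + y.2 + f)

/-- The position in memory of entry `e` of table `i`. -/
def cell (i : ℕ) (e : ℕ × ℕ) : ℕ := sqPair i (sqPair e.1 e.2)

/-- The least known number of intracluster pairs for entry `e = (a, k)` of table `i`: the top
cluster has size `a` and `k` edges are kept. The memory holds the difference to `n * n`, so that
the initial value `0` stands for a cost that is never attained. -/
def entryCost (n : ℕ) (σ : Store Arr) (i : ℕ) (e : ℕ × ℕ) : ℕ := n * n - σ .gain (cell i e)

/-- The cost of joining the entries of tables `l` and `r` encoded by `q`. -/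
def joinCost (n : ℕ) (σ : Store Arr) (l r f q : ℕ) : ℕ :=
  entryCost n σ l (upper n q) + entryCost n σ r (lower n q) +
    f * ((upper n q).1 * (lower n q).1)

lemma exists_upper_lower {n : ℕ} {x y : ℕ × ℕ} (hx₁ : x.1 < n) (hx₂ : x.2 < n) (hy₁ : y.1 < n)
    (hy₂ : y.2 < n) : ∃ q < n ^ 4, upper n q = x ∧ lower n q = y := by
  let d : Fin 4 → Fin n := ![⟨y.2, hy₂⟩, ⟨y.1, hy₁⟩, ⟨x.2, hx₂⟩, ⟨x.1, hx₁⟩]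
  have hd (i : Fin 4) : digit n (finFunctionFinEquiv d) i = d i :=
    congrArg (fun d : Fin 4 → Fin n => (d i : ℕ)) (finFunctionFinEquiv.symm_apply_apply d)
  exact ⟨finFunctionFinEquiv d, Fin.is_lt _, Prod.ext (hd 3) (hd 2), Prod.ext (hd 1) (hd 0)⟩

lemma cell_inj {i j : ℕ} {e e' : ℕ × ℕ} : cell i e = cell j e' ↔ i = j ∧ e = e' := by
  simp [cell, Prod.ext_iff]

/-- Two states hold the same table `i`. -/
def SameTable (i : ℕ) (σ τ : Store Arr) : Prop :=
  ∀ e, σ .gain (cell i e) = τ .gain (cell i e) ∧ σ .keep (cell i e) = τ .keep (cell i e) ∧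
    σ .origin (cell i e) = τ .origin (cell i e)

lemma SameTable.symm {i : ℕ} {σ τ : Store Arr} (h : SameTable i σ τ) : SameTable i τ σ :=
  fun e => ⟨(h e).1.symm, (h e).2.1.symm, (h e).2.2.symm⟩

lemma SameTable.trans {i : ℕ} {σ τ ρ : Store Arr} (h : SameTable i σ τ) (h' : SameTable i τ ρ) :
    SameTable i σ ρ := fun e =>
  ⟨(h e).1.trans (h' e).1, (h e).2.1.trans (h' e).2.1, (h e).2.2.trans (h' e).2.2⟩

lemma sameTable_of_eq {σ τ : Store Arr} (i : ℕ) (hgain : σ .gain = τ .gain)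
    (hkeep : σ .keep = τ .keep) (horigin : σ .origin = τ .origin) : SameTable i σ τ := fun _ =>
  ⟨congrFun hgain _, congrFun hkeep _, congrFun horigin _⟩

lemma SameTable.entryCost_eq {n i : ℕ} {σ τ : Store Arr} (h : SameTable i σ τ) (e : ℕ × ℕ) :
    entryCost n σ i e = entryCost n τ i e := by
  rw [entryCost, entryCost, (h e).1]

/-- Table `i` results from joining the tables `l` and `r` in the ways listed in `S`, which consists
of pairs `(q, f)`. -/
structure Combined (n : ℕ) (σ : Store Arr) (i l r : ℕ) (S : Set (ℕ × ℕ)) : Prop where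
  keep_le : ∀ e, entryCost n σ i e < n * n → σ .keep (cell i e) ≤ 1
  eq_join : ∀ e, entryCost n σ i e < n * n →
    e = join (σ .keep (cell i e)) (upper n (σ .origin (cell i e))) (lower n (σ .origin (cell i e)))
  eq_joinCost : ∀ e, entryCost n σ i e < n * n →
    entryCost n σ i e = joinCost n σ l r (σ .keep (cell i e)) (σ .origin (cell i e))
  le_joinCost : ∀ x ∈ S, entryCost n σ i (join x.2 (upper n x.1) (lower n x.1)) ≤
    joinCost n σ l r x.2 x.1

lemma Combined.congr {n i l r : ℕ} {σ τ : Store Arr} {S : Set (ℕ × ℕ)} (h : Combined n σ i l r S)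
    (hi : SameTable i σ τ) (hl : SameTable l σ τ) (hr : SameTable r σ τ) :
    Combined n τ i l r S := by
  have hjoin (f q : ℕ) : joinCost n σ l r f q = joinCost n τ l r f q := by
    rw [joinCost, joinCost, hl.entryCost_eq, hr.entryCost_eq]
  constructor
  · intro e
    rw [← hi.entryCost_eq, ← (hi e).2.1]
    exact h.keep_le e
  · intro e
    rw [← hi.entryCost_eq, ← (hi e).2.1, ← (hi e).2.2]
    exact h.eq_join e
  · intro e
    rw [← hi.entryCost_eq, ← (hi e).2.1, ← (hi e).2.2, ← hjoin]
    exact h.eq_joinCost e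
  · intro x
    rw [← hi.entryCost_eq, ← hjoin]
    exact h.le_joinCost x

lemma Combined.mono {n i l r : ℕ} {σ : Store Arr} {S S' : Set (ℕ × ℕ)} (h : Combined n σ i l r S)
    (hS : S' ⊆ S) : Combined n σ i l r S' :=
  { h with le_joinCost := fun x hx => h.le_joinCost x (hS hx) }

/-- The expression with value `digit`. -/
def digitExpr (e : Ex Arr) : ℕ → Ex Arr
  | 0 => e % .len
  | i + 1 => digitExpr (e / .len) i

/-- The expression with value `cell`. -/
def cellExpr (i a k : Ex Arr) : Ex Arr := i.pair (a.pair k)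

/-- The expression with value `entryCost`. -/
def entryCostExpr (i a k : Ex Arr) : Ex Arr := .len * .len - .get .gain (cellExpr i a k)

/-- The number of the table of a vertex. -/
def tableOf (v : Arr) : Ex Arr := .get .table (.get v Arr.step)

/-- The expression with value `joinCost`. -/
def joinCostExpr (f : ℕ) : Ex Arr :=
  entryCostExpr (tableOf .par) (digitExpr Arr.quad 3) (digitExpr Arr.quad 2) +
    entryCostExpr (tableOf .child) (digitExpr Arr.quad 1) (digitExpr Arr.quad 0) +
    .lit f * (digitExpr Arr.quad 3 * digitExpr Arr.quad 1)

/-- Improve the current table by one way of joining two entries. -/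
def relax (f : ℕ) : Stmt Arr :=
  let i : Ex Arr := .len + Arr.step
  let a : Ex Arr := digitExpr Arr.quad 3 + .lit f * digitExpr Arr.quad 1
  let k : Ex Arr := digitExpr Arr.quad 2 + digitExpr Arr.quad 0 + .lit f
  .ite (joinCostExpr f) (entryCostExpr i a k)
    (.put .keep (cellExpr i a k) (.lit f) ;; .put .origin (cellExpr i a k) Arr.quad ;;
      .put .gain (cellExpr i a k) (.len * .len - joinCostExpr f)) .skip

/-- Fill the table of the current step. -/
def combine : Stmt Arr :=
  .loop .quad 4 (.len * .len * .len * .len) (relax 0 ;; relax 1)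

/-- Fill the tables of the single vertices. -/
def fillLeaves : Stmt Arr :=
  .loop .step 1 .len
    (.put .gain (cellExpr Arr.step 1 0) (.len * .len) ;; .put .table Arr.step Arr.step)

/-- Fill the tables of the single vertices, then that of each step of the elimination order. -/
def fillTables : Stmt Arr :=
  fillLeaves ;;
  .loop .step 1 (.len - 1) (combine ;; .put .table (.get .par Arr.step) (.len + Arr.step))

section Tables
variable {n : ℕ} {σ : Store Arr}

@[simp] lemma eval_digitExpr (e : Ex Arr) (i : ℕ) :
    (digitExpr e i).eval n σ = digit n (e.eval n σ) i := by
  induction i generalizing e with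
  | zero => simp [digitExpr, digit]
  | succ i ih => rw [digitExpr, ih, digit, digit, eval_div, Nat.div_div_eq_div_mul, pow_succ',
      eval_len]

@[simp] lemma eval_cellExpr (i a k : Ex Arr) :
    (cellExpr i a k).eval n σ = cell (i.eval n σ) (a.eval n σ, k.eval n σ) := rfl

@[simp] lemma eval_entryCostExpr (i a k : Ex Arr) :
    (entryCostExpr i a k).eval n σ = entryCost n σ (i.eval n σ) (a.eval n σ, k.eval n σ) := rfl

@[simp] lemma eval_joinCostExpr (f : ℕ) : (joinCostExpr f).eval n σ =
    joinCost n σ (σ .table (σ .par (σ .step 0))) (σ .table (σ .child (σ .step 0))) f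
      (σ .quad 0) := by
  simp [joinCostExpr, joinCost, upper, lower, tableOf]

/-- The effect of `relax f` when the counter `quad` has value `q`. -/
def improve (n : ℕ) (σ : Store Arr) (i l r f q : ℕ) : Store Arr :=
  let e := join f (upper n q) (lower n q)
  if joinCost n σ l r f q < entryCost n σ i e then
    ((σ.set .keep (cell i e) f).set .origin (cell i e) q).set .gain (cell i e)
      (n * n - joinCost n σ l r f q)
  else σ

lemma relax_run {f : ℕ} (hf : f ≤ 1) (hq : σ .quad 0 < n ^ 4) :
    (relax f).run n σ = improve n σ (n + σ .step 0) (σ .table (σ .par (σ .step 0)))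
      (σ .table (σ .child (σ .step 0))) f (σ .quad 0) := by
  have hclamp_f : clamp n f = f := clamp_of_lt_pow (d := 1) (by omega) (by rw [pow_one]; omega)
  have hclamp_q : clamp n (σ .quad 0) = σ .quad 0 :=
    clamp_of_lt_pow le_rfl (hq.trans_le (Nat.pow_le_pow_left (by omega) 4))
  have hclamp (x : ℕ) : clamp n (n * n - x) = n * n - x :=
    clamp_of_lt_pow (d := 2) (by omega) (by rw [pow_two]; nlinarith [Nat.sub_le (n * n) x])
  simp only [relax, improve, run_ite, run_seq, run_put, run_skip, eval_joinCostExpr,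
    eval_entryCostExpr, eval_cellExpr, eval_add, eval_sub, eval_mul, eval_len, eval_get, eval_zero,
    eval_lit, eval_digitExpr, set_apply, reduceCtorEq, false_and, if_false, joinCost, entryCost,
    join, upper, lower, hclamp_f, hclamp_q, hclamp]
  rfl

lemma improve_sameTable {i l r f q j : ℕ} (hj : j ≠ i) :
    SameTable j (improve n σ i l r f q) σ := by
  rw [improve]
  split_ifs
  · intro e
    simp [cell_inj, hj]
  · exact sameTable_of_eq j rfl rfl rfl

lemma joinCost_improve {i l r : ℕ} (hl : l ≠ i) (hr : r ≠ i) (f q f' q' : ℕ) :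
    joinCost n (improve n σ i l r f q) l r f' q' = joinCost n σ l r f' q' := by
  rw [joinCost, joinCost, (improve_sameTable hl).entryCost_eq, (improve_sameTable hr).entryCost_eq]

lemma entryCost_improve (i l r f q : ℕ) (e : ℕ × ℕ) :
    entryCost n (improve n σ i l r f q) i e = if e = join f (upper n q) (lower n q) then
      min (joinCost n σ l r f q) (entryCost n σ i e) else entryCost n σ i e := by
  rw [improve]
  split_ifs with hlt heq heq
  · have hle : joinCost n σ l r f q ≤ n * n := hlt.le.trans (Nat.sub_le _ _)
    rw [heq, min_eq_left hlt.le]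
    simpa [entryCost] using Nat.sub_sub_self hle
  · simp [entryCost, cell_inj, heq]
  · rw [heq, min_eq_right (not_lt.1 hlt)]
  · rfl

lemma Combined.improve {i l r f q : ℕ} {S : Set (ℕ × ℕ)} (h : Combined n σ i l r S)
    (hl : l ≠ i) (hr : r ≠ i) (hf : f ≤ 1) :
    Combined n (improve n σ i l r f q) i l r (insert (q, f) S) := by
  have hcost := entryCost_improve (n := n) (σ := σ) i l r f q
  have hjoin := joinCost_improve (n := n) (σ := σ) hl hr f q
  set e := join f (upper n q) (lower n q)
  set τ := LoopLang.improve n σ i l r f q with hτ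
  have hle : ∀ x ∈ insert (q, f) S,
      entryCost n τ i (join x.2 (upper n x.1) (lower n x.1)) ≤ joinCost n τ l r x.2 x.1 := by
    rintro x (rfl | hx)
    · rw [hcost, hjoin, if_pos rfl]
      exact min_le_left _ _
    · rw [hcost, hjoin]
      split_ifs
      exacts [(min_le_right _ _).trans (h.le_joinCost x hx), h.le_joinCost x hx]
  by_cases hlt : joinCost n σ l r f q < entryCost n σ i e
  · have hkeep (e' : ℕ × ℕ) : τ .keep (cell i e') = if e' = e then f else σ .keep (cell i e') := by
      simp [hτ, LoopLang.improve, e, hlt, cell_inj]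
    have horigin (e' : ℕ × ℕ) :
        τ .origin (cell i e') = if e' = e then q else σ .origin (cell i e') := by
      simp [hτ, LoopLang.improve, e, hlt, cell_inj]
    refine ⟨fun e' => ?_, fun e' => ?_, fun e' => ?_, hle⟩
    · rw [hcost, hkeep]
      split_ifs
      exacts [fun _ => hf, h.keep_le e']
    · rw [hcost, hkeep, horigin]
      split_ifs with heq
      exacts [fun _ => heq, h.eq_join e']
    · rw [hcost, hkeep, horigin, hjoin]
      split_ifs with heq
      exacts [fun _ => min_eq_left (heq ▸ hlt.le), h.eq_joinCost e']
  · have hτσ : τ = σ := if_neg hlt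
    rw [hτσ] at hle ⊢
    exact { h with le_joinCost := hle }

/-- All ways of joining two entries of the tables below. -/
def allJoins (n : ℕ) : Set (ℕ × ℕ) := {x | x.1 < n ^ 4 ∧ x.2 ≤ 1}

lemma relax_spec {i l r f q : ℕ} {S : Set (ℕ × ℕ)} (hstep : n + σ .step 0 = i)
    (hpar : σ .table (σ .par (σ .step 0)) = l) (hchild : σ .table (σ .child (σ .step 0)) = r)
    (hl : l ≠ i) (hr : r ≠ i) (hquad : σ .quad 0 = q) (hq : q < n ^ 4) (hf : f ≤ 1)
    (h : Combined n σ i l r S) :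
    Combined n ((relax f).run n σ) i l r (insert (q, f) S) ∧
      ∀ j ≠ i, SameTable j ((relax f).run n σ) σ := by
  subst hquad
  rw [relax_run hf hq, hstep, hpar, hchild]
  exact ⟨h.improve hl hr hf, fun j hj => improve_sameTable hj⟩

lemma combine_spec {i l r : ℕ} (hstep : n + σ .step 0 = i)
    (hpar : σ .table (σ .par (σ .step 0)) = l) (hchild : σ .table (σ .child (σ .step 0)) = r)
    (hl : l ≠ i) (hr : r ≠ i) (hgain : ∀ e, σ .gain (cell i e) = 0) :
    Combined n (combine.run n σ) i l r (allJoins n) ∧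
      ∀ j ≠ i, SameTable j (combine.run n σ) σ := by
  refine Stmt.loop_inv (n ^ 4) le_rfl (by simp only [eval_mul, eval_len]; ring) le_rfl
    (fun m τ => Combined n τ i l r {x | x.1 < m ∧ x.2 ≤ 1} ∧ ∀ j ≠ i, SameTable j τ σ)
    ⟨?_, fun j _ => sameTable_of_eq j rfl rfl rfl⟩ ?_
  · have hcost (e : ℕ × ℕ) : ¬ entryCost n σ i e < n * n := by simp [entryCost, hgain]
    exact ⟨fun e h => absurd h (hcost e), fun e h => absurd h (hcost e),
      fun e h => absurd h (hcost e), fun x hx => absurd hx.1 x.1.not_lt_zero⟩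
  · rintro q τ hq hτ ⟨hcomb, hsame⟩
    have hset (j : ℕ) : SameTable j τ (τ.set .quad 0 q) := sameTable_of_eq j rfl rfl rfl
    rw [← hτ .step rfl, ← hτ .par rfl, ← hτ .table rfl] at hpar
    rw [← hτ .step rfl, ← hτ .child rfl, ← hτ .table rfl] at hchild
    rw [← hτ .step rfl] at hstep
    obtain ⟨hcomb₀, hsame₀⟩ := relax_spec (σ := τ.set .quad 0 q) hstep hpar hchild hl hr
      (by simp) hq zero_le_one (hcomb.congr (hset i) (hset l) (hset r))
    have hframe (b : Arr) (hb : (relax 0).writes b = false) :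
        (relax 0).run n (τ.set .quad 0 q) b = τ.set .quad 0 q b := Stmt.run_of_not_writes hb
    obtain ⟨hcomb₁, hsame₁⟩ := relax_spec (σ := (relax 0).run n (τ.set .quad 0 q))
      (by rwa [hframe .step rfl]) (by rwa [hframe .step rfl, hframe .par rfl, hframe .table rfl])
      (by rwa [hframe .step rfl, hframe .child rfl, hframe .table rfl]) hl hr
      (by rw [hframe .quad rfl]; simp) hq le_rfl hcomb₀
    refine ⟨hcomb₁.mono fun x ⟨hxq, hxf⟩ => ?_, fun j hj => (hsame₁ j hj).trans
      ((hsame₀ j hj).trans (((hset j).symm).trans (hsame j hj)))⟩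
    simp only [Set.mem_insert_iff, Set.mem_ofPred_eq, Prod.ext_iff]
    omega

/-- The number of the table of vertex `v` after `t` steps: table `v < n` is that of the single
vertex, table `n + t` is the one filled by step `t`. -/
def tableAt (O : EliminationOrder n) : ℕ → ℕ → ℕ
  | 0, v => v
  | t + 1, v => if v = O.par t then n + t else tableAt O t v

lemma tableAt_lt (O : EliminationOrder n) (t : ℕ) {v : ℕ} (hv : v < n) :
    tableAt O t v < n + t := by
  induction t with
  | zero => simpa [tableAt] using hv
  | succ t ih =>
    rw [tableAt]
    split_ifs <;> omega

/-- The tables of the single vertices and of the first `t` steps are correct. -/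
structure Filled (O : EliminationOrder n) (σ : Store Arr) (t : ℕ) : Prop where
  leaf : ∀ v < n, ∀ e, entryCost n σ v e = if e = (1, 0) then 0 else n * n
  combined : ∀ s < t, Combined n σ (n + s) (tableAt O s (O.par s)) (tableAt O s (O.child s))
    (allJoins n)

variable {O : EliminationOrder n}

lemma Filled.congr {t : ℕ} {τ : Store Arr} (h : Filled O σ t) (ht : t ≤ n - 1)
    (hsame : ∀ i < n + t, SameTable i σ τ) : Filled O τ t where
  leaf v hv e := by rw [← (hsame v (by omega)).entryCost_eq, h.leaf v hv]
  combined s hs :=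
    have hpar := tableAt_lt O s (O.par_lt (hs.trans_le ht))
    have hchild := tableAt_lt O s (O.child_lt (hs.trans_le ht))
    (h.combined s hs).congr (hsame _ (by omega)) (hsame _ (by omega)) (hsame _ (by omega))

lemma fillLeaves_spec (hgain : ∀ i, σ .gain i = 0) :
    Filled O (fillLeaves.run n σ) 0 ∧
      (∀ v < n, fillLeaves.run n σ .table v = v) ∧
      ∀ i, n ≤ i → ∀ e, fillLeaves.run n σ .gain (cell i e) = 0 := by
  obtain ⟨hleaf, htable⟩ : (∀ i e, fillLeaves.run n σ .gain (cell i e) =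
      if i < n ∧ e = (1, 0) then n * n else 0) ∧ ∀ v < n, fillLeaves.run n σ .table v = v := by
    refine Stmt.loop_inv n (by omega) rfl (by simp) (fun m (τ : Store Arr) =>
      (∀ i e, τ .gain (cell i e) = if i < m ∧ e = (1, 0) then n * n else 0) ∧
        ∀ v < m, τ .table v = v)
      ⟨fun i e => by simp [hgain], fun v hv => absurd hv v.not_lt_zero⟩ ?_
    rintro m τ hm - ⟨hleaf, htable⟩
    have hclamp : clamp n (n * n) = n * n :=
      clamp_of_lt_pow (d := 2) (by omega) (by rw [pow_two]; nlinarith)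
    constructor
    · intro i e
      simp only [run_seq, run_put, eval_cellExpr, eval_get, eval_zero, eval_one, eval_mul, eval_len,
        set_apply, reduceCtorEq, false_and, true_and, if_false, cell_inj, hclamp, hleaf]
      grind
    · intro v hv
      rcases Nat.lt_succ_iff_lt_or_eq.1 hv with hv | rfl
      · simp [htable v hv, hv.ne]
      · simp [clamp_of_le_self hm.le]
  refine ⟨⟨fun v hv e => ?_, fun s hs => absurd hs s.not_lt_zero⟩, htable, fun i hi e => ?_⟩
  · rw [entryCost, hleaf]
    split_ifs <;> simp_all
  · rw [hleaf, if_neg (by omega)]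

lemma fillTables_spec (hpar : σ .par = O.par) (hchild : σ .child = O.child)
    (hgain : ∀ i, σ .gain i = 0) : Filled O (fillTables.run n σ) (n - 1) ∧
      ∀ v < n, fillTables.run n σ .table v = tableAt O (n - 1) v := by
  obtain ⟨hleaf, hvert, hzero⟩ := fillLeaves_spec (O := O) hgain
  suffices h : Filled O (fillTables.run n σ) (n - 1) ∧
      (∀ v < n, fillTables.run n σ .table v = tableAt O (n - 1) v) ∧
      ∀ i, n + (n - 1) ≤ i → ∀ e, fillTables.run n σ .gain (cell i e) = 0 from ⟨h.1, h.2.1⟩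
  refine Stmt.loop_inv (σ := fillLeaves.run n σ) (n - 1) (by omega) rfl (by simp)
    (fun t τ => Filled O τ t ∧ (∀ v < n, τ .table v = tableAt O t v) ∧
      ∀ i, n + t ≤ i → ∀ e, τ .gain (cell i e) = 0) ⟨hleaf, hvert, hzero⟩ ?_
  rintro t τ ht hτ ⟨hfilled, htable, hzero⟩
  have hτpar : τ .par = O.par := by rw [hτ .par rfl, Stmt.run_of_not_writes rfl, hpar]
  have hτchild : τ .child = O.child := by rw [hτ .child rfl, Stmt.run_of_not_writes rfl, hchild]
  set ρ := combine.run n (τ.set .step 0 t) with hρ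
  have hframe (b : Arr) (hb : combine.writes b = false) : ρ b = τ.set .step 0 t b :=
    Stmt.run_of_not_writes hb
  have hltpar := tableAt_lt O t (O.par_lt ht)
  have hltchild := tableAt_lt O t (O.child_lt ht)
  obtain ⟨hcomb, hsame⟩ := combine_spec (n := n) (σ := τ.set .step 0 t) (i := n + t)
    (l := tableAt O t (O.par t)) (r := tableAt O t (O.child t)) (by simp)
    (by simp [hτpar, htable _ (O.par_lt ht)]) (by simp [hτchild, htable _ (O.child_lt ht)])
    hltpar.ne hltchild.ne (fun e => hzero _ le_rfl e)
  have hput : (Stmt.put Arr.table (.get .par Arr.step) (.len + Arr.step)).run n ρ =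
      ρ.set .table (O.par t) (n + t) := by
    have hclamp : clamp n (n + t) = n + t :=
      clamp_of_lt_pow (d := 2) (by omega) (by rw [pow_two]; nlinarith [ht.trans_le (n.sub_le 1)])
    simp [hframe .par rfl, hframe .step rfl, hτpar, hclamp]
  have hset (i : ℕ) : SameTable i ρ (ρ.set .table (O.par t) (n + t)) :=
    sameTable_of_eq i rfl rfl rfl
  have hsame' (i : ℕ) (hi : i ≠ n + t) : SameTable i τ (ρ.set .table (O.par t) (n + t)) :=
    (hsame i hi).symm.trans (hset i)
  rw [run_seq, ← hρ, hput]
  refine ⟨⟨(hfilled.congr ht.le fun i hi => hsame' i hi.ne).leaf, fun s hs => ?_⟩,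
    fun v hv => ?_, fun i hi e => ?_⟩
  · rcases Nat.lt_succ_iff_lt_or_eq.1 hs with hs | rfl
    · exact (hfilled.congr ht.le fun i hi => hsame' i hi.ne).combined s hs
    · exact hcomb.congr (hset _) (hset _) (hset _)
  · simp [tableAt, hframe .table rfl, htable v hv]
  · rw [← (hsame' i (by omega) e).1, hzero i (by omega)]

/-! ### The values in the table of the root -/

lemma Filled.entryCost_le {t v : ℕ} (h : Filled O σ (n - 1)) (ht : t ≤ n - 1) (hv : v < n)
    (hlive : Live O.child t v) (keep : ℕ → Bool) :
    entryCost n σ (tableAt O t v) (O.size keep t v, O.kept keep t v) ≤ O.cost keep t v := by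
  induction t generalizing v with
  | zero =>
    rw [O.size_zero hv, tableAt, h.leaf v hv]
    exact (if_pos rfl).trans_le (Nat.zero_le _)
  | succ t ih =>
    obtain ⟨hlive, hchild⟩ := live_succ.1 hlive
    by_cases hpar : v = O.par t
    · subst hpar
      have hchild_live := O.child_live ht
      have hsize := O.size_add_size_le (keep := keep) (t := t) (O.par_ne_child ht)
      have hpar_pos := O.size_pos (keep := keep) hv hlive
      have hchild_pos := O.size_pos (keep := keep) (O.child_lt ht) hchild_live
      obtain ⟨q, hq, hupper, hlower⟩ := exists_upper_lower
        (x := (O.size keep t (O.par t), O.kept keep t (O.par t)))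
        (y := (O.size keep t (O.child t), O.kept keep t (O.child t))) (by simp only; omega)
        (O.kept_lt (by omega) hv) (by simp only; omega) (O.kept_lt (by omega) (O.child_lt ht))
      have hjoin := (h.combined t ht).le_joinCost (q, (keep t).toNat) ⟨hq, (keep t).toNat_le⟩
      rw [joinCost, hupper, hlower] at hjoin
      rw [O.size_succ_par ht, tableAt, if_pos rfl, EliminationOrder.kept, EliminationOrder.cost,
        EliminationOrder.gather, EliminationOrder.gather, if_neg hchild, if_pos rfl,
        if_neg hchild, if_pos rfl]
      exact hjoin.trans (add_le_add (add_le_add (ih (by omega) hv hlive)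
        (ih (by omega) (O.child_lt ht) hchild_live)) le_rfl)
    · rw [O.size_succ_of_ne hpar hchild, tableAt, if_neg hpar, EliminationOrder.kept,
        EliminationOrder.cost, EliminationOrder.gather, EliminationOrder.gather, if_neg hchild,
        if_neg hpar, if_neg hchild, if_neg hpar]
      exact ih (by omega) hv hlive

/-- The least cost in table `i` of a choice with `k` kept edges, the top cluster having any size
from `1` to `n`. -/
noncomputable def leastCost (n : ℕ) (σ : Store Arr) (i k : ℕ) : ℕ :=
  ⨅ A : Fin n, entryCost n σ i (A + 1, k)

lemma leastCost_le {i k A : ℕ} (hA : A < n) :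
    leastCost n σ i k ≤ entryCost n σ i (A + 1, k) :=
  ciInf_le' (fun A : Fin n => entryCost n σ i (A + 1, k)) ⟨A, hA⟩

lemma Filled.leastCost_root_le (h : Filled O σ (n - 1)) (hn : 0 < n) (keep : ℕ → Bool) :
    leastCost n σ (tableAt O (n - 1) 0) (O.kept keep (n - 1) 0) ≤ O.cost keep (n - 1) 0 := by
  have hpos := O.size_pos (keep := keep) hn O.live_zero
  have hle := O.size_le (keep := keep) (n - 1) 0
  refine (leastCost_le (A := O.size keep (n - 1) 0 - 1) (by omega)).trans ?_
  rw [Nat.sub_add_cancel hpos]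
  exact h.entryCost_le le_rfl hn O.live_zero keep

lemma Filled.leastCost_root_le_choose [NeZero n] (h : Filled O σ (n - 1)) {k : ℕ} (hk : k < n) :
    leastCost n σ (tableAt O (n - 1) 0) k ≤ n.choose 2 := by
  have hkept : O.kept (fun t => decide (t < k)) (n - 1) 0 = k := by
    have hfilter : ({t ∈ Finset.range (n - 1) | t < k} : Finset ℕ) = Finset.range k := by
      ext t
      simp only [Finset.mem_filter, Finset.mem_range]
      omega
    simp only [EliminationOrder.kept_root, decide_eq_true_eq, hfilter, Finset.card_range]
  rw [← hkept]
  exact (h.leastCost_root_le (NeZero.pos n) _).trans (O.cost_le le_rfl (NeZero.pos n))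

end Tables

/-! ### Arithmetic with many digits -/

/-- The number whose digits in base `b`, from the last one on, are `g 0, …, g (m - 1)`. -/
def numeral (b m : ℕ) (g : ℕ → ℕ) : ℕ := ∑ d ∈ Finset.range m, g d * b ^ d

lemma numeral_succ (b m : ℕ) (g : ℕ → ℕ) : numeral b (m + 1) g = numeral b m g + g m * b ^ m :=
  Finset.sum_range_succ _ _

lemma numeral_congr {b m : ℕ} {g g' : ℕ → ℕ} (h : ∀ d < m, g d = g' d) :
    numeral b m g = numeral b m g' :=
  Finset.sum_congr rfl fun d hd => by rw [h d (Finset.mem_range.1 hd)]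

lemma numeral_lt {b m : ℕ} {g : ℕ → ℕ} (h : ∀ d < m, g d < b) : numeral b m g < b ^ m := by
  induction m with
  | zero => simp [numeral]
  | succ m ih =>
    calc numeral b (m + 1) g = numeral b m g + g m * b ^ m := numeral_succ b m g
      _ < b ^ m + g m * b ^ m := Nat.add_lt_add_right (ih fun d hd => h d (by omega)) _
      _ = (g m + 1) * b ^ m := by ring
      _ ≤ b ^ (m + 1) := by
        rw [pow_succ']
        exact Nat.mul_le_mul_right _ (h m m.lt_succ_self)

lemma numeral_succ_lt_of_lt {b m : ℕ} {g g' : ℕ → ℕ} (h : ∀ d < m, g d < b) (hlt : g m < g' m) :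
    numeral b (m + 1) g < numeral b (m + 1) g' := by
  have hmul : (g m + 1) * b ^ m ≤ g' m * b ^ m := Nat.mul_le_mul_right _ hlt
  have hg := numeral_lt h
  rw [numeral_succ, numeral_succ]
  linarith

/-- The base of the number system: large enough for `n` digits to hold `Nat.choose x j` whenever
`x ≤ n ^ 2` and `j < n`. -/
def base (n : ℕ) : ℕ := n * n + 1

/-- The `n` digits `g` represent `x`. -/
structure Represents (n : ℕ) (g : ℕ → ℕ) (x : ℕ) : Prop where
  lt_base : ∀ d < n, g d < base n
  numeral_eq : numeral (base n) n g = x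

lemma Represents.congr {n : ℕ} {g g' : ℕ → ℕ} {x : ℕ} (h : Represents n g x)
    (hg : ∀ d < n, g' d = g d) : Represents n g' x where
  lt_base d hd := hg d hd ▸ h.lt_base d hd
  numeral_eq := (numeral_congr hg).trans h.numeral_eq

lemma represents_single {n x : ℕ} (hx : x < base n) (hn : 0 < n) :
    Represents n (fun d => if d = 0 then x else 0) x where
  lt_base d _ := by
    split_ifs
    exacts [hx, Nat.succ_pos _]
  numeral_eq := by simp [numeral, hn.ne']

lemma choose_lt_base_pow {n x j : ℕ} (hx : x ≤ n ^ 2) (hj : j < n) :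
    x.choose j < base n ^ n :=
  calc x.choose j ≤ x ^ j := Nat.choose_le_pow x j
    _ ≤ base n ^ j := Nat.pow_le_pow_left (by rw [base]; nlinarith) j
    _ < base n ^ n := Nat.pow_lt_pow_right (by rw [base]; nlinarith) hj

/-- The expression with value `base`. -/
def baseExpr : Ex Arr := .len * .len + 1

/-- The digit at the current place of row `j`. -/
def rowDigit (j : Ex Arr) : Ex Arr := .get .digits (j.pair Arr.place)

/-- Replace the digit at the current place of row `j`. -/
def putRowDigit (j e : Ex Arr) : Stmt Arr := .put .digits (j.pair Arr.place) e

/-- Add the digits at the current place of the rows `n - 2 - row` and `n - 1 - row`. -/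
def addDigit : Stmt Arr :=
  let j : Ex Arr := .len - 1 - Arr.row
  .put .total 0 (rowDigit j + rowDigit (.len - 2 - Arr.row) + Arr.carry) ;;
    putRowDigit j (Arr.total % baseExpr) ;; .put .carry 0 (Arr.total / baseExpr)

/-- Add row `n - 2 - row` to row `n - 1 - row`. -/
def addRow : Stmt Arr := .put .carry 0 0 ;; .loop .place 1 .len addDigit

/-- Turn rows that hold `R` into rows that hold `pascalStep R`. -/
def pascalRow : Stmt Arr := .loop .row 1 (.len - 1) addRow

/-- Set row `row` to zero. -/
def clearRow : Stmt Arr := .loop .place 1 .len (putRowDigit Arr.row 0)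

/-- Set the first `e` rows to zero. -/
def clearRows (e : Ex Arr) : Stmt Arr := .loop .row 1 e clearRow

/-- Compute in the last row the tail of the entry of cost `cost` with `kept` edges: rows holding
`Nat.choose 0` become rows holding `Nat.choose cost`, of which the part below `kept` is cut off. -/
def computeTail : Stmt Arr :=
  clearRows .len ;; .put .digits (.pair 0 0) 1 ;; .loop .round 2 Arr.cost pascalRow ;;
    clearRows Arr.kept ;; .loop .round 2 (.len * (.len - 1) / 2 - Arr.cost) pascalRow

section Digits
variable {n : ℕ} {σ : Store Arr}

/-- The digits of row `j`. -/
def digitsOf (σ : Store Arr) (j d : ℕ) : ℕ := σ .digits (sqPair j d)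

/-- Row `j` represents `R j`, for each of the `n` rows. -/
def RowsAre (n : ℕ) (σ : Store Arr) (R : ℕ → ℕ) : Prop :=
  ∀ j < n, Represents n (digitsOf σ j) (R j)

lemma clamp_of_le_base {w : ℕ} (hw : w ≤ base n) : clamp n w = w :=
  clamp_of_lt_pow (d := 2) (by omega) (by rw [base] at hw; nlinarith)

lemma addDigit_run {i m s : ℕ} (hrow : σ .row 0 = i) (hplace : σ .place 0 = m)
    (hs : digitsOf σ (n - 1 - i) m + digitsOf σ (n - 2 - i) m + σ .carry 0 = s)
    (hsb : s < 2 * base n) : addDigit.run n σ = ((σ.set .total 0 s).set .digits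
      (sqPair (n - 1 - i) m) (s % base n)).set .carry 0 (s / base n) := by
  have hbase : 0 < base n := Nat.succ_pos _
  have hclamp : clamp n s = s :=
    clamp_of_lt_pow (d := 3) (by omega) (by rw [base] at hsb; nlinarith [sq_nonneg (n : ℤ)])
  have hclamp_mod : clamp n (s % base n) = s % base n :=
    clamp_of_le_base (Nat.mod_lt s hbase).le
  have hclamp_div : clamp n (s / base n) = s / base n :=
    clamp_of_le_base (by rw [Nat.div_le_iff_le_mul_add_pred hbase]; nlinarith)
  unfold digitsOf at hs
  simp [addDigit, rowDigit, putRowDigit, baseExpr, hrow, hplace, hs, hclamp, hclamp_mod,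
    hclamp_div, ← base.eq_def]

/-- In `τ`, the last `m` digits of row `j'` of `σ` have been added to those of row `j`. -/
structure PartialSum (n : ℕ) (σ τ : Store Arr) (j j' m : ℕ) : Prop where
  other : ∀ l ≠ j, digitsOf τ l = digitsOf σ l
  high : ∀ d ≥ m, digitsOf τ j d = digitsOf σ j d
  lt_base : ∀ d < m, digitsOf τ j d < base n
  carry_le : τ .carry 0 ≤ 1
  add_eq : numeral (base n) m (digitsOf τ j) + τ .carry 0 * base n ^ m =
    numeral (base n) m (digitsOf σ j) + numeral (base n) m (digitsOf σ j')

lemma PartialSum.succ {τ ρ : Store Arr} {j j' m s : ℕ} (h : PartialSum n σ τ j j' m)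
    (hs : digitsOf σ j m + digitsOf σ j' m + τ .carry 0 = s) (hsb : s < 2 * base n)
    (hdigits : ρ .digits = (τ.set .digits (sqPair j m) (s % base n)) .digits)
    (hcarry : ρ .carry 0 = s / base n) : PartialSum n σ ρ j j' (m + 1) := by
  have hbase : 0 < base n := Nat.succ_pos _
  have hρ (l d : ℕ) :
      digitsOf ρ l d = if l = j ∧ d = m then s % base n else digitsOf τ l d := by
    simp [digitsOf, hdigits]
  constructor
  · intro l hl
    funext d
    rw [hρ, if_neg (by simp [hl]), h.other l hl]
  · intro d hd
    rw [hρ, if_neg (by omega), h.high d (by omega)]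
  · intro d hd
    rw [hρ]
    split_ifs
    exacts [Nat.mod_lt s hbase, h.lt_base d (by omega)]
  · rw [hcarry, Nat.div_le_iff_le_mul_add_pred hbase]
    omega
  · have hlow : numeral (base n) m (digitsOf ρ j) = numeral (base n) m (digitsOf τ j) :=
      numeral_congr fun d hd => by rw [hρ, if_neg (by omega)]
    have hdiv : s % base n * base n ^ m + s / base n * base n ^ (m + 1) =
        (digitsOf σ j m + digitsOf σ j' m + τ .carry 0) * base n ^ m := by
      rw [pow_succ', ← mul_assoc, ← add_mul, mul_comm (s / base n), Nat.mod_add_div, hs]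
    rw [numeral_succ, numeral_succ, numeral_succ, hlow, hρ, if_pos ⟨rfl, rfl⟩, hcarry]
    linarith [h.add_eq]

lemma PartialSum.represents {τ : Store Arr} {j j' x y : ℕ} (h : PartialSum n σ τ j j' n)
    (hx : Represents n (digitsOf σ j) x) (hy : Represents n (digitsOf σ j') y)
    (hxy : x + y < base n ^ n) : Represents n (digitsOf τ j) (x + y) := by
  have hadd := h.add_eq
  rw [hx.numeral_eq, hy.numeral_eq] at hadd
  have hcarry : τ .carry 0 = 0 := by
    by_contra hpos
    have := Nat.mul_le_mul_right (base n ^ n) (Nat.pos_of_ne_zero hpos)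
    omega
  exact ⟨h.lt_base, by rwa [hcarry, zero_mul, add_zero] at hadd⟩

lemma addRow_spec {i x y : ℕ} (hi : i < n - 1) (hrow : σ .row 0 = i)
    (hx : Represents n (digitsOf σ (n - 1 - i)) x) (hy : Represents n (digitsOf σ (n - 2 - i)) y)
    (hxy : x + y < base n ^ n) :
    (∀ j ≠ n - 1 - i, digitsOf (addRow.run n σ) j = digitsOf σ j) ∧
      Represents n (digitsOf (addRow.run n σ) (n - 1 - i)) (x + y) := by
  suffices hsum : PartialSum n σ (addRow.run n σ) (n - 1 - i) (n - 2 - i) n from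
    ⟨hsum.other, hsum.represents hx hy hxy⟩
  refine Stmt.loop_inv (σ := (Stmt.put Arr.carry 0 0).run n σ) n (by omega) rfl (by simp)
    (fun m (τ : Store Arr) => PartialSum n σ τ (n - 1 - i) (n - 2 - i) m) ?_
    fun m τ hm hτ h => ?_
  · refine ⟨fun _ _ => rfl, fun _ _ => rfl, fun d hd => absurd hd d.not_lt_zero, ?_, ?_⟩ <;>
      simp [numeral, clamp_of_le_self]
  · obtain ⟨s, hs⟩ : ∃ s, digitsOf σ (n - 1 - i) m + digitsOf σ (n - 2 - i) m + τ .carry 0 = s :=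
      ⟨_, rfl⟩
    have hsb : s < 2 * base n := by
      have := hx.lt_base m hm
      have := hy.lt_base m hm
      have := h.carry_le
      omega
    have hs' : digitsOf (τ.set .place 0 m) (n - 1 - i) m +
        digitsOf (τ.set .place 0 m) (n - 2 - i) m + τ .carry 0 = s := by
      rw [← hs, ← h.high m le_rfl, ← h.other (n - 2 - i) (by omega)]
      rfl
    have hrow' : (τ.set .place 0 m) .row 0 = i := by
      rw [set_of_ne (by decide), hτ .row rfl]
      exact hrow
    rw [addDigit_run hrow' (by simp) hs' hsb]
    exact h.succ hs hsb rfl rfl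

lemma pascalRow_spec {R : ℕ → ℕ} (hR : RowsAre n σ R)
    (hlt : ∀ j < n, pascalStep R j < base n ^ n) :
    RowsAre n (pascalRow.run n σ) (pascalStep R) := by
  suffices hrows : (∀ j < n, n - 1 - (n - 1) < j →
      Represents n (digitsOf (pascalRow.run n σ) j) (pascalStep R j)) ∧
      ∀ j < n, j ≤ n - 1 - (n - 1) → Represents n (digitsOf (pascalRow.run n σ) j) (R j) by
    intro j hj
    rcases j with _ | j
    exacts [hrows.2 0 hj (Nat.zero_le _), hrows.1 (j + 1) hj (by omega)]
  refine Stmt.loop_inv (n - 1) (by omega) rfl (by simp) (fun i (τ : Store Arr) =>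
    (∀ j < n, n - 1 - i < j → Represents n (digitsOf τ j) (pascalStep R j)) ∧
      ∀ j < n, j ≤ n - 1 - i → Represents n (digitsOf τ j) (R j))
    ⟨fun j hj hj' => by omega, fun j hj _ => hR j hj⟩ fun i τ hi _ ⟨hnew, hold⟩ => ?_
  have hstep : R (n - 1 - i) + R (n - 2 - i) = pascalStep R (n - 1 - i) := by
    obtain ⟨j, hj⟩ : ∃ j, n - 1 - i = j + 1 := ⟨n - 2 - i, by omega⟩
    rw [hj, show n - 2 - i = j by omega]
    rfl
  obtain ⟨hother, hsum⟩ := addRow_spec (σ := τ.set .row 0 i) hi (by simp)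
    (hold _ (by omega) le_rfl) (hold _ (by omega) (by omega)) (hstep ▸ hlt _ (by omega))
  constructor <;> intro j hj hj'
  · by_cases hji : j = n - 1 - i
    · rwa [hji, ← hstep]
    · rw [hother j hji]
      exact hnew j hj (by omega)
  · rw [hother j (by omega)]
    exact hold j hj (by omega)

lemma pascalRows_spec {R : ℕ → ℕ} {e : Ex Arr} {x : ℕ} (hR : RowsAre n σ R)
    (he : e.eval n σ = x) (hx : x ≤ n ^ 2)
    (hlt : ∀ i ≤ x, ∀ j < n, pascalStep^[i] R j < base n ^ n) :
    RowsAre n ((Stmt.loop .round 2 e pascalRow).run n σ) (pascalStep^[x] R) := by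
  refine Stmt.loop_inv x (by omega) he hx
    (fun i (τ : Store Arr) => RowsAre n τ (pascalStep^[i] R)) hR fun i τ hi _ hτ => ?_
  have hiter := Function.iterate_succ_apply' pascalStep i R
  rw [hiter]
  exact pascalRow_spec (σ := τ.set .round 0 i) hτ fun j hj => hiter ▸ hlt (i + 1) hi j hj

lemma clearRow_spec {i : ℕ} (hrow : σ .row 0 = i) :
    (∀ d < n, digitsOf (clearRow.run n σ) i d = 0) ∧
      ∀ j ≠ i, digitsOf (clearRow.run n σ) j = digitsOf σ j := by
  refine Stmt.loop_inv n (by omega) rfl (by simp) (fun m (τ : Store Arr) =>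
    (∀ d < m, digitsOf τ i d = 0) ∧ ∀ j ≠ i, digitsOf τ j = digitsOf σ j)
    ⟨fun d hd => absurd hd d.not_lt_zero, fun _ _ => rfl⟩ fun m τ _ hτ ⟨hzero, hold⟩ => ?_
  have hdigits (j d : ℕ) : digitsOf ((putRowDigit Arr.row 0).run n (τ.set .place 0 m)) j d =
      if j = i ∧ d = m then 0 else digitsOf τ j d := by
    simp [digitsOf, putRowDigit, hτ .row rfl, hrow, clamp_of_le_self]
  refine ⟨fun d hd => ?_, fun j hj => ?_⟩
  · rw [hdigits]
    split_ifs with hdm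
    exacts [rfl, hzero d (by omega)]
  · funext d
    rw [hdigits, if_neg (by simp [hj]), hold j hj]

lemma clearRows_digits {e : Ex Arr} {x : ℕ} (he : e.eval n σ = x) (hx : x ≤ n) :
    (∀ j < x, ∀ d < n, digitsOf ((clearRows e).run n σ) j d = 0) ∧
      ∀ j ≥ x, digitsOf ((clearRows e).run n σ) j = digitsOf σ j := by
  refine Stmt.loop_inv x (by omega) he (by simpa) (fun i (τ : Store Arr) =>
    (∀ j < i, ∀ d < n, digitsOf τ j d = 0) ∧ ∀ j ≥ i, digitsOf τ j = digitsOf σ j)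
    ⟨fun j hj => absurd hj j.not_lt_zero, fun _ _ => rfl⟩ fun i τ _ _ ⟨hzero, hold⟩ => ?_
  obtain ⟨hnew, hother⟩ := clearRow_spec (n := n) (σ := τ.set .row 0 i) (i := i) (by simp)
  refine ⟨fun j hj d hd => ?_, fun j hj => ?_⟩
  · by_cases hji : j = i
    · exact hji ▸ hnew d hd
    · rw [hother j hji]
      exact hzero j (by omega) d hd
  · rw [hother j (by omega)]
    exact hold j (by omega)

lemma clearRows_spec {R : ℕ → ℕ} {e : Ex Arr} {x : ℕ} (he : e.eval n σ = x) (hx : x ≤ n)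
    (hR : RowsAre n σ R) :
    RowsAre n ((clearRows e).run n σ) fun j => if j < x then 0 else R j := by
  obtain ⟨hzero, hold⟩ := clearRows_digits he hx
  intro j hj
  by_cases hjx : j < x
  · simp only [if_pos hjx]
    refine (represents_single (Nat.succ_pos _) (by omega)).congr fun d hd => ?_
    rw [hzero j hjx d hd, ite_self]
  · simp only [if_neg hjx]
    rw [hold j (not_lt.1 hjx)]
    exact hR j hj

lemma chooseRows_spec :
    RowsAre n ((clearRows .len ;; .put .digits (.pair 0 0) 1).run n σ) (Nat.choose 0) := by
  have hzero := (clearRows_digits (σ := σ) (e := .len) rfl (le_refl n)).1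
  intro j hj
  have hx : Nat.choose 0 j < base n := by
    refine Nat.lt_succ_of_le ((Nat.choose_le_pow 0 j).trans ?_)
    exact (pow_le_one₀ le_rfl zero_le_one).trans (Nat.mul_pos (by omega) (by omega))
  refine (represents_single hx (by omega)).congr fun d hd => ?_
  have hd0 := hzero j hj d hd
  unfold digitsOf at hd0
  rcases j with _ | j <;> simp [digitsOf, hd0, clamp_of_le_self (show 1 ≤ n by omega)]

lemma computeTail_spec {ip k : ℕ} (hcost : σ .cost 0 = ip) (hip : ip ≤ n.choose 2)
    (hkept : σ .kept 0 = k) (hk : k < n) :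
    Represents n (digitsOf (computeTail.run n σ) (n - 1))
      (tailNum (n.choose 2) (n - 1) ip k) := by
  have hp : n.choose 2 ≤ n ^ 2 := Nat.choose_le_pow n 2
  let σ₁ := (clearRows .len ;; .put .digits (.pair 0 0) 1).run n σ
  let σ₂ := (Stmt.loop .round 2 Arr.cost pascalRow).run n σ₁
  let σ₃ := (clearRows Arr.kept).run n σ₂
  have hrows₁ : RowsAre n σ₁ (Nat.choose 0) := chooseRows_spec
  have hrows₂ : RowsAre n σ₂ ip.choose := by
    have hiter (i : ℕ) : pascalStep^[i] (Nat.choose 0) = i.choose := by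
      rw [pascalStep_iterate_choose, zero_add]
    rw [← hiter]
    refine pascalRows_spec hrows₁ ?_ (hip.trans hp) fun i hi j hj => ?_
    · exact (congrFun (Stmt.run_of_not_writes rfl) 0).trans hcost
    · rw [hiter]
      exact choose_lt_base_pow (by omega) hj
  have hrows₃ : RowsAre n σ₃ (cutRow ip k) :=
    clearRows_spec ((congrFun ((Stmt.run_of_not_writes rfl).trans
      (Stmt.run_of_not_writes rfl)) 0).trans hkept) hk.le hrows₂
  rw [tailNum_eq_pascalStep]
  refine pascalRows_spec hrows₃ ?_ (by omega) (fun i hi j hj => ?_) (n - 1) (by omega)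
  · have hcost₃ : σ₃ .cost 0 = ip :=
      (congrFun ((Stmt.run_of_not_writes rfl).trans ((Stmt.run_of_not_writes rfl).trans
        (Stmt.run_of_not_writes rfl))) 0).trans hcost
    simp [σ₃, hcost₃, Nat.choose_two_right]
  · calc pascalStep^[i] (cutRow ip k) j ≤ pascalStep^[i] ip.choose j :=
          pascalStep_mono.iterate i (cutRow_le ip k) j
      _ = (ip + i).choose j := by rw [pascalStep_iterate_choose]
      _ < base n ^ n := choose_lt_base_pow (by omega) hj

end Digits

/-! ### The best number of kept edges -/

/-- The cost of the root entry of size `a` with `kept` kept edges. -/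
def rootCost (a : Ex Arr) : Ex Arr := entryCostExpr (.get .table 0) a Arr.kept

/-- Find the size that minimizes the cost of the root entry with `kept` kept edges. -/
def findSize : Stmt Arr :=
  .put .minSize 0 1 ;;
    .loop .size 1 .len
      (.ite (rootCost (Arr.size + 1)) (rootCost Arr.minSize) (.put .minSize 0 (Arr.size + 1)) .skip)

/-- Compute in the last row the tail that results from keeping `kept` edges at the least cost. -/
def evaluateKept : Stmt Arr :=
  findSize ;; .put .cost 0 (rootCost Arr.minSize) ;; computeTail

/-- Store in `less` whether the last row is less than `best`. -/
def compareBest : Stmt Arr :=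
  let x : Ex Arr := rowDigit (.len - 1)
  let y : Ex Arr := .get .best Arr.place
  .put .less 0 0 ;; .loop .place 1 .len
    (.ite x y (.put .less 0 1) (.ite y x (.put .less 0 0) .skip))

/-- Copy the last row to `best`. -/
def copyRow : Stmt Arr := .loop .place 1 .len (.put .best Arr.place (rowDigit (.len - 1)))

/-- Make the last row and its root entry the best one. -/
def updateBest : Stmt Arr :=
  .put .bestKept 0 Arr.kept ;; .put .bestSize 0 Arr.minSize ;; copyRow

/-- Compare the best number of kept edges with all others. -/
def improveBest : Stmt Arr :=
  .loop .kept 1 .len (evaluateKept ;; compareBest ;; .ite 0 Arr.less updateBest .skip)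

/-- Find the number of kept edges with the least tail. -/
def chooseBest : Stmt Arr := .put .kept 0 0 ;; evaluateKept ;; updateBest ;; improveBest

section Choose
variable {n : ℕ} {σ : Store Arr}

/-- The tail that results from keeping `k` edges at the least cost. -/
noncomputable def leastTail (n : ℕ) (σ : Store Arr) (k : ℕ) : ℕ :=
  tailNum (n.choose 2) (n - 1) (leastCost n σ (σ .table 0) k) k

lemma entryCost_congr {τ : Store Arr} (h : τ .gain = σ .gain) :
    entryCost n τ = entryCost n σ := by
  funext i e
  rw [entryCost, entryCost, h]

lemma leastCost_congr {τ : Store Arr} (h : τ .gain = σ .gain) :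
    leastCost n τ = leastCost n σ := by
  funext i k
  simp only [leastCost, entryCost_congr h]

lemma leastTail_congr {τ : Store Arr} (hgain : τ .gain = σ .gain) (htable : τ .table = σ .table) :
    leastTail n τ = leastTail n σ := by
  funext k
  rw [leastTail, leastTail, leastCost_congr hgain, htable]

lemma findSize_spec [NeZero n] {k : ℕ} (hkept : σ .kept 0 = k) :
    ∃ A < n, findSize.run n σ .minSize 0 = A + 1 ∧
      entryCost n σ (σ .table 0) (A + 1, k) = leastCost n σ (σ .table 0) k := by
  set E : ℕ → ℕ := fun a => entryCost n σ (σ .table 0) (a, k)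
  suffices hmin : ∃ A < n, findSize.run n σ .minSize 0 = A + 1 ∧ ∀ B < n, E (A + 1) ≤ E (B + 1) by
    obtain ⟨A, hA, hmin, hle⟩ := hmin
    exact ⟨A, hA, hmin, le_antisymm (le_ciInf fun B => hle B B.isLt) (leastCost_le hA)⟩
  refine Stmt.loop_inv (σ := (Stmt.put Arr.minSize 0 1).run n σ) (x := .size) (k := 1)
    (e := .len) n (by omega) rfl (by simp) (fun i (τ : Store Arr) =>
      ∃ A < n, τ .minSize 0 = A + 1 ∧ ∀ B < i, E (A + 1) ≤ E (B + 1))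
    ⟨0, NeZero.pos n, by simp [clamp_of_le_self NeZero.one_le], by simp⟩ ?_
  rintro i τ hi hτ ⟨A, hA, hmin, hle⟩
  have hcost (a : Ex Arr) : (rootCost a).eval n (τ.set .size 0 i) =
      E (a.eval n (τ.set .size 0 i)) := by
    simp [rootCost, entryCost, E, hτ .table rfl, hτ .kept rfl, hτ .gain rfl, hkept]
  simp only [run_ite, hcost]
  have hsize : (Arr.size + 1 : Ex Arr).eval n (τ.set .size 0 i) = i + 1 := by simp
  have hold : (Arr.minSize : Ex Arr).eval n (τ.set .size 0 i) = A + 1 := by simp [hmin]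
  rw [hsize, hold]
  split_ifs with hlt
  · refine ⟨i, hi, by simp [clamp_of_le_self (Nat.succ_le_of_lt hi)], fun B hB => ?_⟩
    rcases Nat.lt_succ_iff_lt_or_eq.1 hB with hBi | rfl
    exacts [hlt.le.trans (hle B hBi), le_rfl]
  · refine ⟨A, hA, by simp [hmin], fun B hB => ?_⟩
    rcases Nat.lt_succ_iff_lt_or_eq.1 hB with hBi | rfl
    exacts [hle B hBi, not_lt.1 hlt]

/-- The last row and `minSize` hold the evaluation of keeping `k` edges. -/
structure Evaluated (n : ℕ) (σ τ : Store Arr) (k : ℕ) : Prop where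
  kept_eq : τ .kept 0 = k
  minSize_le : τ .minSize 0 ≤ n
  cost_eq : entryCost n σ (σ .table 0) (τ .minSize 0, k) = leastCost n σ (σ .table 0) k
  represents : Represents n (digitsOf τ (n - 1)) (leastTail n σ k)

lemma evaluateKept_spec [NeZero n] {k : ℕ} (hkept : σ .kept 0 = k) (hk : k < n)
    (hle : leastCost n σ (σ .table 0) k ≤ n.choose 2) :
    Evaluated n σ (evaluateKept.run n σ) k := by
  obtain ⟨A, hA, hmin, hleast⟩ := findSize_spec (n := n) hkept
  have hkept' : findSize.run n σ .kept 0 = k :=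
    (congrFun (Stmt.run_of_not_writes rfl) 0).trans hkept
  let ρ := (Stmt.put .cost 0 (rootCost Arr.minSize)).run n (findSize.run n σ)
  have hminSize : evaluateKept.run n σ .minSize 0 = A + 1 :=
    (congrFun (Stmt.run_of_not_writes (P := computeTail) (σ := ρ) rfl) 0).trans hmin
  refine ⟨(congrFun (Stmt.run_of_not_writes rfl) 0).trans hkept, hminSize ▸ hA,
    hminSize ▸ hleast, computeTail_spec (σ := ρ) ?_ hle hkept' hk⟩
  have hcost : (rootCost Arr.minSize).eval n (findSize.run n σ) =
      leastCost n σ (σ .table 0) k := by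
    have hgain : findSize.run n σ .gain = σ .gain := Stmt.run_of_not_writes rfl
    have htable : findSize.run n σ .table = σ .table := Stmt.run_of_not_writes rfl
    rw [← hleast, rootCost]
    simp [entryCost, hgain, htable, hmin, hkept']
  simp only [ρ, run_put, set_apply, eval_zero, and_self, if_true, hcost]
  exact clamp_of_lt_pow (d := 2) (by omega) (by have := Nat.choose_le_pow n 2; nlinarith)

lemma compareBest_spec {x y : ℕ} (hx : Represents n (digitsOf σ (n - 1)) x)
    (hy : Represents n (σ .best) y) : compareBest.run n σ .less 0 = if x < y then 1 else 0 := by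
  rw [← hx.numeral_eq, ← hy.numeral_eq]
  refine Stmt.loop_inv (σ := (Stmt.put Arr.less 0 0).run n σ) (x := .place) (k := 1)
    (e := .len) n (by omega) rfl (by simp) (fun m (τ : Store Arr) => τ .less 0 =
      if numeral (base n) m (digitsOf σ (n - 1)) < numeral (base n) m (σ .best) then 1 else 0)
    (by simp [numeral, clamp_of_le_self]) fun m τ hm hτ hless => ?_
  have hdigits : τ .digits = σ .digits := hτ .digits rfl
  have hbest : τ .best = σ .best := hτ .best rfl
  have hxm : τ .digits (sqPair (n - 1) m) = digitsOf σ (n - 1) m := by rw [hdigits, digitsOf]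
  have hzero : clamp n 0 = 0 := clamp_of_le_self n.zero_le
  have hone : clamp n 1 = 1 := clamp_of_le_self (by omega)
  have hlow {g : ℕ → ℕ} {y : ℕ} (h : Represents n g y) : ∀ d < m, g d < base n :=
    fun d hd => h.lt_base d (hd.trans hm)
  rcases lt_trichotomy (digitsOf σ (n - 1) m) (σ .best m) with hlt | heq | hgt
  · rw [if_pos (numeral_succ_lt_of_lt (hlow hx) hlt)]
    simp [rowDigit, hxm, hbest, hlt, hone]
  · rw [numeral_succ, numeral_succ, heq]
    simp [rowDigit, hxm, hbest, heq, hless]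
  · rw [if_neg (numeral_succ_lt_of_lt (hlow hy) hgt).not_gt]
    simp [rowDigit, hxm, hbest, hgt, hgt.not_gt, hzero]

lemma copyRow_spec {x : ℕ} (hx : Represents n (digitsOf σ (n - 1)) x) :
    Represents n (copyRow.run n σ .best) x := by
  refine hx.congr (Stmt.loop_inv n (by omega) rfl (by simp)
    (fun m (τ : Store Arr) => ∀ d < m, τ .best d = digitsOf σ (n - 1) d)
    (fun d hd => absurd hd d.not_lt_zero) fun m τ hm hτ hbest d hd => ?_)
  have hdigits : τ .digits = σ .digits := hτ .digits rfl
  have hclamp := clamp_of_le_base (hx.lt_base m hm).le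
  unfold digitsOf at hclamp hbest
  by_cases hdm : d = m
  · simp [rowDigit, hdm, hdigits, digitsOf, hclamp]
  · simp [rowDigit, hdm, hbest d (by omega), digitsOf]

/-- Keeping `bestKept` edges has the least tail among the numbers of kept edges below `m`, and
`bestSize` is the size of a root entry that attains it. -/
structure BestBelow (n : ℕ) (σ τ : Store Arr) (m : ℕ) : Prop where
  bestKept_lt : τ .bestKept 0 < n
  bestSize_le : τ .bestSize 0 ≤ n
  cost_eq : entryCost n σ (σ .table 0) (τ .bestSize 0, τ .bestKept 0) =
    leastCost n σ (σ .table 0) (τ .bestKept 0)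
  represents : Represents n (τ .best) (leastTail n σ (τ .bestKept 0))
  leastTail_le : ∀ k < m, leastTail n σ (τ .bestKept 0) ≤ leastTail n σ k

lemma Evaluated.congr {τ ρ : Store Arr} {k : ℕ} (h : Evaluated n σ τ k)
    (hkept : ρ .kept = τ .kept) (hsize : ρ .minSize = τ .minSize)
    (hdigits : ρ .digits = τ .digits) : Evaluated n σ ρ k where
  kept_eq := hkept ▸ h.kept_eq
  minSize_le := hsize ▸ h.minSize_le
  cost_eq := hsize ▸ h.cost_eq
  represents := h.represents.congr fun _ _ => congrFun hdigits _

lemma Evaluated.of_tables_eq {τ ρ : Store Arr} {k : ℕ} (h : Evaluated n τ ρ k)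
    (hgain : τ .gain = σ .gain) (htable : τ .table = σ .table) : Evaluated n σ ρ k where
  kept_eq := h.kept_eq
  minSize_le := h.minSize_le
  cost_eq := by
    rw [← htable, ← entryCost_congr hgain, ← leastCost_congr hgain]
    exact h.cost_eq
  represents := leastTail_congr hgain htable ▸ h.represents

lemma Evaluated.bestBelow {τ : Store Arr} {k m : ℕ} (h : Evaluated n σ τ k) (hk : k < n)
    (hle : ∀ j < m, leastTail n σ k ≤ leastTail n σ j) :
    BestBelow n σ (updateBest.run n τ) m := by
  have hkept : updateBest.run n τ .bestKept 0 = k := by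
    rw [← clamp_of_le_self hk.le, ← h.kept_eq]
    exact congrFun (Stmt.run_of_not_writes (P := copyRow) rfl) 0
  have hsize : updateBest.run n τ .bestSize 0 = τ .minSize 0 := by
    rw [← clamp_of_le_self h.minSize_le]
    exact congrFun (Stmt.run_of_not_writes (P := copyRow) rfl) 0
  constructor
  · exact hkept.trans_lt hk
  · exact hsize.trans_le h.minSize_le
  · rw [hsize, hkept]
    exact h.cost_eq
  · rw [hkept]
    exact copyRow_spec h.represents
  · rwa [hkept]

lemma BestBelow.congr {τ ρ : Store Arr} {m : ℕ} (h : BestBelow n σ τ m)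
    (hkept : ρ .bestKept = τ .bestKept) (hsize : ρ .bestSize = τ .bestSize)
    (hbest : ρ .best = τ .best) : BestBelow n σ ρ m := by
  constructor <;> simp only [hkept, hsize, hbest]
  exacts [h.bestKept_lt, h.bestSize_le, h.cost_eq, h.represents, h.leastTail_le]

lemma BestBelow.succ {τ : Store Arr} {m : ℕ} (h : BestBelow n σ τ m) (hm : m < n)
    (hτ : Evaluated n σ τ m) :
    BestBelow n σ ((compareBest ;; .ite 0 Arr.less updateBest .skip).run n τ) (m + 1) := by
  set ρ := compareBest.run n τ
  have hless : ρ .less 0 =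
      if leastTail n σ m < leastTail n σ (τ .bestKept 0) then 1 else 0 :=
    compareBest_spec hτ.represents h.represents
  have hρ : Evaluated n σ ρ m := hτ.congr (Stmt.run_of_not_writes rfl)
    (Stmt.run_of_not_writes rfl) (Stmt.run_of_not_writes rfl)
  have hold : BestBelow n σ ρ m := h.congr (Stmt.run_of_not_writes rfl)
    (Stmt.run_of_not_writes rfl) (Stmt.run_of_not_writes rfl)
  have hle {k : ℕ} (hm : leastTail n σ k ≤ leastTail n σ m)
      (hlt : ∀ j < m, leastTail n σ k ≤ leastTail n σ j) :
      ∀ j < m + 1, leastTail n σ k ≤ leastTail n σ j :=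
    fun j hj => (Nat.lt_succ_iff_lt_or_eq.1 hj).elim (hlt j) fun hjm => hjm ▸ hm
  change BestBelow n σ (if 0 < ρ .less 0 then updateBest.run n ρ else ρ) (m + 1)
  rw [hless]
  split_ifs with hlt hpos hpos
  · exact hρ.bestBelow hm (hle le_rfl fun j hj => hlt.le.trans (h.leastTail_le j hj))
  · exact absurd zero_lt_one hpos
  · exact absurd hpos (lt_irrefl 0)
  · have hkept : ρ .bestKept = τ .bestKept := Stmt.run_of_not_writes rfl
    refine { hold with leastTail_le := hle ?_ hold.leastTail_le }
    rw [hkept]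
    exact not_lt.1 hlt

lemma improveBest_spec [NeZero n] {τ : Store Arr} (hgain : τ .gain = σ .gain)
    (htable : τ .table = σ .table) (hle : ∀ k < n, leastCost n σ (σ .table 0) k ≤ n.choose 2)
    (h : BestBelow n σ τ 0) : BestBelow n σ (improveBest.run n τ) n := by
  refine Stmt.loop_inv n (by omega) rfl (by simp) (fun k (ρ : Store Arr) => BestBelow n σ ρ k) h
    fun k ρ hk hρ hbest => ?_
  have hgain' : ρ .gain = σ .gain := (hρ .gain rfl).trans hgain
  have htable' : ρ .table = σ .table := (hρ .table rfl).trans htable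
  have hevaluated : Evaluated n (ρ.set .kept 0 k) (evaluateKept.run n (ρ.set .kept 0 k)) k := by
    refine evaluateKept_spec (by simp) hk ?_
    rw [leastCost_congr (σ := σ) (τ := ρ.set .kept 0 k) hgain', set_of_ne (by decide), htable']
    exact hle k hk
  have hframe {b : Arr} (hb : evaluateKept.writes b = false) (hne : b ≠ .kept) :
      evaluateKept.run n (ρ.set .kept 0 k) b = ρ b := by
    rw [Stmt.run_of_not_writes hb, set_of_ne hne]
  exact (hbest.congr (hframe rfl (by decide)) (hframe rfl (by decide))
    (hframe rfl (by decide))).succ hk (hevaluated.of_tables_eq hgain' htable')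

lemma chooseBest_spec [NeZero n] (hle : ∀ k < n, leastCost n σ (σ .table 0) k ≤ n.choose 2) :
    BestBelow n σ (chooseBest.run n σ) n := by
  let τ := (Stmt.put Arr.kept 0 0).run n σ
  have hkept : τ .kept 0 = 0 := clamp_of_le_self n.zero_le
  have hgain : τ .gain = σ .gain := Stmt.run_of_not_writes rfl
  have htable : τ .table = σ .table := Stmt.run_of_not_writes rfl
  have hleast : leastCost n τ (τ .table 0) 0 ≤ n.choose 2 := by
    rw [leastCost_congr hgain, htable]
    exact hle 0 (NeZero.pos n)
  have hevaluated : Evaluated n σ (evaluateKept.run n τ) 0 :=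
    (evaluateKept_spec hkept (NeZero.pos n) hleast).of_tables_eq hgain htable
  have hframe {b : Arr} (hupdate : updateBest.writes b = false)
      (hevaluate : evaluateKept.writes b = false) :
      updateBest.run n (evaluateKept.run n τ) b = τ b := by
    rw [Stmt.run_of_not_writes hupdate, Stmt.run_of_not_writes hevaluate]
  exact improveBest_spec ((hframe rfl rfl).trans hgain) ((hframe rfl rfl).trans htable) hle
    (hevaluated.bestBelow (NeZero.pos n) fun j hj => absurd hj j.not_lt_zero)

end Choose

/-! ### Tracing the clustering back -/

/-- Step back through the elimination order: label the child of the current edge and pass the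
entry that is wanted for its parent on to the two parts that the entry was joined from. -/
def traceStep : Stmt Arr :=
  let t : Ex Arr := .len - 2 - Arr.step
  let p : Ex Arr := .get .par t
  let c : Ex Arr := .get .child t
  let x : Ex Arr := .pair (.len + t) (.get .want p)
  let q : Ex Arr := .get .origin x
  .ite 0 (.get .keep x) (.put .io c (.get .io p)) (.put .io c c) ;;
  .put .want c (.pair (digitExpr q 1) (digitExpr q 0)) ;;
  .put .want p (.pair (digitExpr q 3) (digitExpr q 2))

/-- Label the vertices by a clustering that realizes the chosen entry of the root's table. -/
def traceBack : Stmt Arr :=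
  .put .want 0 (.pair Arr.bestSize Arr.bestKept) ;; .put .io 0 0 ;;
  .loop .step 1 (.len - 1) traceStep

section Trace
variable {n : ℕ} {σ : Store Arr}

/-- The entry of the table of `v` after `t` steps that is to be realized, if entry `r` is to be
realized at the root after all steps. -/
def wanted (O : EliminationOrder n) (σ : Store Arr) (r : ℕ × ℕ) (t v : ℕ) : ℕ × ℕ :=
  if t < n - 1 then
    let q := σ .origin (cell (n + t) (wanted O σ r (t + 1) (O.par t)))
    if v = O.child t then lower n q
    else if v = O.par t then upper n q
    else wanted O σ r (t + 1) v
  else r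
termination_by n - 1 - t

/-- Whether realizing entry `r` at the root keeps the edge of step `t`. -/
def tracedKeep (O : EliminationOrder n) (σ : Store Arr) (r : ℕ × ℕ) (t : ℕ) : Bool :=
  0 < σ .keep (cell (n + t) (wanted O σ r (t + 1) (O.par t)))

variable {O : EliminationOrder n} {r : ℕ × ℕ}

lemma wanted_child {t : ℕ} (ht : t < n - 1) : wanted O σ r t (O.child t) =
    lower n (σ .origin (cell (n + t) (wanted O σ r (t + 1) (O.par t)))) := by
  rw [wanted, if_pos ht, if_pos rfl]

lemma wanted_par {t : ℕ} (ht : t < n - 1) : wanted O σ r t (O.par t) =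
    upper n (σ .origin (cell (n + t) (wanted O σ r (t + 1) (O.par t)))) := by
  rw [wanted, if_pos ht, if_neg (O.par_ne_child ht), if_pos rfl]

lemma wanted_of_ne {t v : ℕ} (ht : t < n - 1) (hchild : v ≠ O.child t) (hpar : v ≠ O.par t) :
    wanted O σ r t v = wanted O σ r (t + 1) v := by
  rw [wanted, if_pos ht, if_neg hchild, if_neg hpar]

lemma Filled.entryCost_wanted_lt (h : Filled O σ (n - 1))
    (hr : entryCost n σ (tableAt O (n - 1) 0) r < n * n) {t v : ℕ} (ht : t ≤ n - 1) (hv : v < n)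
    (hlive : Live O.child t v) : entryCost n σ (tableAt O t v) (wanted O σ r t v) < n * n := by
  induction ht using Nat.decreasingInduction generalizing v with
  | self =>
    rwa [wanted, if_neg (lt_irrefl _), O.eq_zero_of_live hv hlive]
  | of_succ t ht ih =>
    have hjoined := ih (O.par_lt ht) (O.par_live ht)
    rw [tableAt, if_pos rfl] at hjoined
    have hcost := (h.combined t ht).eq_joinCost _ hjoined
    rw [joinCost, ← wanted_par ht, ← wanted_child ht] at hcost
    by_cases hchild : v = O.child t
    · subst hchild
      omega
    · by_cases hpar : v = O.par t
      · subst hpar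
        omega
      · have hnext := ih hv (live_succ.2 ⟨hlive, hchild⟩)
        rwa [tableAt, if_neg hpar, ← wanted_of_ne ht hchild hpar] at hnext

lemma Filled.realizes_wanted (h : Filled O σ (n - 1))
    (hr : entryCost n σ (tableAt O (n - 1) 0) r < n * n) {t v : ℕ} (ht : t ≤ n - 1) (hv : v < n)
    (hlive : Live O.child t v) :
    (O.size (tracedKeep O σ r) t v, O.kept (tracedKeep O σ r) t v) = wanted O σ r t v ∧
      O.cost (tracedKeep O σ r) t v = entryCost n σ (tableAt O t v) (wanted O σ r t v) := by
  induction t generalizing v with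
  | zero =>
    have hlt := h.entryCost_wanted_lt hr ht hv hlive
    rw [tableAt, h.leaf v hv] at hlt ⊢
    split_ifs at hlt ⊢ with hone
    · exact ⟨by rw [O.size_zero hv, hone]; rfl, rfl⟩
    · exact absurd hlt (lt_irrefl _)
  | succ t ih =>
    have hlt := h.entryCost_wanted_lt hr ht hv hlive
    obtain ⟨hlive, hchild⟩ := live_succ.1 hlive
    by_cases hpar : v = O.par t
    · subst hpar
      obtain ⟨hpair, hcost⟩ := ih (by omega) hv hlive
      obtain ⟨hpair', hcost'⟩ := ih (by omega) (O.child_lt ht) (O.child_live ht)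
      rw [tableAt, if_pos rfl] at hlt ⊢
      set e := wanted O σ r (t + 1) (O.par t) with he
      have hkeep : (tracedKeep O σ r t).toNat = σ .keep (cell (n + t) e) := by
        have := (h.combined t ht).keep_le e hlt
        rw [tracedKeep, ← he]
        interval_cases σ .keep (cell (n + t) e) <;> rfl
      have hjoin := (h.combined t ht).eq_join e hlt
      have hjoinCost := (h.combined t ht).eq_joinCost e hlt
      rw [← wanted_par ht, ← wanted_child ht, ← hpair, ← hpair', ← hkeep] at hjoin
      rw [joinCost, ← wanted_par ht, ← wanted_child ht, ← hcost, ← hcost', ← hkeep, ← hpair,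
        ← hpair'] at hjoinCost
      rw [O.size_succ_par ht, EliminationOrder.kept, EliminationOrder.cost,
        EliminationOrder.gather, EliminationOrder.gather, if_neg hchild, if_pos rfl,
        if_neg hchild, if_pos rfl]
      exact ⟨hjoin.symm, hjoinCost.symm⟩
    · rw [O.size_succ_of_ne hpar hchild, tableAt, if_neg hpar, ← wanted_of_ne ht hchild hpar,
        EliminationOrder.kept, EliminationOrder.cost, EliminationOrder.gather,
        EliminationOrder.gather, if_neg hchild, if_neg hpar, if_neg hchild, if_neg hpar]
      exact ih (by omega) hv hlive

/-- The state `τ` of the trace when steps `t` to `n - 2` have been undone: the labels of the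
eliminated vertices are related as `tracedKeep` demands, and `want` holds the wanted entries. -/
structure Traced (O : EliminationOrder n) (σ : Store Arr) (r : ℕ × ℕ) (τ : Store Arr) (t : ℕ) :
    Prop where
  io_zero : τ .io 0 = 0
  io_child : ∀ s, t ≤ s → s < n - 1 → τ .io (O.child s) =
    if tracedKeep O σ r s then τ .io (O.par s) else O.child s
  io_lt : ∀ v < n, Live O.child t v → τ .io v < n
  want_eq : ∀ v < n, Live O.child t v →
    τ .want v = sqPair (wanted O σ r t v).1 (wanted O σ r t v).2

lemma clamp_sqPair {a k : ℕ} (ha : a ≤ n) (hk : k ≤ n) : clamp n (sqPair a k) = sqPair a k := by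
  refine clamp_of_lt_pow (d := 4) le_rfl ?_
  have hsum : (a + k) * (a + k) ≤ (n + n) * (n + n) := by gcongr
  have hpow : (n + 2) ^ 4 = (n * n + 4 * n + 4) * (n * n + 4 * n + 4) := by ring
  rw [sqPair, hpow]
  nlinarith

lemma clamp_sqPair_digit [NeZero n] (q i j : ℕ) :
    clamp n (sqPair (digit n q i) (digit n q j)) = sqPair (digit n q i) (digit n q j) :=
  clamp_sqPair (Nat.mod_lt _ (NeZero.pos n)).le (Nat.mod_lt _ (NeZero.pos n)).le

lemma traceStep_run [NeZero n] {t : ℕ} {e : ℕ × ℕ} (ht : n - 2 - σ .step 0 = t)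
    (hpar : σ .par t = O.par t) (hchild : σ .child t = O.child t) (htn : t < n - 1)
    (hio : σ .io (O.par t) < n) (hwant : σ .want (O.par t) = sqPair e.1 e.2) :
    (∀ v, traceStep.run n σ .io v = if v = O.child t then
      if 0 < σ .keep (cell (n + t) e) then σ .io (O.par t) else O.child t else σ .io v) ∧
    ∀ v, traceStep.run n σ .want v =
      if v = O.child t then
        sqPair (lower n (σ .origin (cell (n + t) e))).1 (lower n (σ .origin (cell (n + t) e))).2
      else if v = O.par t then
        sqPair (upper n (σ .origin (cell (n + t) e))).1 (upper n (σ .origin (cell (n + t) e))).2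
      else σ .want v := by
  have hne := O.par_ne_child htn
  have hcell : sqPair (n + t) (sqPair e.1 e.2) = cell (n + t) e := rfl
  have hclampChild : clamp n (O.child t) = O.child t := clamp_of_le_self (O.child_lt htn).le
  have hclampIo : clamp n (σ .io (O.par t)) = σ .io (O.par t) := clamp_of_le_self hio.le
  by_cases hkeep : 0 < σ .keep (cell (n + t) e)
  all_goals
    simp only [traceStep, run_seq, run_ite, run_put, eval_get, eval_zero, eval_pair, eval_add,
      eval_sub, eval_len, eval_ofNat, eval_digitExpr, set_apply, reduceCtorEq, false_and, true_and,
      if_false, ht, hpar, hchild, hwant, hcell, hkeep, if_true, hclampChild, hclampIo,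
      clamp_sqPair_digit, hne, lower, upper]
    exact ⟨fun _ => trivial, fun v => by split_ifs <;> simp_all⟩

lemma Traced.pred [NeZero n] {τ : Store Arr} {t : ℕ} (h : Traced O σ r τ (t + 1))
    (ht : t < n - 1) (hstep : n - 2 - τ .step 0 = t) (hpar : τ .par = O.par)
    (hchild : τ .child = O.child) (hkeep : τ .keep = σ .keep) (horigin : τ .origin = σ .origin) :
    Traced O σ r (traceStep.run n τ) t := by
  obtain ⟨hio, hwant⟩ := traceStep_run hstep (congrFun hpar t) (congrFun hchild t) ht
    (h.io_lt _ (O.par_lt ht) (O.par_live ht)) (h.want_eq _ (O.par_lt ht) (O.par_live ht))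
  simp only [horigin, ← wanted_child ht, ← wanted_par ht] at hwant
  have hlabel : traceStep.run n τ .io (O.child t) =
      if tracedKeep O σ r t then τ .io (O.par t) else O.child t := by
    simp only [hio, if_true, hkeep, tracedKeep, decide_eq_true_eq]
  have hother {v : ℕ} (hv : v ≠ O.child t) : traceStep.run n τ .io v = τ .io v := by
    rw [hio, if_neg hv]
  refine ⟨?_, fun s hts hs => ?_, fun v hv hlive => ?_, fun v hv hlive => ?_⟩
  · rw [hother (O.live_zero t ht), h.io_zero]
  · rw [hother (O.par_live hs t (by omega))]
    rcases hts.eq_or_lt with rfl | hts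
    · exact hlabel
    · rw [hother (O.child_live hs t hts), h.io_child s hts hs]
  · by_cases hvchild : v = O.child t
    · rw [hvchild, hlabel]
      split_ifs
      exacts [h.io_lt _ (O.par_lt ht) (O.par_live ht), O.child_lt ht]
    · rw [hother hvchild]
      exact h.io_lt v hv (live_succ.2 ⟨hlive, hvchild⟩)
  · rw [hwant]
    split_ifs with hvchild hvpar
    · rw [hvchild]
    · rw [hvpar]
    · rw [wanted_of_ne ht hvchild hvpar]
      exact h.want_eq v hv (live_succ.2 ⟨hlive, hvchild⟩)

lemma Filled.isOptimal [NeZero n] {T : SimpleGraph (Fin n)} (h : Filled O σ (n - 1))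
    (hO : O.Follows T) (hT : T.IsTree) (hkept : r.2 < n)
    (hcost : entryCost n σ (tableAt O (n - 1) 0) r = leastCost n σ (tableAt O (n - 1) 0) r.2)
    (hmin : ∀ k < n,
      tailNum (n.choose 2) (n - 1) (leastCost n σ (tableAt O (n - 1) 0) r.2) r.2 ≤
        tailNum (n.choose 2) (n - 1) (leastCost n σ (tableAt O (n - 1) 0) k) k) :
    IsOptimal T (ofLabel fun w : Fin n => O.rep (tracedKeep O σ r) (n - 1) w) := by
  have hn := NeZero.pos n
  have hlt : entryCost n σ (tableAt O (n - 1) 0) r < n * n :=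
    calc entryCost n σ (tableAt O (n - 1) 0) r
        ≤ n.choose 2 := hcost.trans_le (h.leastCost_root_le_choose hkept)
      _ = n * (n - 1) / 2 := n.choose_two_right
      _ ≤ n * (n - 1) := Nat.div_le_self _ _
      _ < n * n := by gcongr; omega
  obtain ⟨hpair, hroot⟩ := h.realizes_wanted hlt le_rfl hn O.live_zero
  rw [wanted, if_neg (lt_irrefl _)] at hpair hroot
  have hkept' : O.kept (tracedKeep O σ r) (n - 1) 0 = r.2 := congrArg Prod.snd hpair
  refine hO.isOptimal hT (best := leastCost n σ (tableAt O (n - 1) 0))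
    (h.leastCost_root_le hn) ?_ ?_
  · rw [hkept', hroot, hcost]
  · rwa [hkept']

lemma traceBack_spec [NeZero n] (hpar : σ .par = O.par) (hchild : σ .child = O.child)
    (hsize : σ .bestSize 0 ≤ n) (hkept : σ .bestKept 0 ≤ n) {v : ℕ} (hv : v < n) :
    traceBack.run n σ .io v =
      O.rep (tracedKeep O σ (σ .bestSize 0, σ .bestKept 0)) (n - 1) v := by
  set r := (σ .bestSize 0, σ .bestKept 0)
  let τ₀ := (Stmt.put Arr.want 0 (.pair Arr.bestSize Arr.bestKept) ;; .put .io 0 0).run n σ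
  have hinit : Traced O σ r τ₀ (n - 1) := by
    have hzero : clamp n 0 = 0 := clamp_of_le_self n.zero_le
    have hclamp : clamp n (sqPair (σ .bestSize 0) (σ .bestKept 0)) = sqPair r.1 r.2 :=
      clamp_sqPair hsize hkept
    refine ⟨hzero, fun s hs hs' => absurd hs' hs.not_gt, fun v hv hlive => ?_,
      fun v hv hlive => ?_⟩
    · rw [O.eq_zero_of_live hv hlive]
      exact hzero.trans_lt (NeZero.pos n)
    · rw [O.eq_zero_of_live hv hlive, wanted, if_neg (lt_irrefl _)]
      exact hclamp
  have hfinal : Traced O σ r (traceBack.run n σ) (n - 1 - (n - 1)) := by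
    refine Stmt.loop_inv (σ := τ₀) (n - 1) (by omega) rfl (by simp)
      (fun i τ => Traced O σ r τ (n - 1 - i)) hinit fun i τ hi hτ htraced => ?_
    have hset : Traced O σ r (τ.set .step 0 i) (n - 1 - (i + 1) + 1) := by
      rw [show n - 1 - (i + 1) + 1 = n - 1 - i by omega]
      exact ⟨htraced.io_zero, htraced.io_child, htraced.io_lt, htraced.want_eq⟩
    exact hset.pred (by omega) (by rw [set_apply, if_pos ⟨rfl, rfl⟩]; omega)
      ((hτ .par rfl).trans hpar) ((hτ .child rfl).trans hchild) (hτ .keep rfl) (hτ .origin rfl)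
  exact O.eq_rep hfinal.io_zero (fun t ht => hfinal.io_child t (by omega) ht) hv

end Trace

/-! ### The algorithm -/

/-- Compute the labels of a surprise optimal clustering of a tree. -/
def optimalClustering : Stmt Arr := orderEdges ;; fillTables ;; chooseBest ;; traceBack

lemma optimalClustering_deg : optimalClustering.deg = 5 := by decide

lemma optimalClustering_spec {n : ℕ} [NeZero n] {T : SimpleGraph (Fin n)} {mem : ℕ → ℕ}
    (hT : T.IsTree) (hmem : HoldsEdges T mem) :
    IsOptimal T (ofLabel fun w : Fin n => optimalClustering.run n (startStore mem) .io w) := by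
  set σ := orderEdges.run n (startStore mem)
  obtain ⟨hord, h0⟩ : PartialOrdering T σ ∧ σ .left 0 = 0 :=
    orderEdges_spec (σ := startStore mem) hT.connected hmem fun _ => rfl
  have hgain (i : ℕ) : σ .gain i = 0 :=
    congrFun (Stmt.run_of_not_writes (P := orderEdges) rfl) i
  let O := hord.eliminationOrder h0
  have hfollows : O.Follows T := fun t ht => hord.adj t (by omega) ht
  set τ := fillTables.run n σ
  obtain ⟨hfilled, htable⟩ : Filled O τ (n - 1) ∧ ∀ v < n, τ .table v = tableAt O (n - 1) v :=
    fillTables_spec rfl rfl hgain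
  have hroot := htable 0 (NeZero.pos n)
  set ρ := chooseBest.run n τ
  have hbest : BestBelow n τ ρ n := chooseBest_spec fun k hk =>
    hroot ▸ hfilled.leastCost_root_le_choose hk
  have hframe (b : Arr) (hb : chooseBest.writes b = false) : ρ b = τ b :=
    Stmt.run_of_not_writes hb
  have hrun : ∀ v < n, optimalClustering.run n (startStore mem) .io v =
      O.rep (tracedKeep O ρ (ρ .bestSize 0, ρ .bestKept 0)) (n - 1) v := fun v hv =>
    traceBack_spec ((hframe .par rfl).trans (Stmt.run_of_not_writes rfl))
      ((hframe .child rfl).trans (Stmt.run_of_not_writes rfl)) hbest.bestSize_le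
      hbest.bestKept_lt.le hv
  have hlabels : (fun w : Fin n => optimalClustering.run n (startStore mem) .io w) =
      fun w : Fin n => O.rep (tracedKeep O ρ (ρ .bestSize 0, ρ .bestKept 0)) (n - 1) w :=
    funext fun w => hrun w w.2
  have hfilled' : Filled O ρ (n - 1) := hfilled.congr le_rfl fun i _ =>
    sameTable_of_eq i (hframe .gain rfl).symm (hframe .keep rfl).symm (hframe .origin rfl).symm
  rw [hlabels]
  refine hfilled'.isOptimal hfollows hT hbest.bestKept_lt ?_ ?_
  all_goals rw [← hroot, leastCost_congr (hframe .gain rfl)]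
  · rw [entryCost_congr (hframe .gain rfl)]
    exact hbest.cost_eq
  · exact hbest.leastTail_le

end LoopLang

namespace WordRAM
open Surprise LoopLang

section Input
variable {n : ℕ} (L : List (Fin n × Fin n))

lemma getD_flatMap_pair {j : ℕ} (hj : j < L.length) (d : ℕ) :
    (L.flatMap fun q => [(q.1 : ℕ), (q.2 : ℕ)]).getD (2 * j) d = L[j].1 ∧
      (L.flatMap fun q => [(q.1 : ℕ), (q.2 : ℕ)]).getD (2 * j + 1) d = L[j].2 := by
  induction L generalizing j with
  | nil => exact absurd hj j.not_lt_zero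
  | cons q L ih =>
    cases j with
    | zero => exact ⟨rfl, rfl⟩
    | succ j => exact ih (Nat.lt_of_succ_lt_succ hj)

lemma initState_mem_pair {j : ℕ} (hj : j < L.length) :
    (initState L).mem (2 * j + 1) = L[j].1 ∧ (initState L).mem (2 * j + 2) = L[j].2 :=
  getD_flatMap_pair L hj 0

lemma length_inputWords : (inputWords L).length = 2 * L.length + 1 := by
  simp [inputWords, List.length_flatMap, mul_comm]

lemma initState_mem_eq_zero {i : ℕ} (hi : 2 * L.length + 1 ≤ i) : (initState L).mem i = 0 :=
  List.getD_eq_default _ _ (by rwa [length_inputWords])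

lemma le_of_mem_inputWords {x : ℕ} (hx : x ∈ inputWords L) : x ≤ n := by
  simp only [inputWords, List.mem_cons, List.mem_flatMap, List.not_mem_nil, or_false] at hx
  rcases hx with rfl | ⟨q, -, rfl | rfl⟩
  exacts [le_rfl, q.1.is_lt.le, q.2.is_lt.le]

lemma initState_mem_le (i : ℕ) : (initState L).mem i ≤ n := by
  change (inputWords L).getD i 0 ≤ n
  rcases lt_or_ge i (inputWords L).length with hi | hi
  · rw [List.getD_eq_getElem _ _ hi]
    exact le_of_mem_inputWords L (List.getElem_mem hi)
  · rw [List.getD_eq_default _ _ hi]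
    exact n.zero_le

variable {L} {T : SimpleGraph (Fin n)}

lemma IsEdgeList.length_eq (hL : IsEdgeList T L) (hT : T.IsTree) : L.length = n - 1 := by
  classical
  have hedges : T.edgeSet = ((L.map fun q => s(q.1, q.2)).toFinset : Set (Sym2 (Fin n))) := by
    ext e
    rw [← hL.2 e, Finset.mem_coe, List.mem_toFinset]
  rw [← ncard_edgeSet_of_isTree hT, hedges, Set.ncard_coe_finset,
    List.toFinset_card_of_nodup hL.1, List.length_map]

lemma IsEdgeList.holdsEdges [NeZero n] (hL : IsEdgeList T L) (hT : T.IsTree) :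
    HoldsEdges T (initState L).mem := by
  have hlen := hL.length_eq hT
  refine ⟨fun j hj => ?_, fun j hj => ?_, fun u v huv => ?_⟩
  · obtain ⟨hfst, hsnd⟩ := initState_mem_pair L (j := j) (by omega)
    rw [hfst, hsnd]
    exact ⟨Fin.is_lt _, Fin.is_lt _⟩
  · obtain ⟨hfst, hsnd⟩ := initState_mem_pair L (j := j) (by omega)
    rw [hfst, hsnd, Fin.ofNat_val_eq_self, Fin.ofNat_val_eq_self, ← SimpleGraph.mem_edgeSet,
      ← hL.2]
    exact List.mem_map_of_mem (List.getElem_mem _)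
  · rw [← SimpleGraph.mem_edgeSet, ← hL.2] at huv
    obtain ⟨q, hq, heq⟩ := List.mem_map.1 huv
    obtain ⟨j, hj, rfl⟩ := List.getElem_of_mem hq
    obtain ⟨hfst, hsnd⟩ := initState_mem_pair L hj
    refine ⟨j, by omega, ?_⟩
    rw [hfst, hsnd]
    rcases Sym2.eq_iff.1 heq with ⟨rfl, rfl⟩ | ⟨rfl, rfl⟩
    exacts [.inl ⟨rfl, rfl⟩, .inr ⟨rfl, rfl⟩]

end Input

end WordRAM

/-- There is a word RAM program (with words of `O(log n)` bits, that is, with word bound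
polynomial in `n`) that on every tree with `n` vertices halts after `O(n ^ 5)` steps and outputs
a clustering of optimal surprise. -/
theorem theorem14 :
    ∃ (P : WordRAM.Prog) (c K : ℕ),
      ∀ (n : ℕ) (T : SimpleGraph (Fin n)), T.IsTree →
        ∀ L : List (Fin n × Fin n), WordRAM.IsEdgeList T L →
          ∃ (t : ℕ) (s : WordRAM.State),
            WordRAM.Runs ((n + 2) ^ c) P (WordRAM.initState L) t s ∧
            t ≤ K * n ^ 5 ∧
            ∃ ζ : Finpartition (Finset.univ : Finset (Fin n)),
              WordRAM.Outputs s ζ ∧ Surprise.IsOptimal T ζ := by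
  obtain ⟨P, c, K, hP⟩ := LoopLang.optimalClustering.exists_prog
  refine ⟨P, c, K, fun n T hT L hL => ?_⟩
  have hn : 0 < n := Fin.pos hT.connected.nonempty.some
  have : NeZero n := ⟨hn.ne'⟩
  have hlen := hL.length_eq hT
  obtain ⟨t, s, hrun, ht, hmem⟩ := hP n (WordRAM.initState L) hn rfl (fun _ => rfl)
    (WordRAM.initState_mem_le L) fun i hi => WordRAM.initState_mem_eq_zero L (by omega)
  rw [LoopLang.optimalClustering_deg] at ht
  refine ⟨t, s, hrun, ht, _, fun u v => ?_,
    LoopLang.optimalClustering_spec hT (hL.holdsEdges hT)⟩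
  rw [Surprise.part_ofLabel_eq_iff, hmem u (by omega), hmem v (by omega), LoopLang.default_arr]
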